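/- **Setting.** Let $(X_{t,T})_{t\in\mathbb Z,\,T\in\mathbb N^*}$ be an array of real random variables on a probability space with $\mathbb E X_{t,T}=0$ and finite variances $\sigma_{t,T}^2$. Assume: 1. (*Local stationarity*) there are a local spectral density $f:\mathbb R^2\to[0,\infty)$, which is $2\pi$-periodic and locally integrable in its second argument, and a constant $C\ge 0$ such that, with $\gamma_k(u)=\int_{-\pi}^{\pi}e^{ik\lambda}f(u,\lambda)\,d\lambda$, $|\mathrm{Cov}(X_{t,T},X_{t-k,T})-\gamma_k(t/T)|\le C/T$ for all $t,k\in\mathbb Z$, $T\in\mathbb N^*$; 2. (*Geometric $\alpha$-mixing*) there are $K>0$, $\rho>1$ with $\alpha(n)\le K\rho^{-n}$ for all $n\ge1$, where $\alpha(n)$ is the supremum of $|\mathbb P(A\cap B)-\mathbb P(A)\mathbb P(B)|$ over $T\in\mathbb N^*$, $t\in\mathbb Z$, $A\in\sigma(X_{s,T}:s\le t)$, $B\in\sigma(X_{s,T}:s\ge t+n)$; 3. $0<m_f\le f(u,\lambda)\le M_f$ for all $u,\lambda$; 4. $f$ is continuously differentiable in $u$ and $|\partial_u f(u,\lambda)|\le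 M_f'$ for all $u,\lambda$, where $M_f'\ge 0$; 5. (*Bernstein-type condition*) there are $c>0$, $d\ge 1/2$ with $\mathbb E|X_{t,T}|^k\le c^{k-2}(k!)^d\sigma_{t,T}^2$ for $t=1,\dots,T$ and $k=2,3,\dots$. Put $C_0=(2\pi)^{1/2}M_f/m_f$, $C_1=(2\pi M_f'+C)/m_f$, $$C_{1,1}=12\cdot2^{8d+9}\max\{c^2,3\pi M_f\}^2\,e\,\Big(1+\frac1{\log\rho}\Big)(1+K^{1/2}),\qquad C_{2,1}=12\cdot 2^{3(d+1)}\max\{c^2,3\pi M_f\}\,e\,\Big(1+\frac1{\log\rho}\Big).$$ For $p\ge1$, $N\ge p+1$ let $$\hat\gamma_{k;N,T}(t)=\frac1{N-|k|}\sum_{\ell=t-N+|k|+1}^{t}X_{\ell-|k|,T}X_{\ell,T},\qquad \hat\Gamma=[\hat\gamma_{i-j;N,T}(t)]_{i,j=1}^p,\qquad \hat\gamma=(\hat\gamma_{1;N,T}(t),\dots,\hat\gamma_{p;N,T}(t))',$$ and let $\hat a=\hat\Gamma^{-1}\hat\gamma$ be the localised Yule–Walker estimator $\hat a^{(p)}_{N,T}(t)$,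 and $\bar a=(\mathbb E\hat\Gamma)^{-1}\mathbb E\hat\gamma$ its population counterpart $\bar a^{(p)}_{N,T}(t)$. Let $\|\cdot\|$ be the Euclidean norm. **Theorem.** Let $p\ge 1$, $N\ge p+1$, $T\ge 2C_1p^2$, $N\le t\le T$ and $\varepsilon>0$. Then $\mathbb E\hat\Gamma$ is invertible and, with $\eta:=\frac{m_f}{4p}\min\{1,\frac{\varepsilon}{8C_0}\}$, $$\mathbb P(\|\hat a-\bar a\|>\varepsilon)\ \le\ B_\varepsilon:=3p\exp\Bigg(-\frac{\eta^2}{2\Big(C_{1,1}\frac p{N-p}+\eta^{(3+4d)/(2+2d)}\big(C_{2,1}\frac p{N-p}\big)^{1/(2+2d)}\Big)}\Bigg),$$ where outcomes at which $\hat\Gamma$ is singular (so that $\hat a$ is undefined) are counted as belonging to the event on the left. Moreover, with $$U_{p,N}:=\frac{32C_0}{m_f}\Big(\frac{C_{1,1}^{2+2d}}{C_{2,1}}\Big)^{1/(3+4d)}\frac{p^{(4+6d)/(3+4d)}}{(N-p)^{(1+2d)/(3+4d)}},$$ $$B_\varepsilon\le\begin{cases} 3p\exp\Bigg(-\dfrac{m_f^2}{32C_{1,1}\frac{p^3}{N-p}+m_f^{(3+4d)/(2+2d)}\big(2^{4+2d}C_{2,1}\frac{p^2}{N-p}\big)^{1/(2+2d)}}\Bigg)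 & \text{if }\varepsilon\ge 8C_0,\\[3mm] 3p\exp\Big(-\varepsilon^2\dfrac{m_f^2}{2^{12}C_{1,1}}\Big(C_0^2\dfrac{p^3}{N-p}\Big)^{-1}\Big) & \text{if }\varepsilon\le\min\{U_{p,N},8C_0\},\\[3mm] 3p\exp\Big(-\varepsilon^{1/(2+2d)}\Big(\dfrac{m_f}{2^{9+4d}C_{2,1}}\Big)^{1/(2+2d)}\Big(C_0\dfrac{p^2}{N-p}\Big)^{-1/(2+2d)}\Big) & \text{if }8C_0>\varepsilon\ge\min\{U_{p,N},8C_0\}. \end{cases}$$ -/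

import Mathlib

open MeasureTheory ProbabilityTheory

noncomputable section

namespace LocalYW

variable {Ω : Type*} [MeasurableSpace Ω]

/-! ### The assumptions. An array `(X_{t,T})`, `t ∈ ℤ`, `T = 1, 2, …`, is a function `X t T ω`;
the value at `T = 0` is never used. -/

/-- A local spectral density: a nonnegative function of `(u, lam)`, `2π`-periodic and locally
integrable in the second variable. -/
structure IsLocalSpectralDensity (f : ℝ → ℝ → ℝ) : Prop where
  nonneg : ∀ u lam, 0 ≤ f u lam
  periodic : ∀ u, Function.Periodic (f u) (2 * Real.pi)
  locallyIntegrable : ∀ u, LocallyIntegrable (f u) volume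

/-- The local covariance function `γ_k(u) = ∫_{-π}^{π} e^{i k lam} f(u, lam) d lam`. -/
def localCov (f : ℝ → ℝ → ℝ) (k : ℤ) (u : ℝ) : ℂ :=
  ∫ lam in (-Real.pi)..Real.pi, Complex.exp (Complex.I * k * lam) * (f u lam : ℂ)

/-- The array consists of random variables with finite variances and is locally stationary with
local spectral density `f` and constant `C`. -/
structure IsLocallyStationary (μ : Measure Ω) (X : ℤ → ℕ → Ω → ℝ) (f : ℝ → ℝ → ℝ) (C : ℝ) :
    Prop where
  measurable : ∀ t T, 1 ≤ T → Measurable (X t T)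
  memLp : ∀ t T, 1 ≤ T → MemLp (X t T) 2 μ
  density : IsLocalSpectralDensity f
  const_nonneg : 0 ≤ C
  cov_approx : ∀ (t k : ℤ) (T : ℕ), 1 ≤ T →
    ‖((covariance (X t T) (X (t - k) T) μ : ℝ) : ℂ) - localCov f k ((t : ℝ) / T)‖ ≤ C / T

/-- `σ(X_{s,T} : s ≤ t)`. -/
abbrev pastSigma (X : ℤ → ℕ → Ω → ℝ) (T : ℕ) (t : ℤ) : MeasurableSpace Ω :=
  ⨆ s : {s : ℤ // s ≤ t}, MeasurableSpace.comap (X s T) inferInstance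

/-- `σ(X_{s,T} : s ≥ t)`. -/
abbrev futureSigma (X : ℤ → ℕ → Ω → ℝ) (T : ℕ) (t : ℤ) : MeasurableSpace Ω :=
  ⨆ s : {s : ℤ // t ≤ s}, MeasurableSpace.comap (X s T) inferInstance

/-- The strong mixing coefficient `α(k)`: the supremum over `T ≥ 1`, `t ∈ ℤ`,
`A ∈ σ(X_{s,T} : s ≤ t)` and `B ∈ σ(X_{s,T} : s ≥ t + k)` of `|P(A ∩ B) - P(A) P(B)|`. For a
probability measure the set is nonempty and bounded. -/
def alphaMixing (μ : Measure Ω) (X : ℤ → ℕ → Ω → ℝ) (k : ℕ) : ℝ :=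
  sSup {r : ℝ | ∃ (T : ℕ) (t : ℤ) (A B : Set Ω), 1 ≤ T ∧
    MeasurableSet[pastSigma X T t] A ∧ MeasurableSet[futureSigma X T (t + k)] B ∧
    r = |μ.real (A ∩ B) - μ.real A * μ.real B|}

/-- Geometric `α`-mixing with constants `K > 0` and `ρ > 1`. -/
structure IsGeomMixing (μ : Measure Ω) (X : ℤ → ℕ → Ω → ℝ) (K ρ : ℝ) : Prop where
  K_pos : 0 < K
  one_lt_rho : 1 < ρ
  bound : ∀ n : ℕ, 1 ≤ n → alphaMixing μ X n ≤ K * (ρ ^ n)⁻¹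

/-- `0 < m_f ≤ |f(u, lam)| ≤ M_f`. -/
structure DensityBounded (f : ℝ → ℝ → ℝ) (mf Mf : ℝ) : Prop where
  pos : 0 < mf
  lower : ∀ u lam, mf ≤ |f u lam|
  upper : ∀ u lam, |f u lam| ≤ Mf

/-- `f` is continuously differentiable in its first argument and the partial derivative is
bounded by `M'_f ≥ 0`. -/
structure DensityDerivBounded (f : ℝ → ℝ → ℝ) (Mf' : ℝ) : Prop where
  nonneg : 0 ≤ Mf'
  contDiff : ∀ lam, ContDiff ℝ 1 (fun u => f u lam)
  bound : ∀ u lam, |deriv (fun v => f v lam) u| ≤ Mf'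

/-- The Bernstein-type moment condition with constants `c > 0` and `d ≥ 1/2`:
`E|X_{t,T}|^k ≤ c^{k-2} (k!)^d Var(X_{t,T})` for `t = 1, …, T` and `k = 2, 3, …`. -/
structure BernsteinCond (μ : Measure Ω) (X : ℤ → ℕ → Ω → ℝ) (c d : ℝ) : Prop where
  c_pos : 0 < c
  half_le_d : 1 / 2 ≤ d
  integrable : ∀ (T : ℕ) (t : ℤ) (k : ℕ), 1 ≤ t → t ≤ T → 2 ≤ k →
    Integrable (fun ω => |X t T ω| ^ k) μ
  bound : ∀ (T : ℕ) (t : ℤ) (k : ℕ), 1 ≤ t → t ≤ T → 2 ≤ k →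
    ∫ ω, |X t T ω| ^ k ∂μ ≤ c ^ (k - 2) * (k.factorial : ℝ) ^ d * variance (X t T) μ

/-! ### The localised Yule–Walker estimator -/

/-- `γ̂_{k;N,T}(t) = (N-|k|)⁻¹ ∑_{ℓ = t-N+|k|+1}^{t} X_{ℓ-|k|,T} X_{ℓ,T}`. -/
def gammaHat (X : ℤ → ℕ → Ω → ℝ) (N T : ℕ) (t k : ℤ) (ω : Ω) : ℝ :=
  (1 / ((N : ℝ) - |(k : ℝ)|)) *
    ∑ l ∈ Finset.Icc (t - N + |k| + 1) t, X (l - |k|) T ω * X l T ω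

/-- `Γ̂^{(p)}_{N,T}(t) = [γ̂_{i-j;N,T}(t)]_{i,j = 1,…,p}`. -/
def GammaHat (X : ℤ → ℕ → Ω → ℝ) (p N T : ℕ) (t : ℤ) (ω : Ω) : Matrix (Fin p) (Fin p) ℝ :=
  Matrix.of fun i j => gammaHat X N T t ((i : ℤ) - (j : ℤ)) ω

/-- `γ̂^{(p)}_{N,T}(t) = (γ̂_{1;N,T}(t), …, γ̂_{p;N,T}(t))'`. -/
def gammaHatVec (X : ℤ → ℕ → Ω → ℝ) (p N T : ℕ) (t : ℤ) (ω : Ω) : Fin p → ℝ :=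
  fun i => gammaHat X N T t ((i : ℤ) + 1) ω

/-- `E Γ̂^{(p)}_{N,T}(t)`, entrywise. -/
def EGammaHat (μ : Measure Ω) (X : ℤ → ℕ → Ω → ℝ) (p N T : ℕ) (t : ℤ) :
    Matrix (Fin p) (Fin p) ℝ :=
  Matrix.of fun i j => ∫ ω, GammaHat X p N T t ω i j ∂μ

/-- `E γ̂^{(p)}_{N,T}(t)`, entrywise. -/
def EgammaHatVec (μ : Measure Ω) (X : ℤ → ℕ → Ω → ℝ) (p N T : ℕ) (t : ℤ) : Fin p → ℝ :=
  fun i => ∫ ω, gammaHatVec X p N T t ω i ∂μ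

/-- The localised Yule–Walker estimator `â^{(p)}_{N,T}(t) = Γ̂⁻¹ γ̂`. -/
def aHat (X : ℤ → ℕ → Ω → ℝ) (p N T : ℕ) (t : ℤ) (ω : Ω) : EuclideanSpace ℝ (Fin p) :=
  WithLp.toLp 2 ((GammaHat X p N T t ω)⁻¹.mulVec (gammaHatVec X p N T t ω))

/-- Its population counterpart `ā^{(p)}_{N,T}(t) = (E Γ̂)⁻¹ E γ̂`. -/
def aBar (μ : Measure Ω) (X : ℤ → ℕ → Ω → ℝ) (p N T : ℕ) (t : ℤ) : EuclideanSpace ℝ (Fin p) :=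
  WithLp.toLp 2 ((EGammaHat μ X p N T t)⁻¹.mulVec (EgammaHatVec μ X p N T t))

/-! ### The constants -/

/-- `C_0 = (2π)^{1/2} M_f / m_f`. -/
def const0 (mf Mf : ℝ) : ℝ := Real.sqrt (2 * Real.pi) * Mf / mf

/-- `C_1 = (2π M'_f + C) / m_f`. -/
def const1 (mf Mf' C : ℝ) : ℝ := (2 * Real.pi * Mf' + C) / mf

/-- `C_{1,a} = 12 · 2^{8ad+9} (a!)^{4d} max{c², 3πM_f}^{2a} e (1 + 1/log ρ)(1 + K^{1/2})`. -/
def const1a (a : ℕ) (Mf c d K ρ : ℝ) : ℝ :=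
  12 * (2 : ℝ) ^ (8 * (a : ℝ) * d + 9) * (a.factorial : ℝ) ^ (4 * d) *
    (max (c ^ 2) (3 * Real.pi * Mf)) ^ (2 * a) * Real.exp 1 * (1 + 1 / Real.log ρ) *
    (1 + Real.sqrt K)

/-- `C_{2,a} = 12 · 2^{3(ad+1)} (a!)^{2d} max{c², 3πM_f}^{a} e (1 + 1/log ρ)`. -/
def const2a (a : ℕ) (Mf c d ρ : ℝ) : ℝ :=
  12 * (2 : ℝ) ^ (3 * ((a : ℝ) * d + 1)) * (a.factorial : ℝ) ^ (2 * d) *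
    (max (c ^ 2) (3 * Real.pi * Mf)) ^ a * Real.exp 1 * (1 + 1 / Real.log ρ)

/-- `η = (m_f / (4p)) min{1, ε / (8 C_0)}`. -/
def etaYW (mf C0 : ℝ) (p : ℕ) (ε : ℝ) : ℝ :=
  mf / (4 * p) * min 1 (ε * (1 / (8 * C0)))

/-- The exponential bound
`3p exp(- η² / (2 (C_{1,1} p/(N-p) + η^{(3+4d)/(2+2d)} (C_{2,1} p/(N-p))^{1/(2+2d)})))`. -/
def boundYW (mf C0 C11 C21 d : ℝ) (p N : ℕ) (ε : ℝ) : ℝ :=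
  3 * p * Real.exp (-(etaYW mf C0 p ε ^ 2 /
    (2 * (C11 * ((p : ℝ) / ((N : ℝ) - p)) +
      etaYW mf C0 p ε ^ ((3 + 4 * d) / (2 + 2 * d)) *
        (C21 * ((p : ℝ) / ((N : ℝ) - p))) ^ (1 / (2 + 2 * d))))))

/-- `U_{p,N}`, the threshold between the second and the third regime. -/
def threshU (mf C0 C11 C21 d : ℝ) (p N : ℕ) : ℝ :=
  32 * C0 / mf * (C11 ^ (2 + 2 * d) / C21) ^ (1 / (3 + 4 * d)) *
    ((p : ℝ) ^ ((4 + 6 * d) / (3 + 4 * d)) /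
      ((N : ℝ) - p) ^ ((1 + 2 * d) / (3 + 4 * d)))

end LocalYW

end

/-! The estimator solves a linear system whose entries are the empirical covariances at lags `0, …,
p`. It therefore suffices to have a stability estimate for such systems and an exponential
inequality for each single lag, joined by a union bound over `p + 1 ≤ 3p` lags.

Deterministic part. The expected empirical covariances differ by at most `mf / (2p)` from the local
covariances averaged over the window (`abs_integral_gammaHat_sub_windowCov_le`, `bias_le`). The
matrix of these averages has quadratic form at least `2π mf |v|²`, because the form integrates `|∑
v_j e^{ij lam}|²` against `f` (`le_sum_sum_mul_realCov`). Hence the expected matrix is coercive. If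
every empirical covariance is within `16η` of its mean, the random matrix stays coercive, and
`euclNorm_inv_mulVec_sub_le` puts the two solutions within `ε` of each other (`estimator_close`).

Probabilistic part. The centred products `X_{ℓ-k} X_ℓ` form a mixing sequence in which a gap is
shortened by the lag `k` (`isMixingSequence_products`). The `q`-th moment of their sum is expanded
over sorted index lists. Each mixed moment is cut at a gap where the mixing rate is at most the
geometric mean over all gaps, so the covariance paid there can be charged to all gaps at once
(`exists_cut_le_gapProd`). Cutting repeatedly leads to decompositions into consecutive clusters
(`abs_integral_prod_le_clusterSum`), with no singletons because the variables are centred. Inside a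
cluster each gap sums to a constant independent of the sample size, and a generating function
argument (`sortedSum_clusterSum_le`) gives the bound `q! z^{-q} w^n` for the moment. Covariances
across a gap are controlled by the cube root of the mixing rate and third moments
(`abs_covariance_le`).

Markov's inequality with `q` of order `A` and `z = q / (x n)` yields probability at most `exp (-A)`
under two conditions, a Gaussian and a heavy-tailed one (`measureReal_lt_abs_sum_le`). The two terms
in the denominator of `boundYW` deliver exactly these conditions (`le_of_exponent`). The three
regimes are algebra: they record which term of that denominator dominates. -/

namespace LocalYW

/-! ### Sums over sorted lists -/

/-- The sum of `F` over all weakly increasing lists of length `q` with entries in `[s, n)`. -/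
def sortedSum (n : ℕ) : ℕ → ℕ → (List ℕ → ℝ) → ℝ
  | 0, _, F => F []
  | q + 1, s, F => ∑ i ∈ Finset.Ico s n, sortedSum n q i (fun J => F (i :: J))

theorem sortedSum_mono {n : ℕ} (q s : ℕ) {F G : List ℕ → ℝ}
    (h : ∀ J : List ℕ, J.length = q → J.Pairwise (· ≤ ·) → (∀ x ∈ J, s ≤ x ∧ x < n) →
      F J ≤ G J) :
    sortedSum n q s F ≤ sortedSum n q s G := by
  induction q generalizing s F G with
  | zero => exact h [] rfl List.Pairwise.nil (by simp)
  | succ q ih =>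
    refine Finset.sum_le_sum fun i hi => ih i fun J hJ hJs hJm => ?_
    rw [Finset.mem_Ico] at hi
    refine h _ (by simp [hJ]) (List.pairwise_cons.2 ⟨fun x hx => (hJm x hx).1, hJs⟩) ?_
    intro x hx
    rcases List.mem_cons.1 hx with rfl | hx
    · exact hi
    · exact ⟨hi.1.trans (hJm x hx).1, (hJm x hx).2⟩

theorem sortedSum_nonneg {n : ℕ} (q s : ℕ) {F : List ℕ → ℝ} (h : ∀ J, 0 ≤ F J) :
    0 ≤ sortedSum n q s F := by
  induction q generalizing s F with
  | zero => exact h []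
  | succ q ih => exact Finset.sum_nonneg fun i _ => ih i fun J => h _

theorem sortedSum_antitone {n : ℕ} (q : ℕ) {s s' : ℕ} (hs : s ≤ s') {F : List ℕ → ℝ}
    (h : ∀ J, 0 ≤ F J) : sortedSum n q s' F ≤ sortedSum n q s F := by
  cases q with
  | zero => exact le_rfl
  | succ q =>
    exact Finset.sum_le_sum_of_subset_of_nonneg (Finset.Ico_subset_Ico_left hs)
      fun i _ _ => sortedSum_nonneg _ _ fun J => h _

theorem sortedSum_sum {n : ℕ} {ι : Type*} (t : Finset ι) (q s : ℕ) (F : ι → List ℕ → ℝ) :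
    sortedSum n q s (fun J => ∑ i ∈ t, F i J) = ∑ i ∈ t, sortedSum n q s (F i) := by
  induction q generalizing s F with
  | zero => rfl
  | succ q ih =>
    simp only [sortedSum, ih]
    exact Finset.sum_comm

theorem sortedSum_const_mul {n : ℕ} (a : ℝ) (q s : ℕ) (F : List ℕ → ℝ) :
    sortedSum n q s (fun J => a * F J) = a * sortedSum n q s F := by
  induction q generalizing s F with
  | zero => rfl
  | succ q ih => simp only [sortedSum, ih, Finset.mul_sum]

/-- Cutting each list after its first `m` entries. -/
theorem sortedSum_take_drop_le {n : ℕ} (m q s : ℕ) {F G : List ℕ → ℝ}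
    (hF : ∀ J, 0 ≤ F J) (hG : ∀ J, 0 ≤ G J) :
    sortedSum n (m + q) s (fun J => F (J.take m) * G (J.drop m)) ≤
      sortedSum n m s F * sortedSum n q s G := by
  induction m generalizing s F with
  | zero => simp only [List.take_zero, List.drop_zero, Nat.zero_add, sortedSum_const_mul]; rfl
  | succ m ih =>
    rw [Nat.add_right_comm]
    simp only [sortedSum, List.take_succ_cons, List.drop_succ_cons, Finset.sum_mul]
    refine Finset.sum_le_sum fun i hi => (ih i fun J => hF _).trans ?_
    -- The tail really starts at `i` or later. Letting it start at `s` only adds nonnegative terms,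
    -- and this is what decouples the two factors.
    exact mul_le_mul_of_nonneg_left (sortedSum_antitone q (Finset.mem_Ico.1 hi).1 hG)
      (sortedSum_nonneg _ _ fun J => hF _)

theorem sortedSum_succ_of_lt {n : ℕ} (q : ℕ) {s : ℕ} (hs : s < n) (F : List ℕ → ℝ) :
    sortedSum n (q + 1) s F =
      sortedSum n q s (fun J => F (s :: J)) + sortedSum n (q + 1) (s + 1) F := by
  simp only [sortedSum]
  rw [Finset.sum_eq_sum_Ico_succ_bot hs]

/-- Splitting off the multiplicity of the smallest admissible entry. -/
theorem sortedSum_eq_sum_replicate {n : ℕ} (q : ℕ) {s : ℕ} (hs : s < n) (F : List ℕ → ℝ) :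
    sortedSum n q s F = ∑ j ∈ Finset.range (q + 1),
      sortedSum n (q - j) (s + 1) (fun J => F (List.replicate j s ++ J)) := by
  induction q generalizing F with
  | zero => simp [sortedSum]
  | succ q ih =>
    rw [sortedSum_succ_of_lt q hs, ih, Finset.sum_range_succ' _ (q + 1)]
    congr 1
    refine Finset.sum_congr rfl fun j _ => ?_
    rw [Nat.add_sub_add_right]
    rfl

/-! ### Products over gaps -/

/-- The product of `θ` over the successive gaps of the list `a :: J`. -/
def gapProd (θ : ℕ → ℝ) : ℕ → List ℕ → ℝ
  | _, [] => 1
  | a, i :: J => θ (i - a) * gapProd θ i J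

theorem gapProd_nonneg {θ : ℕ → ℝ} (hθ : ∀ g, 0 ≤ θ g) (a : ℕ) (J : List ℕ) :
    0 ≤ gapProd θ a J := by
  induction J generalizing a with
  | nil => exact zero_le_one
  | cons i J ih => exact mul_nonneg (hθ _) (ih i)

/-- Given its predecessor, an entry is determined by its gap, so each summation costs a factor `σ`.
Within a cluster only the first index can then contribute a factor `n`. -/
theorem sortedSum_gapProd_le {n : ℕ} {θ : ℕ → ℝ} (hθ : ∀ g, 0 ≤ θ g) {σ : ℝ}
    (hσ : ∑ g ∈ Finset.range n, θ g ≤ σ) (m s : ℕ) :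
    sortedSum n m s (gapProd θ s) ≤ σ ^ m := by
  have hσ0 : 0 ≤ σ := (Finset.sum_nonneg fun g _ => hθ g).trans hσ
  induction m generalizing s with
  | zero => simp [sortedSum, gapProd]
  | succ m ih =>
    simp only [sortedSum, gapProd, sortedSum_const_mul]
    calc ∑ i ∈ Finset.Ico s n, θ (i - s) * sortedSum n m i (gapProd θ i)
        ≤ ∑ i ∈ Finset.Ico s n, θ (i - s) * σ ^ m :=
          Finset.sum_le_sum fun i _ => mul_le_mul_of_nonneg_left (ih i) (hθ _)
      _ = (∑ g ∈ Finset.range (n - s), θ g) * σ ^ m := by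
          rw [Finset.sum_Ico_eq_sum_range, Finset.sum_mul]
          simp
      _ ≤ σ * σ ^ m := by
          refine mul_le_mul_of_nonneg_right (le_trans ?_ hσ) (by positivity)
          exact Finset.sum_le_sum_of_subset_of_nonneg
            (Finset.range_subset_range.2 (Nat.sub_le _ _)) fun g _ _ => hθ g
      _ = σ ^ (m + 1) := by ring

/-- A sorted list of at least two entries can be cut at a gap `g` at which `θ` is at most the
geometric mean of its values over all gaps. -/
theorem exists_cut_le_gapProd {θ : ℕ → ℝ} (hθ : ∀ g, 0 ≤ θ g) (a i : ℕ) (J : List ℕ)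
    (hs : (a :: i :: J).Pairwise (· ≤ ·)) :
    ∃ (J₁ J₂ : List ℕ) (x g : ℕ), a :: i :: J = J₁ ++ J₂ ∧ J₁ ≠ [] ∧ J₂ ≠ [] ∧
      (∀ y ∈ J₁, y ≤ x) ∧ (∀ y ∈ J₂, x + g ≤ y) ∧ x ∈ J₁ ∧
      θ g ^ (J.length + 1) ≤ gapProd θ a (i :: J) := by
  have first : ∀ (a i : ℕ) (J : List ℕ), (a :: i :: J).Pairwise (· ≤ ·) →
      ∀ y ∈ i :: J, a + (i - a) ≤ y := by
    intro a i J hs y hy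
    rw [List.pairwise_cons, List.pairwise_cons] at hs
    have h1 := hs.1 i (by simp)
    rcases List.mem_cons.1 hy with rfl | hy
    · omega
    · have := hs.2.1 y hy; omega
  induction J generalizing a i with
  | nil =>
    exact ⟨[a], [i], a, i - a, rfl, by simp, by simp, by simp, first a i [] hs, by simp,
      by simp [gapProd]⟩
  | cons k J ih =>
    obtain ⟨J₁, J₂, x, g, hJ, h1, h2, h3, h4, h5, h6⟩ := ih i k (List.pairwise_cons.1 hs).2
    -- Cut at whichever is smaller, `θ` of the first gap or of the cut chosen in the tail; the
    -- smaller value to the full power is then below the product.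
    by_cases hle : θ (i - a) ≤ θ g
    · refine ⟨[a], i :: k :: J, a, i - a, rfl, by simp, by simp, by simp, first a i _ hs,
        by simp, ?_⟩
      calc θ (i - a) ^ ((k :: J).length + 1) = θ (i - a) * θ (i - a) ^ (J.length + 1) := by
            rw [List.length_cons, pow_succ']
        _ ≤ θ (i - a) * θ g ^ (J.length + 1) :=
            mul_le_mul_of_nonneg_left (pow_le_pow_left₀ (hθ _) hle _) (hθ _)
        _ ≤ _ := mul_le_mul_of_nonneg_left h6 (hθ _)
    · refine ⟨a :: J₁, J₂, x, g, by rw [hJ]; rfl, by simp, h2, ?_, h4, by simp [h5], ?_⟩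
      · intro y hy
        rcases List.mem_cons.1 hy with rfl | hy
        · refine (List.pairwise_cons.1 hs).1 x ?_
          rw [hJ]; simp [h5]
        · exact h3 y hy
      · calc θ g ^ ((k :: J).length + 1) = θ g * θ g ^ (J.length + 1) := by
              rw [List.length_cons, pow_succ']
          _ ≤ θ (i - a) * θ g ^ (J.length + 1) :=
              mul_le_mul_of_nonneg_right (not_le.1 hle).le (pow_nonneg (hθ _) _)
          _ ≤ _ := mul_le_mul_of_nonneg_left h6 (hθ _)

/-! ### Sums over decompositions into consecutive clusters -/

/-- The sum, over all ways of cutting a list into consecutive nonempty clusters, of the product of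
the weights `c` of the clusters. -/
def clusterSum (c : List ℕ → ℝ) : List ℕ → ℝ
  | [] => 1
  | a :: J => ∑ m ∈ Finset.range (J.length + 1), c (a :: J.take m) * clusterSum c (J.drop m)
termination_by J => J.length
decreasing_by simp

theorem clusterSum_nil (c : List ℕ → ℝ) : clusterSum c [] = 1 := by rw [clusterSum]

theorem clusterSum_cons (c : List ℕ → ℝ) (a : ℕ) (J : List ℕ) :
    clusterSum c (a :: J) =
      ∑ m ∈ Finset.range (J.length + 1), c (a :: J.take m) * clusterSum c (J.drop m) := by
  rw [clusterSum]

theorem clusterSum_nonneg {c : List ℕ → ℝ} (hc : ∀ J, 0 ≤ c J) (J : List ℕ) :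
    0 ≤ clusterSum c J := by
  induction hn : J.length using Nat.strong_induction_on generalizing J with
  | _ n ih =>
    cases J with
    | nil => rw [clusterSum_nil]; exact zero_le_one
    | cons a J =>
      rw [clusterSum_cons]
      refine Finset.sum_nonneg fun m _ => mul_nonneg (hc _) (ih _ ?_ _ rfl)
      simp at hn ⊢; omega

/-- Concatenating decompositions of the two pieces gives decompositions of the whole list in which
no cluster crosses the junction; all other terms are nonnegative. -/
theorem clusterSum_mul_le_append {c : List ℕ → ℝ} (hc : ∀ J, 0 ≤ c J) (J₁ J₂ : List ℕ) :
    clusterSum c J₁ * clusterSum c J₂ ≤ clusterSum c (J₁ ++ J₂) := by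
  induction hn : J₁.length using Nat.strong_induction_on generalizing J₁ with
  | _ n ih =>
    cases J₁ with
    | nil => simp [clusterSum_nil]
    | cons a J =>
      rw [List.cons_append, clusterSum_cons, clusterSum_cons, Finset.sum_mul]
      refine (Finset.sum_le_sum (g := fun m => c (a :: (J ++ J₂).take m) *
        clusterSum c ((J ++ J₂).drop m)) fun m hm => ?_).trans
        (Finset.sum_le_sum_of_subset_of_nonneg
          (Finset.range_subset_range.2 (by simp)) fun m _ _ =>
            mul_nonneg (hc _) (clusterSum_nonneg hc _))
      have hm' : m ≤ J.length := by simpa [Nat.lt_succ_iff] using hm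
      rw [List.take_append_of_le_length hm', List.drop_append_of_le_length hm', mul_assoc]
      refine mul_le_mul_of_nonneg_left (ih _ ?_ _ rfl) (hc _)
      simp at hn ⊢; omega

/-- The decomposition into a single cluster crosses the junction, so it is not among the
concatenated ones. Its weight is the room that absorbs the covariance when a mixed moment is cut in
two. -/
theorem clusterSum_mul_add_le_append {c : List ℕ → ℝ} (hc : ∀ J, 0 ≤ c J) {J₁ J₂ : List ℕ}
    (h₁ : J₁ ≠ []) (h₂ : J₂ ≠ []) :
    clusterSum c J₁ * clusterSum c J₂ + c (J₁ ++ J₂) ≤ clusterSum c (J₁ ++ J₂) := by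
  obtain ⟨a, J, rfl⟩ := List.exists_cons_of_ne_nil h₁
  have hl : 0 < J₂.length := List.length_pos_iff.2 h₂
  rw [List.cons_append, clusterSum_cons c a (J ++ J₂), Finset.sum_range_succ,
    List.take_of_length_le le_rfl, List.drop_of_length_le le_rfl, clusterSum_nil, mul_one]
  refine add_le_add_left ?_ _
  rw [clusterSum_cons, Finset.sum_mul]
  refine (Finset.sum_le_sum (g := fun m => c (a :: (J ++ J₂).take m) *
    clusterSum c ((J ++ J₂).drop m)) fun m hm => ?_).trans
    (Finset.sum_le_sum_of_subset_of_nonneg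
      (Finset.range_subset_range.2 (by simp; omega)) fun m _ _ =>
        mul_nonneg (hc _) (clusterSum_nonneg hc _))
  have hm' : m ≤ J.length := by simpa [Nat.lt_succ_iff] using hm
  rw [List.take_append_of_le_length hm', List.drop_append_of_le_length hm', mul_assoc]
  exact mul_le_mul_of_nonneg_left (clusterSum_mul_le_append hc _ _) (hc _)

/-- If the clusters of size `m` starting at a given point have total weight at most `b m`, the
total weight of all decomposed sorted lists of length `q` is controlled by the generating function
of `b`. -/
theorem sortedSum_clusterSum_le {n : ℕ} {c : List ℕ → ℝ} (hc : ∀ J, 0 ≤ c J) {b : ℕ → ℝ}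
    {Q : ℕ} (hb : ∀ m s, m < Q → sortedSum n m s (fun J => c (s :: J)) ≤ b (m + 1))
    {z w : ℝ} (hz : 0 < z) (hw : 1 < w)
    (hbz : ∀ q, q < Q → ∑ m ∈ Finset.range (q + 1), b (m + 1) * z ^ (m + 1) ≤ 1 - w⁻¹)
    {q : ℕ} (hq : q ≤ Q) {s : ℕ} (hs : s ≤ n) :
    sortedSum n q s (clusterSum c) ≤ (z ^ q)⁻¹ * w ^ (n - s) := by
  have hcs := clusterSum_nonneg hc
  have hw0 : 0 < w := by linarith
  -- The sum telescopes: `(1 - w⁻¹) w^(j+1) = w^(j+1) - w^j`.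
  have geom : ∀ k : ℕ, (1 - w⁻¹) * ∑ j ∈ Finset.range k, w ^ (j + 1) ≤ w ^ k := by
    intro k
    have : (1 - w⁻¹) * ∑ j ∈ Finset.range k, w ^ (j + 1) = w ^ k - 1 := by
      induction k with
      | zero => simp
      | succ k ih => rw [Finset.sum_range_succ, mul_add, ih]; field_simp; ring
    linarith
  induction q using Nat.strong_induction_on generalizing s with
  | _ q ih =>
    cases q with
    | zero =>
      simp only [sortedSum, clusterSum_nil, pow_zero, inv_one, one_mul]
      exact one_le_pow₀ hw.le
    | succ q =>
      -- Remove the cluster headed by the first entry `i`. If it has `m + 1` entries, `hb` bounds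
      -- its weight and the induction hypothesis treats the remaining `q - m` entries; `hbz` then
      -- sums over `m`.
      have step : ∀ i ∈ Finset.Ico s n,
          sortedSum n q i (fun J => clusterSum c (i :: J)) ≤
            (z ^ (q + 1))⁻¹ * (1 - w⁻¹) * w ^ (n - i) := by
        intro i hi
        rw [Finset.mem_Ico] at hi
        calc sortedSum n q i (fun J => clusterSum c (i :: J))
            ≤ sortedSum n q i (fun J => ∑ m ∈ Finset.range (q + 1),
                c (i :: J.take m) * clusterSum c (J.drop m)) := by
              refine sortedSum_mono q i fun J hJ _ _ => ?_
              rw [clusterSum_cons, hJ]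
          _ = ∑ m ∈ Finset.range (q + 1), sortedSum n q i (fun J =>
                c (i :: J.take m) * clusterSum c (J.drop m)) := sortedSum_sum _ _ _ _
          _ ≤ ∑ m ∈ Finset.range (q + 1),
                b (m + 1) * ((z ^ (q - m))⁻¹ * w ^ (n - i)) := by
              refine Finset.sum_le_sum fun m hm => ?_
              have hm' : m ≤ q := by simpa [Nat.lt_succ_iff] using hm
              have h1 := sortedSum_take_drop_le (n := n) m (q - m) i
                (F := fun J => c (i :: J)) (G := clusterSum c) (fun J => hc _) hcs
              rw [Nat.add_sub_cancel' hm'] at h1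
              refine h1.trans ?_
              have h2 := hb m i (by omega)
              refine mul_le_mul h2 (ih (q - m) (by omega) (by omega) hi.2.le)
                (sortedSum_nonneg _ _ hcs) ((sortedSum_nonneg _ _ fun J => hc _).trans h2)
          _ = (z ^ (q + 1))⁻¹ * w ^ (n - i) *
                ∑ m ∈ Finset.range (q + 1), b (m + 1) * z ^ (m + 1) := by
              rw [Finset.mul_sum]
              refine Finset.sum_congr rfl fun m hm => ?_
              have hm' : m ≤ q := by simpa [Nat.lt_succ_iff] using hm
              have : z ^ (q + 1) = z ^ (q - m) * z ^ (m + 1) := by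
                rw [← pow_add]; congr 1; omega
              rw [this]; field_simp
          _ ≤ (z ^ (q + 1))⁻¹ * w ^ (n - i) * (1 - w⁻¹) :=
              mul_le_mul_of_nonneg_left (hbz q (by omega)) (by positivity)
          _ = _ := by ring
      refine (Finset.sum_le_sum step).trans ?_
      rw [← Finset.mul_sum, mul_assoc]
      refine mul_le_mul_of_nonneg_left ?_ (by positivity)
      refine le_trans (le_of_eq ?_) (geom (n - s))
      congr 1
      rw [Finset.sum_Ico_eq_sum_range, ← Finset.sum_range_reflect]
      refine Finset.sum_congr rfl fun j hj => ?_
      have := Finset.mem_range.1 hj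
      congr 1; omega

variable {Ω : Type*} [MeasurableSpace Ω]

/-! ### Random variables with all moments -/

/-- All absolute moments of `F` are finite. -/
def HasAllMoments (μ : Measure Ω) (F : Ω → ℝ) : Prop := ∀ r : ℕ, MemLp F r μ

namespace HasAllMoments

variable {μ : Measure Ω} {F G : Ω → ℝ}

theorem integrable (hF : HasAllMoments μ F) : Integrable F μ := by
  have := hF 1
  rwa [Nat.cast_one, memLp_one_iff_integrable] at this

theorem mul (hF : HasAllMoments μ F) (hG : HasAllMoments μ G) :
    HasAllMoments μ (fun ω => F ω * G ω) := by
  intro r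
  have : ENNReal.HolderTriple ((2 * r : ℕ) : ENNReal) ((2 * r : ℕ) : ENNReal) (r : ENNReal) := by
    refine ⟨?_⟩
    rw [Nat.cast_mul, Nat.cast_two, ENNReal.mul_inv (by simp) (by simp), ← add_mul,
      ENNReal.inv_two_add_inv_two, one_mul]
  exact (hG (2 * r)).mul' (hF (2 * r))

theorem const [IsFiniteMeasure μ] (a : ℝ) : HasAllMoments μ (fun _ => a) :=
  fun _ => memLp_const a

theorem const_mul (hF : HasAllMoments μ F) (a : ℝ) : HasAllMoments μ (fun ω => a * F ω) :=
  fun r => (hF r).const_mul a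

theorem sum {ι : Type*} (s : Finset ι) {f : ι → Ω → ℝ} (h : ∀ i ∈ s, HasAllMoments μ (f i)) :
    HasAllMoments μ (fun ω => ∑ i ∈ s, f i ω) :=
  fun r => memLp_finsetSum s fun i hi => h i hi r

theorem pow [IsFiniteMeasure μ] (hF : HasAllMoments μ F) (k : ℕ) :
    HasAllMoments μ (fun ω => F ω ^ k) := by
  induction k with
  | zero => simpa using const 1
  | succ k ih => simpa [pow_succ] using ih.mul hF

theorem abs (hF : HasAllMoments μ F) : HasAllMoments μ (fun ω => |F ω|) :=
  fun r => (hF r).abs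

theorem list_prod [IsFiniteMeasure μ] {Y : ℕ → Ω → ℝ} (J : List ℕ)
    (h : ∀ i ∈ J, HasAllMoments μ (Y i)) :
    HasAllMoments μ (fun ω => (J.map fun i => Y i ω).prod) := by
  induction J with
  | nil => simpa using const 1
  | cons a J ih =>
    simp only [List.map_cons, List.prod_cons]
    exact (h a (by simp)).mul (ih fun i hi => h i (by simp [hi]))

end HasAllMoments

/-! ### Moments of sums in terms of moments of sorted products -/

/-- The `q`-th moment of a sum is at most `q!` times the sum of the absolute values of the mixed
moments over sorted indices. -/
theorem abs_integral_mul_sum_pow_le (μ : Measure Ω) [IsFiniteMeasure μ] {n : ℕ}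
    {Y : ℕ → Ω → ℝ} (hY : ∀ i < n, HasAllMoments μ (Y i)) (q : ℕ) {s : ℕ} (hs : s ≤ n)
    {P : Ω → ℝ} (hP : HasAllMoments μ P) :
    |∫ ω, P ω * (∑ i ∈ Finset.Ico s n, Y i ω) ^ q ∂μ| ≤
      q.factorial * sortedSum n q s (fun J => |∫ ω, P ω * (J.map fun i => Y i ω).prod ∂μ|) := by
  induction hs using Nat.decreasingInduction generalizing q P with
  | self =>
    cases q with
    | zero => simp [sortedSum]
    | succ q => simp [sortedSum]
  | of_succ s hs ih =>
    have hS : HasAllMoments μ (fun ω => ∑ i ∈ Finset.Ico (s + 1) n, Y i ω) :=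
      .sum _ fun i hi => hY i (Finset.mem_Ico.1 hi).2
    have hYs := hY s hs
    -- The power `Y_s^j` moves into the prefactor, where it corresponds to `j` copies of `s` at the
    -- head of a sorted list.
    have expand : ∀ ω, P ω * (∑ i ∈ Finset.Ico s n, Y i ω) ^ q =
        ∑ j ∈ Finset.range (q + 1), (q.choose j : ℝ) *
          ((P ω * Y s ω ^ j) * (∑ i ∈ Finset.Ico (s + 1) n, Y i ω) ^ (q - j)) := by
      intro ω
      rw [Finset.sum_eq_sum_Ico_succ_bot hs, add_pow, Finset.mul_sum]
      exact Finset.sum_congr rfl fun j _ => by ring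
    simp_rw [expand]
    rw [integral_finsetSum _ fun j _ =>
      (((hP.mul (hYs.pow j)).mul (hS.pow (q - j))).const_mul _).integrable]
    refine (Finset.abs_sum_le_sum_abs _ _).trans ?_
    rw [sortedSum_eq_sum_replicate q hs, Finset.mul_sum]
    refine Finset.sum_le_sum fun j hj => ?_
    have hj' : j ≤ q := by simpa [Nat.lt_succ_iff] using hj
    rw [integral_const_mul, abs_mul, Nat.abs_cast]
    have h1 := ih (q - j) (hP.mul (hYs.pow j))
    -- The quotient `q! / j!` is bounded by `q!`; the gain from repeated indices is given away.
    have hcoef : (q.choose j : ℝ) * (q - j).factorial ≤ q.factorial := by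
      have h2 := Nat.choose_mul_factorial_mul_factorial hj'
      have h3 : q.choose j * (q - j).factorial ≤ q.factorial := by
        rw [← h2, mul_right_comm]
        exact Nat.le_mul_of_pos_right _ j.factorial_pos
      exact_mod_cast h3
    calc (q.choose j : ℝ) * |∫ ω, (P ω * Y s ω ^ j) *
            (∑ i ∈ Finset.Ico (s + 1) n, Y i ω) ^ (q - j) ∂μ|
        ≤ (q.choose j : ℝ) * ((q - j).factorial * sortedSum n (q - j) (s + 1)
            (fun J => |∫ ω, (P ω * Y s ω ^ j) * (J.map fun i => Y i ω).prod ∂μ|)) := by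
          gcongr
      _ ≤ q.factorial * sortedSum n (q - j) (s + 1)
            (fun J => |∫ ω, (P ω * Y s ω ^ j) * (J.map fun i => Y i ω).prod ∂μ|) := by
          rw [← mul_assoc]
          exact mul_le_mul_of_nonneg_right hcoef (sortedSum_nonneg _ _ fun J => abs_nonneg _)
      _ = _ := by
          congr 2
          funext J
          congr 2
          funext ω
          simp [List.map_append, List.map_replicate, mul_assoc]

/-- Mixed moments over sorted indices are bounded by sums over cluster decompositions. -/
theorem abs_integral_prod_le_clusterSum (μ : Measure Ω) [IsProbabilityMeasure μ] {n q : ℕ}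
    {Y : ℕ → Ω → ℝ} (hmean : ∀ i < n, ∫ ω, Y i ω ∂μ = 0)
    {c : List ℕ → ℝ} (hc : ∀ J, 0 ≤ c J)
    (hcut : ∀ (a i : ℕ) (J : List ℕ), (a :: i :: J).length ≤ q →
      (a :: i :: J).Pairwise (· ≤ ·) → (∀ x ∈ a :: i :: J, x < n) →
      ∃ J₁ J₂ : List ℕ, a :: i :: J = J₁ ++ J₂ ∧ J₁ ≠ [] ∧ J₂ ≠ [] ∧
        |(∫ ω, ((J₁ ++ J₂).map fun i => Y i ω).prod ∂μ) -
          (∫ ω, (J₁.map fun i => Y i ω).prod ∂μ) * ∫ ω, (J₂.map fun i => Y i ω).prod ∂μ|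
          ≤ c (J₁ ++ J₂))
    (J : List ℕ) (hJ : J.length ≤ q) (hs : J.Pairwise (· ≤ ·)) (hn : ∀ x ∈ J, x < n) :
    |∫ ω, (J.map fun i => Y i ω).prod ∂μ| ≤ clusterSum c J := by
  induction hl : J.length using Nat.strong_induction_on generalizing J with
  | _ l ih =>
    match J, hJ, hs, hn, hl with
    | [], _, _, _, _ => simp [clusterSum_nil]
    | [a], _, _, hn, _ =>
      simpa [hmean a (hn a (by simp))] using clusterSum_nonneg hc [a]
    | a :: i :: J, hJ, hs, hn, hl =>
      obtain ⟨J₁, J₂, heq, h1, h2, h3⟩ := hcut a i J hJ hs hn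
      rw [heq] at hJ hs hn hl ⊢
      have p1 := List.length_pos_iff.2 h1
      have p2 := List.length_pos_iff.2 h2
      rw [List.length_append] at hl hJ
      rw [List.pairwise_append] at hs
      have i1 := ih J₁.length (by omega) J₁ (by omega) hs.1
        (fun x hx => hn x (by simp [hx])) rfl
      have i2 := ih J₂.length (by omega) J₂ (by omega) hs.2.1
        (fun x hx => hn x (by simp [hx])) rfl
      refine le_trans ?_ (clusterSum_mul_add_le_append hc h1 h2)
      have i3 := mul_le_mul i1 i2 (abs_nonneg _) (clusterSum_nonneg hc J₁)
      rw [← abs_mul] at i3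
      have i4 := abs_sub_abs_le_abs_sub (∫ ω, ((J₁ ++ J₂).map fun i => Y i ω).prod ∂μ)
        ((∫ ω, (J₁.map fun i => Y i ω).prod ∂μ) * ∫ ω, (J₂.map fun i => Y i ω).prod ∂μ)
      linarith

/-- The inequality of arithmetic and geometric means, applied pointwise; it replaces Hölder's
inequality with many factors. -/
theorem list_prod_le_sum_pow_div (J : List ℕ) (hJ : J ≠ []) {x : ℕ → ℝ} (hx : ∀ i, 0 ≤ x i) :
    (J.map x).prod ≤ (∑ i : Fin J.length, x (J[i]) ^ J.length) / J.length := by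
  have hl : (0 : ℝ) < J.length := by exact_mod_cast List.length_pos_iff.2 hJ
  have h := Real.geom_mean_le_arith_mean_weighted Finset.univ
    (fun _ : Fin J.length => (J.length : ℝ)⁻¹) (fun i => x (J[i]) ^ J.length)
    (fun _ _ => by positivity) (by simp [hl.ne']) (fun i _ => pow_nonneg (hx _) _)
  rw [← Finset.mul_sum, inv_mul_eq_div] at h
  refine le_trans (le_of_eq ?_) h
  rw [← Fin.prod_univ_fun_getElem]
  refine Finset.prod_congr rfl fun i _ => ?_
  rw [Real.pow_rpow_inv_natCast (hx _) (by simpa using hJ)]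
  rfl

theorem abs_list_prod_pow (J : List ℕ) (x : ℕ → ℝ) (k : ℕ) :
    |(J.map x).prod| ^ k = (J.map fun i => |x i| ^ k).prod := by
  induction J with
  | nil => simp
  | cons a J ih => simp [abs_mul, mul_pow, ih]

/-- Third absolute moments of products, from moments of the factors. -/
theorem integral_abs_list_prod_pow_three_le (μ : Measure Ω) [IsFiniteMeasure μ]
    {Y : ℕ → Ω → ℝ} (J : List ℕ) (hJ : J ≠ []) (hY : ∀ i ∈ J, HasAllMoments μ (Y i)) {M : ℝ}
    (hM : ∀ i ∈ J, ∫ ω, |Y i ω| ^ (3 * J.length) ∂μ ≤ M) :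
    ∫ ω, |(J.map fun i => Y i ω).prod| ^ 3 ∂μ ≤ M := by
  have hl : (0 : ℝ) < J.length := by exact_mod_cast List.length_pos_iff.2 hJ
  have hmem : ∀ i : Fin J.length, J[i] ∈ J := fun i => List.getElem_mem _
  have hInt : ∀ i : Fin J.length, Integrable (fun ω => |Y (J[i]) ω| ^ (3 * J.length)) μ :=
    fun i => ((hY _ (hmem i)).abs.pow _).integrable
  calc ∫ ω, |(J.map fun i => Y i ω).prod| ^ 3 ∂μ
      ≤ ∫ ω, (∑ i : Fin J.length, |Y (J[i]) ω| ^ (3 * J.length)) / J.length ∂μ := by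
        refine integral_mono (((HasAllMoments.list_prod J hY).abs.pow 3).integrable)
          ((integrable_finsetSum _ fun i _ => hInt i).div_const _) fun ω => ?_
        have h := list_prod_le_sum_pow_div J hJ (x := fun i => |Y i ω| ^ 3)
          fun i => by positivity
        simp only [← pow_mul] at h
        refine le_trans (le_of_eq ?_) h
        exact abs_list_prod_pow J _ 3
    _ = (∑ i : Fin J.length, ∫ ω, |Y (J[i]) ω| ^ (3 * J.length) ∂μ) / J.length := by
        rw [integral_div, integral_finsetSum _ fun i _ => hInt i]
    _ ≤ (∑ _i : Fin J.length, M) / J.length := by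
        gcongr with i
        exact hM _ (hmem i)
    _ = M := by simp [hl.ne']

/-! ### The moment inequality for weakly dependent sequences -/

/-- The weight of a cluster of at least two sorted indices. -/
def clusterWeight (D H G : ℝ) (θ : ℕ → ℕ → ℝ) : List ℕ → ℝ
  | a :: i :: J => D * H ^ 2 * G ^ J.length * gapProd (θ (J.length + 1)) a (i :: J)
  | _ => 0

theorem clusterWeight_nonneg {D H G : ℝ} {θ : ℕ → ℕ → ℝ} (hD : 0 ≤ D) (hG : 0 ≤ G)
    (hθ : ∀ m g, 0 ≤ θ m g) : ∀ J, 0 ≤ clusterWeight D H G θ J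
  | [] => le_rfl
  | [_] => le_rfl
  | a :: i :: J => by
    have := gapProd_nonneg (hθ (J.length + 1)) a (i :: J)
    simp only [clusterWeight]
    positivity

/-- Moment inequality for sums of centred random variables whose covariances across a gap `g`
decay like `θ m g ^ m` for every number `m` of gaps. -/
theorem abs_integral_sum_pow_le (μ : Measure Ω) [IsProbabilityMeasure μ] {n q : ℕ}
    {Y : ℕ → Ω → ℝ} (hY : ∀ i < n, HasAllMoments μ (Y i)) (hmean : ∀ i < n, ∫ ω, Y i ω ∂μ = 0)
    {D H G : ℝ} (hD : 0 ≤ D) (hH : 0 < H) (hG : 0 < G)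
    (hmom : ∀ a i, 1 ≤ a → a < q → i < n →
      ∫ ω, |Y i ω| ^ (3 * a) ∂μ ≤ (H * G ^ (a - 1)) ^ 3)
    {θ : ℕ → ℕ → ℝ} (hθ : ∀ m g, 0 ≤ θ m g)
    (hcov : ∀ (J₁ J₂ : List ℕ) (x g m : ℕ), 1 ≤ m → (∀ y ∈ J₁, y ≤ x) →
      (∀ y ∈ J₂, x + g ≤ y) → (∀ y ∈ J₁, y < n) → (∀ y ∈ J₂, y < n) → ∀ u v : ℝ, 0 < u → 0 < v →
      ∫ ω, |(J₁.map fun i => Y i ω).prod| ^ 3 ∂μ ≤ u ^ 3 →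
      ∫ ω, |(J₂.map fun i => Y i ω).prod| ^ 3 ∂μ ≤ v ^ 3 →
      |(∫ ω, (J₁.map fun i => Y i ω).prod * (J₂.map fun i => Y i ω).prod ∂μ) -
          (∫ ω, (J₁.map fun i => Y i ω).prod ∂μ) * ∫ ω, (J₂.map fun i => Y i ω).prod ∂μ|
        ≤ D * θ m g ^ m * (u * v))
    {σ : ℕ → ℝ} (hσ : ∀ m, 1 ≤ m → m < q → ∑ g ∈ Finset.range n, θ m g ≤ σ m)
    {z w : ℝ} (hz : 0 < z) (hw : 1 < w)
    (hzw : ∀ r, r < q → ∑ m ∈ Finset.range r,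
      D * H ^ 2 * G ^ m * σ (m + 1) ^ (m + 1) * z ^ (m + 2) ≤ 1 - w⁻¹) :
    |∫ ω, (∑ i ∈ Finset.range n, Y i ω) ^ q ∂μ| ≤ q.factorial * ((z ^ q)⁻¹ * w ^ n) := by
  have hcw := clusterWeight_nonneg (H := H) hD hG.le hθ
  have h1 := abs_integral_mul_sum_pow_le μ hY q (Nat.zero_le n) (HasAllMoments.const (μ := μ) 1)
  simp only [one_mul, ← Finset.range_eq_Ico] at h1
  refine h1.trans (mul_le_mul_of_nonneg_left ?_ (by positivity))
  have h2 : sortedSum n q 0 (fun J => |∫ ω, (J.map fun i => Y i ω).prod ∂μ|) ≤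
      sortedSum n q 0 (clusterSum (clusterWeight D H G θ)) := by
    refine sortedSum_mono q 0 fun J hJ hs hn => ?_
    refine abs_integral_prod_le_clusterSum μ hmean (q := q) hcw ?_ J hJ.le hs fun x hx =>
      (hn x hx).2
    intro a i J hl hs hn
    obtain ⟨J₁, J₂, x, g, heq, e1, e2, le1, le2, -, hg⟩ :=
      exists_cut_le_gapProd (hθ (J.length + 1)) a i J hs
    refine ⟨J₁, J₂, heq, e1, e2, ?_⟩
    have p1 := List.length_pos_iff.2 e1
    have p2 := List.length_pos_iff.2 e2
    have hlen : J.length + 2 = J₁.length + J₂.length := by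
      rw [← List.length_append, ← heq]; rfl
    have hl' : J.length + 2 ≤ q := hl
    have n1 : ∀ y ∈ J₁, y < n := fun y hy => hn y (by rw [heq]; simp [hy])
    have n2 : ∀ y ∈ J₂, y < n := fun y hy => hn y (by rw [heq]; simp [hy])
    have m1 := integral_abs_list_prod_pow_three_le μ J₁ e1 (fun i hi => hY i (n1 i hi))
      (fun i hi => hmom J₁.length i p1 (by omega) (n1 i hi))
    have m2 := integral_abs_list_prod_pow_three_le μ J₂ e2 (fun i hi => hY i (n2 i hi))
      (fun i hi => hmom J₂.length i p2 (by omega) (n2 i hi))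
    have h := hcov J₁ J₂ x g (J.length + 1) (by omega) le1 le2 n1 n2 _ _ (by positivity)
      (by positivity) m1 m2
    simp only [List.map_append, List.prod_append]
    refine h.trans ?_
    rw [← heq]
    simp only [clusterWeight]
    have hGG : G ^ J.length = G ^ (J₁.length - 1) * G ^ (J₂.length - 1) := by
      rw [← pow_add]; congr 1; omega
    rw [hGG]
    calc D * θ (J.length + 1) g ^ (J.length + 1) *
          (H * G ^ (J₁.length - 1) * (H * G ^ (J₂.length - 1)))
        = D * H ^ 2 * (G ^ (J₁.length - 1) * G ^ (J₂.length - 1)) *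
          θ (J.length + 1) g ^ (J.length + 1) := by ring
      _ ≤ _ := by gcongr
  refine h2.trans ?_
  -- A cluster of `m ≥ 2` entries has `m - 1` gaps, hence the power of `σ (m - 1)`. Sizes up to one
  -- get weight zero, because singletons have mean zero.
  have h3 := sortedSum_clusterSum_le (n := n) hcw (Q := q)
    (b := fun m => if m ≤ 1 then 0 else D * H ^ 2 * G ^ (m - 2) * σ (m - 1) ^ (m - 1))
    ?_ hz hw ?_ le_rfl (Nat.zero_le n)
  · simpa using h3
  · intro m s hm
    cases m with
    | zero => simp [sortedSum, clusterWeight]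
    | succ m =>
      have h4 : sortedSum n (m + 1) s (fun J => clusterWeight D H G θ (s :: J)) ≤
          sortedSum n (m + 1) s (fun J => D * H ^ 2 * G ^ m * gapProd (θ (m + 1)) s J) := by
        refine sortedSum_mono _ _ fun J hJ _ _ => ?_
        cases J with
        | nil => simp at hJ
        | cons i J =>
          have : J.length = m := by simpa using hJ
          simp only [clusterWeight, this]
          exact le_rfl
      rw [sortedSum_const_mul] at h4
      refine h4.trans ?_
      simp only [show ¬ (m + 1 + 1 ≤ 1) by omega, if_false]
      exact mul_le_mul_of_nonneg_left
        (sortedSum_gapProd_le (hθ _) (hσ (m + 1) (by omega) hm) _ _) (by positivity)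
  · intro r hr
    rw [Finset.sum_range_succ']
    simp only [zero_add, le_refl, if_true, zero_mul, add_zero]
    refine le_trans (le_of_eq (Finset.sum_congr rfl fun m _ => ?_)) (hzw r hr)
    simp

/-! ### Covariance inequalities under strong mixing -/

/-- The function equal to `1` on `S` and to `-1` off `S`. -/
noncomputable def signFun {Ω : Type*} (S : Set Ω) (ω : Ω) : ℝ := 2 * S.indicator 1 ω - 1

theorem abs_signFun {Ω : Type*} (S : Set Ω) (ω : Ω) : |signFun S ω| = 1 := by
  unfold signFun
  by_cases h : ω ∈ S <;> simp [h]
  norm_num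

theorem measurable_signFun {Ω : Type*} {m : MeasurableSpace Ω} {S : Set Ω}
    (hS : MeasurableSet[m] S) : Measurable[m] (signFun S) :=
  ((measurable_one.indicator hS).const_mul 2).sub_const 1

/-- Conditioning on `m` replaces `W` by `h = E[W | m]` without changing the integral. Then `M ∫ |h|`
is an upper bound, and the sign of `h` attains `∫ |h|`: the extremal bounded factors are
`±1`-valued. -/
theorem abs_integral_mul_le_signFun {Ω : Type*} {m mΩ : MeasurableSpace Ω} (hm : m ≤ mΩ)
    (μ : Measure Ω) [IsProbabilityMeasure μ] {U W : Ω → ℝ} (hU : Measurable[m] U) {M : ℝ}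
    (hUM : ∀ ω, |U ω| ≤ M) (hW : Integrable W μ) :
    ∃ S, MeasurableSet[m] S ∧ |∫ ω, U ω * W ω ∂μ| ≤ M * |∫ ω, signFun S ω * W ω ∂μ| := by
  have hM : 0 ≤ M := by
    obtain ⟨ω⟩ : Nonempty Ω := nonempty_of_isProbabilityMeasure μ
    exact (abs_nonneg _).trans (hUM ω)
  set h : Ω → ℝ := μ[W | m] with hh
  have hmeas : Measurable[m] h := stronglyMeasurable_condExp.measurable
  have pull : ∀ F : Ω → ℝ, Measurable[m] F → (∃ B, ∀ ω, |F ω| ≤ B) →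
      ∫ ω, F ω * W ω ∂μ = ∫ ω, F ω * h ω ∂μ := by
    intro F hF ⟨B, hB⟩
    have hInt : Integrable (F * W) μ :=
      hW.bdd_mul (hF.mono hm le_rfl).aestronglyMeasurable (Filter.Eventually.of_forall hB)
    have h1 := condExp_mul_of_stronglyMeasurable_left (m := m) (μ := μ) (f := F) (g := W)
      hF.stronglyMeasurable hInt hW
    calc ∫ ω, F ω * W ω ∂μ = ∫ ω, (μ[F * W | m]) ω ∂μ := (integral_condExp hm).symm
      _ = ∫ ω, F ω * h ω ∂μ := integral_congr_ae h1
  refine ⟨{ω | 0 ≤ h ω}, measurableSet_le measurable_const hmeas, ?_⟩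
  set S : Set Ω := {ω | 0 ≤ h ω} with hSdef
  have hS : MeasurableSet[m] S := measurableSet_le measurable_const hmeas
  have hsgn : ∀ ω, signFun S ω * h ω = |h ω| := by
    intro ω
    unfold signFun
    by_cases hω : ω ∈ S
    · have : 0 ≤ h ω := hω
      simp [hω, abs_of_nonneg this]; ring
    · have : h ω < 0 := not_le.1 hω
      simp [hω, abs_of_neg this]
  rw [pull U hU ⟨M, hUM⟩, pull _ (measurable_signFun hS) ⟨1, fun ω => (abs_signFun S ω).le⟩]
  simp_rw [hsgn]
  have hi : Integrable h μ := integrable_condExp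
  calc |∫ ω, U ω * h ω ∂μ| ≤ ∫ ω, |U ω * h ω| ∂μ := abs_integral_le_integral_abs
    _ ≤ ∫ ω, M * |h ω| ∂μ := by
        refine integral_mono
          (hi.bdd_mul (hU.mono hm le_rfl).aestronglyMeasurable
            (Filter.Eventually.of_forall hUM)).abs (hi.abs.const_mul M) fun ω => ?_
        simp only [abs_mul]
        exact mul_le_mul_of_nonneg_right (hUM ω) (abs_nonneg _)
    _ = M * ∫ ω, |h ω| ∂μ := integral_const_mul _ _
    _ ≤ M * |∫ ω, |h ω| ∂μ| := by gcongr; exact le_abs_self _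

theorem integral_mul_sub_integral {Ω : Type*} [MeasurableSpace Ω] (μ : Measure Ω)
    {U V : Ω → ℝ} (hU : Integrable U μ) (hUV : Integrable (fun ω => U ω * V ω) μ) :
    ∫ ω, U ω * (V ω - ∫ ω', V ω' ∂μ) ∂μ =
      (∫ ω, U ω * V ω ∂μ) - (∫ ω, U ω ∂μ) * ∫ ω, V ω ∂μ := by
  simp_rw [mul_sub]
  rw [integral_sub hUV (hU.mul_const _), integral_mul_const]

/-- The covariance inequality for bounded variables. -/
theorem abs_covariance_le_of_bounded {Ω : Type*} {m₁ m₂ mΩ : MeasurableSpace Ω} (h₁ : m₁ ≤ mΩ)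
    (h₂ : m₂ ≤ mΩ) (μ : Measure Ω) [IsProbabilityMeasure μ] {a : ℝ}
    (hα : ∀ A B, MeasurableSet[m₁] A → MeasurableSet[m₂] B →
      |μ.real (A ∩ B) - μ.real A * μ.real B| ≤ a)
    {U V : Ω → ℝ} (hU : Measurable[m₁] U) (hV : Measurable[m₂] V) {M : ℝ}
    (hUM : ∀ ω, |U ω| ≤ M) (hVM : ∀ ω, |V ω| ≤ M) :
    |(∫ ω, U ω * V ω ∂μ) - (∫ ω, U ω ∂μ) * ∫ ω, V ω ∂μ| ≤ 4 * a * M ^ 2 := by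
  have hM : 0 ≤ M := by
    obtain ⟨ω⟩ : Nonempty Ω := nonempty_of_isProbabilityMeasure μ
    exact (abs_nonneg _).trans (hUM ω)
  have bint : ∀ (F : Ω → ℝ) (B : ℝ), Measurable F → (∀ ω, |F ω| ≤ B) → Integrable F μ :=
    fun F B hF hB => Integrable.of_bound hF.aestronglyMeasurable B (Filter.Eventually.of_forall hB)
  have hU' := hU.mono h₁ le_rfl
  have hV' := hV.mono h₂ le_rfl
  have iU := bint U M hU' hUM
  have iV := bint V M hV' hVM
  have imul : ∀ F G : Ω → ℝ, Measurable F → (∃ B, ∀ ω, |F ω| ≤ B) → Integrable G μ →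
      Integrable (fun ω => F ω * G ω) μ := fun F G hF ⟨B, hB⟩ hG =>
    hG.bdd_mul hF.aestronglyMeasurable (Filter.Eventually.of_forall hB)
  -- First `U` is replaced by a sign function against centred `V`, then `V` by a sign function
  -- against the first one, centred. The covariance of two sign functions is four times the quantity
  -- bounded by `hα`.
  obtain ⟨S, hS, hle⟩ := abs_integral_mul_le_signFun h₁ μ hU hUM
    (iV.sub (integrable_const (∫ ω, V ω ∂μ)))
  have sS := (measurable_signFun hS).mono h₁ le_rfl
  have bS : ∃ B, ∀ ω, |signFun S ω| ≤ B := ⟨1, fun ω => (abs_signFun S ω).le⟩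
  have iS := bint _ 1 sS fun ω => (abs_signFun S ω).le
  obtain ⟨S', hS', hle'⟩ := abs_integral_mul_le_signFun h₂ μ hV hVM
    (iS.sub (integrable_const (∫ ω, signFun S ω ∂μ)))
  have sS' := (measurable_signFun hS').mono h₂ le_rfl
  have bS' : ∃ B, ∀ ω, |signFun S' ω| ≤ B := ⟨1, fun ω => (abs_signFun S' ω).le⟩
  have iS' := bint _ 1 sS' fun ω => (abs_signFun S' ω).le
  simp only [Pi.sub_apply] at hle hle'
  rw [integral_mul_sub_integral μ iU (imul _ _ hU' ⟨M, hUM⟩ iV),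
    integral_mul_sub_integral μ iS (imul _ _ sS bS iV)] at hle
  rw [integral_mul_sub_integral μ iV (imul _ _ hV' ⟨M, hVM⟩ iS),
    integral_mul_sub_integral μ iS' (imul _ _ sS' bS' iS)] at hle'
  have ind : ∀ A : Set Ω, MeasurableSet A →
      ∫ ω, signFun A ω ∂μ = 2 * μ.real A - 1 := by
    intro A hA
    have i1 : Integrable (A.indicator (1 : Ω → ℝ)) μ := (integrable_const (1 : ℝ)).indicator hA
    unfold signFun
    rw [integral_sub (i1.const_mul 2) (integrable_const 1), integral_const_mul]
    have : ∫ ω, A.indicator (1 : Ω → ℝ) ω ∂μ = μ.real A := integral_indicator_one hA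
    simp [this]
  have mS := h₁ _ hS
  have mS' := h₂ _ hS'
  have prodSign : ∫ ω, signFun S' ω * signFun S ω ∂μ =
      4 * μ.real (S ∩ S') - 2 * μ.real S - 2 * μ.real S' + 1 := by
    have e : ∀ ω, signFun S' ω * signFun S ω =
        2 * signFun (S ∩ S') ω - signFun S ω - signFun S' ω + 1 := by
      intro ω
      unfold signFun
      by_cases ha : ω ∈ S <;> by_cases hb : ω ∈ S' <;> simp [ha, hb] <;> norm_num
    have iI := bint (signFun (S ∩ S')) 1 (measurable_signFun (mS.inter mS'))
      fun ω => (abs_signFun _ ω).le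
    have j1 : Integrable (fun ω => 2 * signFun (S ∩ S') ω - signFun S ω) μ :=
      (iI.const_mul 2).sub iS
    have j2 : Integrable (fun ω => 2 * signFun (S ∩ S') ω - signFun S ω - signFun S' ω) μ :=
      j1.sub iS'
    simp_rw [e]
    rw [integral_add j2 (integrable_const 1), integral_sub j1 iS',
      integral_sub (iI.const_mul 2) iS,
      integral_const_mul, ind _ (mS.inter mS'), ind _ mS, ind _ mS']
    simp; ring
  have hfin : |(∫ ω, signFun S' ω * signFun S ω ∂μ) -
      (∫ ω, signFun S' ω ∂μ) * ∫ ω, signFun S ω ∂μ| ≤ 4 * a := by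
    rw [prodSign, ind _ mS, ind _ mS']
    have e : 4 * μ.real (S ∩ S') - 2 * μ.real S - 2 * μ.real S' + 1 -
        (2 * μ.real S' - 1) * (2 * μ.real S - 1) =
        4 * (μ.real (S ∩ S') - μ.real S * μ.real S') := by ring
    rw [e, abs_mul]
    have := hα S S' hS hS'
    norm_num
    linarith
  have hcomm : (∫ ω, V ω * signFun S ω ∂μ) - (∫ ω, V ω ∂μ) * ∫ ω, signFun S ω ∂μ =
      (∫ ω, signFun S ω * V ω ∂μ) - (∫ ω, signFun S ω ∂μ) * ∫ ω, V ω ∂μ := by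
    simp_rw [mul_comm]
  rw [hcomm] at hle'
  calc _ ≤ _ := hle
    _ ≤ M * (M * (4 * a)) := by
      refine mul_le_mul_of_nonneg_left (hle'.trans ?_) hM
      exact mul_le_mul_of_nonneg_left hfin hM
    _ = 4 * a * M ^ 2 := by ring

/-- Clamping a real number to `[-M, M]`. -/
def clamp (M x : ℝ) : ℝ := max (-M) (min M x)

theorem measurable_clamp (M : ℝ) : Measurable (clamp M) := by unfold clamp; fun_prop

theorem abs_clamp_le {M : ℝ} (hM : 0 ≤ M) (x : ℝ) : |clamp M x| ≤ M := by
  unfold clamp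
  rw [abs_le]
  exact ⟨le_max_left _ _, max_le (by linarith) (min_le_left _ _)⟩

theorem abs_clamp_le_abs {M : ℝ} (hM : 0 ≤ M) (x : ℝ) : |clamp M x| ≤ |x| := by
  unfold clamp
  rw [abs_le]
  refine ⟨le_max_of_le_right (le_min ?_ (neg_abs_le x)), max_le ?_ ?_⟩
  · linarith [abs_nonneg x]
  · linarith [abs_nonneg x]
  · exact (min_le_right _ _).trans (le_abs_self x)

/-- The excess vanishes when `|x| ≤ M`; otherwise it is at most `|x|` while `M ≤ |x|`. Spending only
a square here leaves one power of the third moment for the other factor of a covariance. -/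
theorem mul_abs_sub_clamp_le {M : ℝ} (hM : 0 ≤ M) (x : ℝ) : M * |x - clamp M x| ≤ |x| ^ 2 := by
  unfold clamp
  rcases le_total M x with h | h
  · rw [min_eq_left h, max_eq_right (by linarith), abs_of_nonneg (by linarith : 0 ≤ x - M),
      abs_of_nonneg (by linarith : 0 ≤ x)]
    nlinarith
  · rw [min_eq_right h]
    rcases le_total (-M) x with h' | h'
    · rw [max_eq_right h']; simp; positivity
    · rw [max_eq_left h', abs_of_nonpos (by linarith : x - -M ≤ 0),
        abs_of_nonpos (by linarith : x ≤ 0)]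
      nlinarith

/-- Three times the difference of the two sides is `(2x + y)(x - y)²`. -/
theorem sq_mul_le_cubes {x y : ℝ} (hx : 0 ≤ x) (hy : 0 ≤ y) :
    x ^ 2 * y ≤ 2 / 3 * x ^ 3 + 1 / 3 * y ^ 3 := by
  nlinarith [mul_nonneg (add_nonneg (mul_nonneg zero_le_two hx) hy) (sq_nonneg (x - y))]

/-- Covariances involving the remainder of a truncation. -/
theorem abs_covariance_truncation_le {Ω : Type*} [MeasurableSpace Ω] (μ : Measure Ω)
    [IsProbabilityMeasure μ] {U V W : Ω → ℝ} (hU : HasAllMoments μ U) (hV : HasAllMoments μ V)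
    (hW : HasAllMoments μ W) (hU3 : ∫ ω, |U ω| ^ 3 ∂μ ≤ 1) (hV3 : ∫ ω, |V ω| ^ 3 ∂μ ≤ 1) {t : ℝ}
    (ht : 0 ≤ t) {R : Ω → ℝ} (hR : HasAllMoments μ R) (hRU : ∀ ω, |R ω| ≤ t * |U ω| ^ 2)
    (hWV : ∀ ω, |W ω| ≤ |V ω|) :
    |(∫ ω, R ω * W ω ∂μ) - (∫ ω, R ω ∂μ) * ∫ ω, W ω ∂μ| ≤ 2 * t := by
  have i3U := (hU.abs.pow 3).integrable
  have i3V := (hV.abs.pow 3).integrable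
  have b1 : |∫ ω, R ω * W ω ∂μ| ≤ t := by
    calc |∫ ω, R ω * W ω ∂μ| ≤ ∫ ω, |R ω * W ω| ∂μ := abs_integral_le_integral_abs
      _ ≤ ∫ ω, t * (2 / 3 * |U ω| ^ 3 + 1 / 3 * |V ω| ^ 3) ∂μ := by
          refine integral_mono (hR.mul hW).integrable.abs
            (((i3U.const_mul _).add (i3V.const_mul _)).const_mul _) fun ω => ?_
          have h1 := sq_mul_le_cubes (abs_nonneg (U ω)) (abs_nonneg (V ω))
          simp only [abs_mul]
          calc |R ω| * |W ω| ≤ (t * |U ω| ^ 2) * |V ω| :=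
                mul_le_mul (hRU ω) (hWV ω) (abs_nonneg _) (by positivity)
            _ = t * (|U ω| ^ 2 * |V ω|) := by ring
            _ ≤ _ := mul_le_mul_of_nonneg_left h1 ht
      _ = t * (2 / 3 * ∫ ω, |U ω| ^ 3 ∂μ) + t * (1 / 3 * ∫ ω, |V ω| ^ 3 ∂μ) := by
          rw [integral_const_mul, integral_add (i3U.const_mul _) (i3V.const_mul _),
            integral_const_mul, integral_const_mul, mul_add]
      _ ≤ t := by nlinarith
  have b2 : |∫ ω, R ω ∂μ| ≤ t := by
    calc |∫ ω, R ω ∂μ| ≤ ∫ ω, |R ω| ∂μ := abs_integral_le_integral_abs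
      _ ≤ ∫ ω, t * (2 / 3 * |U ω| ^ 3 + 1 / 3) ∂μ := by
          refine integral_mono hR.integrable.abs
            (((i3U.const_mul _).add (integrable_const _)).const_mul _) fun ω => ?_
          have h1 := sq_mul_le_cubes (abs_nonneg (U ω)) zero_le_one
          refine (hRU ω).trans (mul_le_mul_of_nonneg_left ?_ ht)
          linarith
      _ = t * (2 / 3 * (∫ ω, |U ω| ^ 3 ∂μ) + 1 / 3) := by
          rw [integral_const_mul, integral_add (i3U.const_mul _) (integrable_const _),
            integral_const_mul]
          simp
      _ ≤ t := by nlinarith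
  have b3 : |∫ ω, W ω ∂μ| ≤ 1 := by
    calc |∫ ω, W ω ∂μ| ≤ ∫ ω, |W ω| ∂μ := abs_integral_le_integral_abs
      _ ≤ ∫ ω, (2 / 3 + 1 / 3 * |V ω| ^ 3) ∂μ := by
          refine integral_mono hW.integrable.abs
            ((integrable_const _).add (i3V.const_mul _)) fun ω => ?_
          have h1 := sq_mul_le_cubes zero_le_one (abs_nonneg (V ω))
          refine (hWV ω).trans ?_
          linarith
      _ = 2 / 3 + 1 / 3 * ∫ ω, |V ω| ^ 3 ∂μ := by
          rw [integral_add (integrable_const _) (i3V.const_mul _), integral_const_mul]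
          simp
      _ ≤ 1 := by linarith
  calc _ ≤ |∫ ω, R ω * W ω ∂μ| + |(∫ ω, R ω ∂μ) * ∫ ω, W ω ∂μ| := abs_sub _ _
    _ ≤ t + t * 1 := by
        rw [abs_mul]
        exact add_le_add b1 (mul_le_mul b2 b3 (abs_nonneg _) ht)
    _ = 2 * t := by ring

theorem HasAllMoments.of_abs_le {Ω : Type*} [MeasurableSpace Ω] {μ : Measure Ω} {F G : Ω → ℝ}
    (hG : HasAllMoments μ G) (hF : AEStronglyMeasurable F μ) (h : ∀ ω, |F ω| ≤ |G ω|) :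
    HasAllMoments μ F :=
  fun r => (hG r).mono hF (Filter.Eventually.of_forall h)

/-- The covariance inequality for variables with third moments at most one. -/
theorem abs_covariance_le_of_third_moment {Ω : Type*} {m₁ m₂ mΩ : MeasurableSpace Ω}
    (h₁ : m₁ ≤ mΩ) (h₂ : m₂ ≤ mΩ) (μ : Measure Ω) [IsProbabilityMeasure μ] {t : ℝ} (ht : 0 < t)
    (hα : ∀ A B, MeasurableSet[m₁] A → MeasurableSet[m₂] B →
      |μ.real (A ∩ B) - μ.real A * μ.real B| ≤ t ^ 3)
    {U V : Ω → ℝ} (hU : Measurable[m₁] U) (hV : Measurable[m₂] V) (mU : HasAllMoments μ U)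
    (mV : HasAllMoments μ V) (hU3 : ∫ ω, |U ω| ^ 3 ∂μ ≤ 1) (hV3 : ∫ ω, |V ω| ^ 3 ∂μ ≤ 1) :
    |(∫ ω, U ω * V ω ∂μ) - (∫ ω, U ω ∂μ) * ∫ ω, V ω ∂μ| ≤ 8 * t := by
  -- Truncating at `t⁻¹` balances the errors: the bounded parts contribute `4 t³ t⁻² = 4t`, and each
  -- of the two remainders at most `2t`.
  have hM : 0 < t⁻¹ := inv_pos.2 ht
  have mc : ∀ F : Ω → ℝ, Measurable F → HasAllMoments μ F →
      HasAllMoments μ (fun ω => clamp t⁻¹ (F ω)) := fun F hF mF =>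
    mF.of_abs_le ((measurable_clamp _).comp hF).aestronglyMeasurable
      fun ω => abs_clamp_le_abs hM.le _
  have mU' := mc U (hU.mono h₁ le_rfl) mU
  have mV' := mc V (hV.mono h₂ le_rfl) mV
  have mR : ∀ F : Ω → ℝ, HasAllMoments μ F → HasAllMoments μ (fun ω => clamp t⁻¹ (F ω)) →
      HasAllMoments μ (fun ω => F ω - clamp t⁻¹ (F ω)) := fun F a b r => (a r).sub (b r)
  have hR : ∀ x : ℝ, |x - clamp t⁻¹ x| ≤ t * |x| ^ 2 := by
    intro x
    have := mul_abs_sub_clamp_le hM.le x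
    rwa [inv_mul_le_iff₀ ht] at this
  have c1 := abs_covariance_le_of_bounded h₁ h₂ μ hα ((measurable_clamp t⁻¹).comp hU)
    ((measurable_clamp t⁻¹).comp hV) (fun ω => abs_clamp_le hM.le (U ω))
    (fun ω => abs_clamp_le hM.le (V ω))
  have c2 := abs_covariance_truncation_le μ mU mV mV' hU3 hV3 ht.le (mR U mU mU')
    (fun ω => hR (U ω)) (fun ω => abs_clamp_le_abs hM.le _)
  have c3 := abs_covariance_truncation_le μ mV mU mU hV3 hU3 ht.le (mR V mV mV')
    (fun ω => hR (V ω)) (fun ω => le_rfl)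
  simp only [Function.comp] at c1
  have e1 : ∫ ω, (U ω - clamp t⁻¹ (U ω)) * clamp t⁻¹ (V ω) ∂μ =
      (∫ ω, U ω * clamp t⁻¹ (V ω) ∂μ) - ∫ ω, clamp t⁻¹ (U ω) * clamp t⁻¹ (V ω) ∂μ := by
    simp_rw [sub_mul]
    exact integral_sub (mU.mul mV').integrable (mU'.mul mV').integrable
  have e2 : ∫ ω, (V ω - clamp t⁻¹ (V ω)) * U ω ∂μ =
      (∫ ω, U ω * V ω ∂μ) - ∫ ω, U ω * clamp t⁻¹ (V ω) ∂μ := by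
    rw [← integral_sub (mU.mul mV).integrable (mU.mul mV').integrable]
    exact integral_congr_ae (Filter.Eventually.of_forall fun ω => by ring)
  rw [e1, integral_sub mU.integrable mU'.integrable] at c2
  rw [e2, integral_sub mV.integrable mV'.integrable] at c3
  have e3 : 4 * t ^ 3 * t⁻¹ ^ 2 = 4 * t := by field_simp
  rw [e3] at c1
  rw [abs_le] at *
  constructor <;> nlinarith [c1.1, c1.2, c2.1, c2.2, c3.1, c3.2]

/-- The covariance inequality for variables with given bounds on their third moments. -/
theorem abs_covariance_le {Ω : Type*} {m₁ m₂ mΩ : MeasurableSpace Ω}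
    (h₁ : m₁ ≤ mΩ) (h₂ : m₂ ≤ mΩ) (μ : Measure Ω) [IsProbabilityMeasure μ] {t : ℝ} (ht : 0 < t)
    (hα : ∀ A B, MeasurableSet[m₁] A → MeasurableSet[m₂] B →
      |μ.real (A ∩ B) - μ.real A * μ.real B| ≤ t ^ 3)
    {U V : Ω → ℝ} (hU : Measurable[m₁] U) (hV : Measurable[m₂] V) (mU : HasAllMoments μ U)
    (mV : HasAllMoments μ V) {u v : ℝ} (hu : 0 < u) (hv : 0 < v)
    (hU3 : ∫ ω, |U ω| ^ 3 ∂μ ≤ u ^ 3) (hV3 : ∫ ω, |V ω| ^ 3 ∂μ ≤ v ^ 3) :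
    |(∫ ω, U ω * V ω ∂μ) - (∫ ω, U ω ∂μ) * ∫ ω, V ω ∂μ| ≤ 8 * t * (u * v) := by
  have scale : ∀ (F : Ω → ℝ) (r : ℝ), 0 < r → ∫ ω, |F ω| ^ 3 ∂μ ≤ r ^ 3 →
      ∫ ω, |r⁻¹ * F ω| ^ 3 ∂μ ≤ 1 := by
    intro F r hr h
    simp_rw [abs_mul, mul_pow]
    rw [integral_const_mul, abs_of_pos (inv_pos.2 hr), inv_pow, inv_mul_le_iff₀ (by positivity)]
    simpa using h
  have h := abs_covariance_le_of_third_moment h₁ h₂ μ ht hα (hU.const_mul u⁻¹)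
    (hV.const_mul v⁻¹) (mU.const_mul u⁻¹) (mV.const_mul v⁻¹) (scale U u hu hU3)
    (scale V v hv hV3)
  have e : (∫ ω, u⁻¹ * U ω * (v⁻¹ * V ω) ∂μ) - (∫ ω, u⁻¹ * U ω ∂μ) * ∫ ω, v⁻¹ * V ω ∂μ =
      (u * v)⁻¹ * ((∫ ω, U ω * V ω ∂μ) - (∫ ω, U ω ∂μ) * ∫ ω, V ω ∂μ) := by
    have : ∀ ω, u⁻¹ * U ω * (v⁻¹ * V ω) = (u * v)⁻¹ * (U ω * V ω) := fun ω => by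
      rw [mul_inv]; ring
    simp_rw [this, integral_const_mul]
    rw [mul_inv]; ring
  rw [e, abs_mul, abs_of_pos (inv_pos.2 (mul_pos hu hv)), inv_mul_le_iff₀ (mul_pos hu hv)] at h
  linarith

/-! ### A moment inequality under geometric mixing -/

theorem sum_range_exp_neg_le {s : ℝ} (hs : 0 < s) (n : ℕ) :
    ∑ j ∈ Finset.range n, Real.exp (-(s * j)) ≤ 1 + 1 / s := by
  have h1 : ∀ j : ℕ, Real.exp (-(s * j)) = Real.exp (-s) ^ j := by
    intro j
    rw [← Real.exp_nat_mul]; congr 1; ring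
  simp_rw [h1]
  have hlt : Real.exp (-s) < 1 := by rw [Real.exp_lt_one_iff]; linarith
  have hgeom : (∑ j ∈ Finset.range n, Real.exp (-s) ^ j) * (1 - Real.exp (-s)) ≤ 1 := by
    rw [geom_sum_mul_neg]
    have := pow_nonneg (Real.exp_pos (-s)).le n
    linarith
  have hinv : 1 ≤ (1 + 1 / s) * (1 - Real.exp (-s)) := by
    have h2 : (1 + s) * Real.exp (-s) ≤ 1 := by
      have h3 := Real.add_one_le_exp s
      calc (1 + s) * Real.exp (-s) ≤ Real.exp s * Real.exp (-s) := by
            gcongr; linarith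
        _ = 1 := by rw [← Real.exp_add]; simp
    have e : (1 + 1 / s) * (1 - Real.exp (-s)) = 1 + (1 - (1 + s) * Real.exp (-s)) / s := by
      field_simp; ring
    rw [e]
    have : 0 ≤ (1 - (1 + s) * Real.exp (-s)) / s := div_nonneg (by linarith) hs.le
    linarith
  have hpos : 0 < 1 - Real.exp (-s) := by linarith
  exact le_of_mul_le_mul_right (hgeom.trans hinv) hpos

/-- Truncated subtraction makes the terms with `g ≤ k` equal to one. These are the gaps at which
products with lag `k` may overlap, and they account for the summand `k`. -/
theorem sum_range_exp_neg_sub_le {s : ℝ} (hs : 0 < s) (k n : ℕ) :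
    ∑ g ∈ Finset.range n, Real.exp (-(s * ((g - k : ℕ) : ℝ))) ≤ k + 1 + 1 / s := by
  calc ∑ g ∈ Finset.range n, Real.exp (-(s * ((g - k : ℕ) : ℝ)))
      ≤ ∑ g ∈ Finset.range (k + n), Real.exp (-(s * ((g - k : ℕ) : ℝ))) :=
        Finset.sum_le_sum_of_subset_of_nonneg (Finset.range_subset_range.2 (by omega))
          fun g _ _ => (Real.exp_pos _).le
    _ = ∑ g ∈ Finset.range k, Real.exp (-(s * ((g - k : ℕ) : ℝ))) +
          ∑ j ∈ Finset.range n, Real.exp (-(s * j)) := by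
        rw [Finset.sum_range_add]; simp
    _ ≤ k + (1 + 1 / s) := by
        refine add_le_add ?_ (sum_range_exp_neg_le hs n)
        calc ∑ g ∈ Finset.range k, Real.exp (-(s * ((g - k : ℕ) : ℝ)))
            ≤ ∑ g ∈ Finset.range k, (1 : ℝ) := by
              refine Finset.sum_le_sum fun g _ => Real.exp_le_one_iff.2 ?_
              have : 0 ≤ s * ((g - k : ℕ) : ℝ) := by positivity
              linarith
          _ = k := by simp
    _ = _ := by ring

theorem inv_one_sub_pow_le_exp {y : ℝ} (h0 : 0 ≤ y) (h1 : y ≤ 1 / 2) (n : ℕ) :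
    ((1 - y)⁻¹) ^ n ≤ Real.exp (2 * y * n) := by
  have : (1 - y)⁻¹ ≤ Real.exp (2 * y) := by
    rw [inv_le_iff_one_le_mul₀ (by linarith)]
    have := Real.add_one_le_exp (2 * y)
    nlinarith
  calc ((1 - y)⁻¹) ^ n ≤ Real.exp (2 * y) ^ n :=
        pow_le_pow_left₀ (inv_nonneg.2 (by linarith)) this n
    _ = _ := by rw [← Real.exp_nat_mul]; congr 1; ring

/-- `Y 0, …, Y (n - 1)` are centred, satisfy a moment condition of Bernstein type with exponent
`2 * d`, and are geometrically `α`-mixing across gaps larger than `k`. -/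
structure IsMixingSequence {Ω : Type*} [MeasurableSpace Ω] (μ : Measure Ω) (Y : ℕ → Ω → ℝ)
    (n k : ℕ) (d K ρ : ℝ) (past future : ℕ → MeasurableSpace Ω) : Prop where
  hasAllMoments : ∀ i < n, HasAllMoments μ (Y i)
  mean : ∀ i < n, ∫ ω, Y i ω ∂μ = 0
  moment : ∀ r i, 1 ≤ r → i < n →
    ∫ ω, |Y i ω| ^ r ∂μ ≤ 2 ^ r * ((2 * r).factorial : ℝ) ^ d
  past_le : ∀ i, past i ≤ ‹MeasurableSpace Ω›
  future_le : ∀ i, future i ≤ ‹MeasurableSpace Ω›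
  measurable_past : ∀ i j, i ≤ j → Measurable[past j] (Y i)
  measurable_future : ∀ i j, j ≤ i → Measurable[future j] (Y i)
  mixing : ∀ (i g : ℕ) (A B : Set Ω), k < g → MeasurableSet[past i] A →
    MeasurableSet[future (i + g)] B →
    |μ.real (A ∩ B) - μ.real A * μ.real B| ≤ K * (ρ ^ (g - k))⁻¹

theorem measurable_list_prod {Ω : Type*} {m : MeasurableSpace Ω} {Y : ℕ → Ω → ℝ} (J : List ℕ)
    (h : ∀ i ∈ J, Measurable[m] (Y i)) : Measurable[m] (fun ω => (J.map fun i => Y i ω).prod) := by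
  induction J with
  | nil => simp
  | cons a J ih =>
    simp only [List.map_cons, List.prod_cons]
    exact (h a (by simp)).mul (ih fun i hi => h i (by simp [hi]))

namespace IsMixingSequence

variable {Ω : Type*} [MeasurableSpace Ω] {μ : Measure Ω} [IsProbabilityMeasure μ]
  {Y : ℕ → Ω → ℝ} {n k : ℕ} {d K ρ : ℝ} {past future : ℕ → MeasurableSpace Ω}

/-- For gaps above `k` this is the mixing rate together with `K ≤ (1 + √K)³`. For shorter gaps the
exponential is one and the bound is trivial. The cube matches the covariance inequality with third
moments. -/
theorem mixing_le_cube (h : IsMixingSequence μ Y n k d K ρ past future) (hK : 0 ≤ K) (hρ : 1 < ρ)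
    (i g : ℕ) (A B : Set Ω) (hA : MeasurableSet[past i] A)
    (hB : MeasurableSet[future (i + g)] B) :
    |μ.real (A ∩ B) - μ.real A * μ.real B| ≤
      ((1 + √K) * Real.exp (-(Real.log ρ / 3 * ((g - k : ℕ) : ℝ)))) ^ 3 := by
  have hs := Real.sqrt_nonneg K
  have hs2 := Real.sq_sqrt hK
  have e : Real.exp (-(Real.log ρ / 3 * ((g - k : ℕ) : ℝ))) ^ 3 = (ρ ^ (g - k))⁻¹ := by
    rw [← Real.exp_nat_mul, ← Real.exp_log (show 0 < ρ ^ (g - k) by positivity), Real.log_pow,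
      ← Real.exp_neg]
    congr 1; push_cast; ring
  rw [mul_pow, e]
  by_cases hg : k < g
  · refine (h.mixing i g A B hg hA hB).trans ?_
    refine mul_le_mul_of_nonneg_right ?_ (by positivity)
    nlinarith [pow_nonneg hs 3]
  · have : g - k = 0 := by omega
    rw [this, pow_zero, inv_one, mul_one]
    have a1 := measureReal_nonneg (μ := μ) (s := A ∩ B)
    have a2 := measureReal_le_one (μ := μ) (s := A ∩ B)
    have a3 := measureReal_nonneg (μ := μ) (s := A)
    have a4 := measureReal_le_one (μ := μ) (s := A)
    have a5 := measureReal_nonneg (μ := μ) (s := B)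
    have a6 := measureReal_le_one (μ := μ) (s := B)
    have a7 := mul_nonneg a3 a5
    have a8 := mul_le_one₀ a4 a5 a6
    calc |μ.real (A ∩ B) - μ.real A * μ.real B| ≤ 1 := by
          rw [abs_le]; constructor <;> linarith
      _ ≤ (1 + √K) ^ 3 := one_le_pow₀ (by linarith)

/-- `V` plays the role of a variance: a cluster of `m + 2` entries costs at most `V z² (R z)^m`.
With `R z ≤ 1/2` these costs sum to at most `2 V z²`, which dictates `w = (1 - 2 V z²)⁻¹`. The
`m`-th power of the chosen `θ m` is the decay of the cube root of the mixing rate, for every `m`. -/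
theorem abs_integral_sum_pow_le (h : IsMixingSequence μ Y n k d K ρ past future) (hK : 0 ≤ K)
    (hρ : 1 < ρ) (hd : 0 ≤ d) {p : ℕ} (hp : 1 ≤ p) (hk : k ≤ p) {q : ℕ} {Q : ℝ} (hQ : 0 < Q)
    (hfac : ∀ a, 1 ≤ a → a < q → ((6 * a).factorial : ℝ) ≤ 729 * Q ^ (6 * (a - 1)))
    {z V R : ℝ} (hz : 0 < z)
    (hV : V = 96 * 81 ^ d * (1 + √K) * (p * (1 + 1 / Real.log ρ)))
    (hR : R = 12 * (p * (1 + 1 / Real.log ρ)) * q * (Q ^ 2) ^ d)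
    (hRz : R * z ≤ 1 / 2) (hVz : 2 * V * z ^ 2 ≤ 1 / 2) :
    |∫ ω, (∑ i ∈ Finset.range n, Y i ω) ^ q ∂μ| ≤
      q.factorial * ((z ^ q)⁻¹ * Real.exp (4 * V * z ^ 2 * n)) := by
  set κ := 1 + √K with hκ
  have hκ1 : 1 ≤ κ := by rw [hκ]; linarith [Real.sqrt_nonneg K]
  have hlog : 0 < Real.log ρ := Real.log_pos hρ
  set L := 1 + 1 / Real.log ρ with hL
  have hL1 : 1 ≤ L := by rw [hL]; have : 0 < 1 / Real.log ρ := by positivity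
                         linarith
  have hp' : (1 : ℝ) ≤ p := by exact_mod_cast hp
  have hVpos : 0 < V := by rw [hV]; positivity
  have hRnn : 0 ≤ R := by rw [hR]; positivity
  have h1 : |∫ ω, (∑ i ∈ Finset.range n, Y i ω) ^ q ∂μ| ≤
      q.factorial * ((z ^ q)⁻¹ * ((1 - 2 * V * z ^ 2)⁻¹) ^ n) := by
    refine LocalYW.abs_integral_sum_pow_le μ h.hasAllMoments h.mean (D := 8 * κ)
      (H := 2 * 9 ^ d) (G := 2 * (Q ^ 2) ^ d)
      (θ := fun m g => Real.exp (-(Real.log ρ / (3 * m) * ((g - k : ℕ) : ℝ))))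
      (σ := fun m => 3 * m * (p * L)) (by positivity) (by positivity) (by positivity)
      ?_ (fun m g => (Real.exp_pos _).le) ?_ ?_ hz ?_ ?_
    · intro a i ha haq hi
      refine (h.moment (3 * a) i (by omega) hi).trans ?_
      obtain ⟨b, rfl⟩ : ∃ b, a = b + 1 := ⟨a - 1, by omega⟩
      have hf := hfac (b + 1) ha haq
      rw [Nat.add_sub_cancel] at hf ⊢
      calc (2 : ℝ) ^ (3 * (b + 1)) * ((2 * (3 * (b + 1))).factorial : ℝ) ^ d
          ≤ 2 ^ (3 * (b + 1)) * (729 * Q ^ (6 * b)) ^ d := by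
            refine mul_le_mul_of_nonneg_left (Real.rpow_le_rpow (by positivity) ?_ hd)
              (by positivity)
            rw [← mul_assoc]; exact hf
        _ = _ := by
            have e1 : (729 : ℝ) ^ d = (9 ^ d) ^ 3 := by
              rw [← Real.rpow_natCast, ← Real.rpow_mul (by norm_num), mul_comm,
                Real.rpow_mul (by norm_num)]
              norm_num
            have e2 : (Q ^ (6 * b)) ^ d = (((Q ^ 2) ^ d) ^ b) ^ 3 := by
              rw [← pow_mul, ← Real.rpow_natCast ((Q ^ 2) ^ d), ← Real.rpow_mul (by positivity),
                mul_comm d, Real.rpow_mul (by positivity), Real.rpow_natCast, ← pow_mul]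
              congr 2; ring
            rw [Real.mul_rpow (by norm_num) (by positivity), e1, e2]
            ring
    · intro J₁ J₂ x g m hm le1 le2 n1 n2 u v hu hv m1 m2
      have hc := abs_covariance_le (h.past_le x) (h.future_le (x + g)) μ
        (t := κ * Real.exp (-(Real.log ρ / 3 * ((g - k : ℕ) : ℝ)))) (by positivity)
        (fun A B hA hB => h.mixing_le_cube hK hρ x g A B hA hB)
        (measurable_list_prod J₁ fun i hi => h.measurable_past i x (le1 i hi))
        (measurable_list_prod J₂ fun i hi => h.measurable_future i (x + g) (le2 i hi))
        (HasAllMoments.list_prod J₁ fun i hi => h.hasAllMoments i (n1 i hi))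
        (HasAllMoments.list_prod J₂ fun i hi => h.hasAllMoments i (n2 i hi)) hu hv m1 m2
      refine hc.trans (le_of_eq ?_)
      have hm' : (m : ℝ) ≠ 0 := by exact_mod_cast (by omega : m ≠ 0)
      have e : Real.exp (-(Real.log ρ / (3 * m) * ((g - k : ℕ) : ℝ))) ^ m =
          Real.exp (-(Real.log ρ / 3 * ((g - k : ℕ) : ℝ))) := by
        rw [← Real.exp_nat_mul]; congr 1; field_simp
      rw [e]; ring
    · intro m hm _
      have hm' : (1 : ℝ) ≤ m := by exact_mod_cast hm
      have hk' : (k : ℝ) ≤ p := by exact_mod_cast hk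
      refine (sum_range_exp_neg_sub_le (by positivity) k n).trans ?_
      have e : 1 / (Real.log ρ / (3 * m)) = 3 * m * (1 / Real.log ρ) := by field_simp
      rw [e, hL]
      have : 0 < 1 / Real.log ρ := by positivity
      have h2 : (m : ℝ) * (1 / Real.log ρ) ≤ m * (1 / Real.log ρ) * p :=
        le_mul_of_one_le_right (by positivity) hp'
      have h3 : (p : ℝ) ≤ m * p := le_mul_of_one_le_left (by positivity) hm'
      nlinarith
    · rw [one_lt_inv₀ (by linarith)]
      have : 0 < 2 * V * z ^ 2 := by positivity
      linarith
    · intro r hr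
      rw [inv_inv]
      calc _ ≤ ∑ m ∈ Finset.range r, V * z ^ 2 * (1 / 2) ^ m := by
            refine Finset.sum_le_sum fun m hm => ?_
            have hm' : m + 1 ≤ q := by have := Finset.mem_range.1 hm; omega
            -- The factor `(m + 1)^(m + 1)` comes from spreading the decay over `m + 1` gaps. One
            -- copy is absorbed by `2^m`, the others by `q^m`; this is the origin of the factor `q`
            -- in `R`.
            have b1 : ((m + 1 : ℕ) : ℝ) ^ (m + 1) ≤ (2 * q) ^ m := by
              have c1 : ((m + 1 : ℕ) : ℝ) ≤ 2 ^ m := by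
                exact_mod_cast Nat.lt_two_pow_self (n := m)
              have c2 : ((m + 1 : ℕ) : ℝ) ≤ q := by exact_mod_cast hm'
              rw [pow_succ', mul_pow]
              exact mul_le_mul c1 (pow_le_pow_left₀ (by positivity) c2 _) (by positivity)
                (by positivity)
            calc 8 * κ * (2 * 9 ^ d) ^ 2 * (2 * (Q ^ 2) ^ d) ^ m *
                  (3 * ((m + 1 : ℕ) : ℝ) * (p * L)) ^ (m + 1) * z ^ (m + 2)
                = (96 * ((9 : ℝ) ^ d) ^ 2 * κ * (p * L)) * z ^ 2 *
                  ((6 * (p * L) * (Q ^ 2) ^ d * z) ^ m * ((m + 1 : ℕ) : ℝ) ^ (m + 1)) := by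
                  have e6 : (6 : ℝ) ^ m = 2 ^ m * 3 ^ m := by rw [← mul_pow]; norm_num
                  simp only [mul_pow, e6]; ring
              _ ≤ (96 * ((9 : ℝ) ^ d) ^ 2 * κ * (p * L)) * z ^ 2 *
                  ((6 * (p * L) * (Q ^ 2) ^ d * z) ^ m * (2 * q) ^ m) := by gcongr
              _ = V * z ^ 2 * (R * z) ^ m := by
                  have e1 : ((9 : ℝ) ^ d) ^ 2 = 81 ^ d := by
                    rw [← Real.rpow_natCast, ← Real.rpow_mul (by norm_num), mul_comm,
                      Real.rpow_mul (by norm_num)]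
                    norm_num
                  rw [e1, hV, hR, ← mul_pow]
                  congr 2; ring
              _ ≤ V * z ^ 2 * (1 / 2) ^ m := by gcongr
        _ ≤ V * z ^ 2 * 2 := by
            rw [← Finset.mul_sum]
            exact mul_le_mul_of_nonneg_left (sum_geometric_two_le r) (by positivity)
        _ = 1 - (1 - 2 * V * z ^ 2) := by ring
  refine h1.trans ?_
  have h2 := inv_one_sub_pow_le_exp (y := 2 * V * z ^ 2) (by positivity) hVz n
  have e : 2 * (2 * V * z ^ 2) * n = 4 * V * z ^ 2 * n := by ring
  rw [e] at h2
  gcongr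

end IsMixingSequence

/-! ### Exponential inequality under geometric mixing -/

/-- The first six factors give `6! = 720`, rounded up to `729 = 9³` so that its `d`-th power is the
cube of `9^d`; each of the others is at most `6a`. -/
theorem factorial_six_mul_le {a : ℕ} (ha : 1 ≤ a) :
    ((6 * a).factorial : ℝ) ≤ 729 * (6 * a) ^ (6 * (a - 1)) := by
  obtain ⟨b, rfl⟩ : ∃ b, a = b + 1 := ⟨a - 1, by omega⟩
  have h1 := Nat.factorial_mul_ascFactorial 6 (6 * b)
  have h2 := Nat.ascFactorial_le_pow_add 6 (6 * b)
  have h3 : (6 * (b + 1)).factorial ≤ 729 * (6 * (b + 1)) ^ (6 * b) := by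
    rw [show 6 * (b + 1) = 6 + 6 * b by ring, ← h1]
    exact Nat.mul_le_mul (by decide) h2
  rw [Nat.add_sub_cancel]
  exact_mod_cast h3

/-- Markov's inequality for an even moment. -/
theorem measureReal_lt_abs_le {Ω : Type*} [MeasurableSpace Ω] {μ : Measure Ω}
    [IsFiniteMeasure μ] {S : Ω → ℝ} {q : ℕ}
    (hInt : Integrable (fun ω => |S ω| ^ q) μ) {y : ℝ} (hy : 0 < y) :
    μ.real {ω | y < |S ω|} ≤ (∫ ω, |S ω| ^ q ∂μ) / y ^ q := by
  have h := mul_meas_ge_le_integral_of_nonneg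
    (Filter.Eventually.of_forall fun ω => pow_nonneg (abs_nonneg (S ω)) q) hInt (y ^ q)
  rw [le_div_iff₀ (by positivity), mul_comm]
  refine le_trans (mul_le_mul_of_nonneg_left (measureReal_mono fun ω hω => ?_) (by positivity)) h
  exact pow_le_pow_left₀ hy.le (le_of_lt hω) q

namespace IsMixingSequence

variable {Ω : Type*} [MeasurableSpace Ω] {μ : Measure Ω} [IsProbabilityMeasure μ]
  {Y : ℕ → Ω → ℝ} {n k : ℕ} {d K ρ : ℝ} {past future : ℕ → MeasurableSpace Ω}

/-- The exponential inequality, with the order `q` of the moment still free. -/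
theorem measureReal_lt_abs_sum_le_of_moment (h : IsMixingSequence μ Y n k d K ρ past future)
    (hK : 0 ≤ K) (hρ : 1 < ρ) (hd : 0 ≤ d) {p : ℕ} (hp : 1 ≤ p) (hk : k ≤ p) {q : ℕ} {Q : ℝ}
    (hQ : 0 < Q)
    (hfac : ∀ a, 1 ≤ a → a < q → ((6 * a).factorial : ℝ) ≤ 729 * Q ^ (6 * (a - 1)))
    (hq : Even q) (hq0 : 1 ≤ q) {A x ν : ℝ} (hA : 1 ≤ A) (hx : 0 < x) (hν : 0 < ν)
    (hνn : ν ≤ n) (hAν : A ≤ ν) (hqA : q ≤ 2 * A) (hAq : A ≤ 2 * q) (hQA : Q ^ 2 ≤ 32 * A ^ 2)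
    (hgauss : 33000 * A * 256 ^ d * (1 + √K) * (p * (1 + 1 / Real.log ρ)) ≤ x ^ 2 * ν)
    (hheavy : 1000 * A ^ 2 * (32 * A ^ 2) ^ d * (p * (1 + 1 / Real.log ρ)) ≤ x * ν) :
    μ.real {ω | 16 * x * n < |∑ i ∈ Finset.range n, Y i ω|} ≤ Real.exp (-A) := by
  have hlog : 0 < Real.log ρ := Real.log_pos hρ
  set κ := 1 + √K with hκ
  have hκ1 : 1 ≤ κ := by rw [hκ]; linarith [Real.sqrt_nonneg K]
  have hpL : 1 ≤ (p : ℝ) * (1 + 1 / Real.log ρ) := by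
    have h1 : (1 : ℝ) ≤ p := by exact_mod_cast hp
    have h2 : 0 < 1 / Real.log ρ := by positivity
    nlinarith
  set Λ := (p : ℝ) * (1 + 1 / Real.log ρ) with hΛ
  have hn : 0 < (n : ℝ) := hν.trans_le hνn
  have hq' : (1 : ℝ) ≤ q := by exact_mod_cast hq0
  have hS : HasAllMoments μ (fun ω => ∑ i ∈ Finset.range n, Y i ω) :=
    .sum _ fun i hi => h.hasAllMoments i (Finset.mem_range.1 hi)
  -- With this `z`, `q! z^{-q}` is at most `(x n)^q`, so Markov's inequality at level `16 x n`
  -- leaves a spare factor `16^{-q}`. It pays for `exp (q / 40) exp A`, since `A ≤ 2q` and `exp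
  -- (5/2) ≤ 16`.
  set z : ℝ := q / (x * n) with hz
  have hzpos : 0 < z := by positivity
  set V : ℝ := 96 * 81 ^ d * κ * Λ with hV
  set R : ℝ := 12 * Λ * q * (Q ^ 2) ^ d with hR
  have hVn : V * z ^ 2 * n ≤ q / 170 := by
    have e : V * z ^ 2 * n = V * q ^ 2 / (x ^ 2 * n) := by rw [hz]; field_simp
    rw [e, div_le_iff₀ (by positivity)]
    have h81 : (81 : ℝ) ^ d ≤ 256 ^ d := Real.rpow_le_rpow (by norm_num) (by norm_num) hd
    calc V * q ^ 2 ≤ (96 * 256 ^ d * κ * Λ) * (q * (2 * A)) := by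
          rw [hV, sq]; gcongr
      _ = 192 / 33000 * q * (33000 * A * 256 ^ d * κ * Λ) := by ring
      _ ≤ 192 / 33000 * q * (x ^ 2 * n) := by
          exact mul_le_mul_of_nonneg_left (hgauss.trans (by gcongr)) (by positivity)
      _ ≤ q / 170 * (x ^ 2 * n) := by
          have : 0 ≤ q * (x ^ 2 * n) := by positivity
          nlinarith
  -- Here `A ≤ ν` enters, through `q ≤ 2A ≤ 2ν ≤ 2n`.
  have hVz : 2 * V * z ^ 2 ≤ 1 / 2 := by
    have h1 : V * z ^ 2 * n ≤ n / 85 := by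
      refine hVn.trans ?_
      linarith
    have h2 : V * z ^ 2 ≤ 1 / 85 := by
      have e : (n : ℝ) / 85 = 1 / 85 * n := by ring
      rw [e] at h1
      exact le_of_mul_le_mul_right h1 hn
    linarith
  have hRz : R * z ≤ 1 / 2 := by
    have e : R * z = R * q / (x * n) := by rw [hz]; field_simp
    rw [e, div_le_iff₀ (by positivity)]
    calc R * q = 12 * q ^ 2 * (Q ^ 2) ^ d * Λ := by rw [hR]; ring
      _ ≤ 12 * (2 * A) ^ 2 * (32 * A ^ 2) ^ d * Λ := by gcongr
      _ = 48 / 1000 * (1000 * A ^ 2 * (32 * A ^ 2) ^ d * Λ) := by ring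
      _ ≤ 48 / 1000 * (x * n) := by
          exact mul_le_mul_of_nonneg_left (hheavy.trans (by gcongr)) (by norm_num)
      _ ≤ 1 / 2 * (x * n) := by
          have : 0 ≤ x * n := by positivity
          nlinarith
  have hm := h.abs_integral_sum_pow_le hK hρ hd hp hk hQ hfac hzpos hV hR hRz hVz
  have hmk := measureReal_lt_abs_le (q := q) (hS.abs.pow q).integrable
    (show 0 < 16 * x * n by positivity)
  have habs : ∀ ω, |∑ i ∈ Finset.range n, Y i ω| ^ q = (∑ i ∈ Finset.range n, Y i ω) ^ q :=
    fun ω => hq.pow_abs _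
  simp_rw [habs] at hmk
  refine hmk.trans ?_
  rw [div_le_iff₀ (by positivity)]
  refine (le_abs_self _).trans (hm.trans ?_)
  have hexp : Real.exp (4 * V * z ^ 2 * n) ≤ Real.exp (q / 40) := by
    apply Real.exp_le_exp.2
    nlinarith
  have hfacq : (q.factorial : ℝ) ≤ q ^ q := by exact_mod_cast Nat.factorial_le_pow q
  have h16 : Real.exp (q / 40) * Real.exp A ≤ 16 ^ q := by
    calc Real.exp (q / 40) * Real.exp A ≤ Real.exp (q * (5 / 2)) := by
          rw [← Real.exp_add]
          apply Real.exp_le_exp.2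
          linarith
      _ = Real.exp (5 / 2) ^ q := by rw [← Real.exp_nat_mul]
      _ ≤ 16 ^ q := by
          gcongr
          have h5 : Real.exp (5 / 2) ^ 2 ≤ 16 ^ 2 := by
            have e : Real.exp (5 / 2) ^ 2 = Real.exp 1 ^ 5 := by
              rw [← Real.exp_nat_mul, ← Real.exp_nat_mul]; norm_num
            rw [e]
            calc Real.exp 1 ^ 5 ≤ 2.7182818286 ^ 5 :=
                  pow_le_pow_left₀ (Real.exp_pos 1).le Real.exp_one_lt_d9.le 5
              _ ≤ 16 ^ 2 := by norm_num
          exact le_of_sq_le_sq h5 (by norm_num)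
  calc (q.factorial : ℝ) * ((z ^ q)⁻¹ * Real.exp (4 * V * z ^ 2 * n))
      ≤ q ^ q * ((z ^ q)⁻¹ * Real.exp (q / 40)) := by gcongr
    _ = (x * n) ^ q * Real.exp (q / 40) := by
        rw [hz, div_pow]; field_simp
    _ ≤ (x * n) ^ q * (16 ^ q * Real.exp (-A)) := by
        gcongr
        rw [Real.exp_neg, ← div_eq_mul_inv, le_div_iff₀ (Real.exp_pos A)]
        exact h16
    _ = Real.exp (-A) * (16 * x * n) ^ q := by
        rw [mul_assoc, mul_pow 16]; ring

/-- A crude inequality, effective for very large deviations. -/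
theorem measureReal_lt_abs_sum_le_of_large (h : IsMixingSequence μ Y n k d K ρ past future)
    (hd : 0 ≤ d) {A x : ℝ} (hA : 1 ≤ A) (hn : 0 < n)
    (hx : 1000 * A * (32 * A ^ 2) ^ d ≤ x) :
    μ.real {ω | 16 * x * n < |∑ i ∈ Finset.range n, Y i ω|} ≤ Real.exp (-A) := by
  -- A moment of order about `A`, bounded by convexity alone; the dependence between the variables
  -- plays no role.
  set r : ℕ := ⌈A⌉₊ with hr
  have hAr : A ≤ r := Nat.le_ceil A
  have hr1 : 1 ≤ r := by
    have : (0 : ℝ) < r := by linarith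
    exact_mod_cast this
  have hrA : (r : ℝ) ≤ 2 * A := by
    have := Nat.ceil_lt_add_one (show 0 ≤ A by linarith)
    linarith
  have hn' : (0 : ℝ) < n := by exact_mod_cast hn
  have hpow1 : 1 ≤ (32 * A ^ 2) ^ d := Real.one_le_rpow (by nlinarith) hd
  have hx0 : 0 < x := lt_of_lt_of_le (by positivity) hx
  have hS : HasAllMoments μ (fun ω => ∑ i ∈ Finset.range n, Y i ω) :=
    .sum _ fun i hi => h.hasAllMoments i (Finset.mem_range.1 hi)
  have hInt : ∀ i ∈ Finset.range n, Integrable (fun ω => |Y i ω| ^ r) μ := fun i hi =>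
    ((h.hasAllMoments i (Finset.mem_range.1 hi)).abs.pow r).integrable
  have hmom : ∀ i ∈ Finset.range n, ∫ ω, |Y i ω| ^ r ∂μ ≤ (2 * (32 * A ^ 2) ^ d) ^ r := by
    intro i hi
    refine (h.moment r i hr1 (Finset.mem_range.1 hi)).trans ?_
    have hf : ((2 * r).factorial : ℝ) ≤ (32 * A ^ 2) ^ r := by
      have h1 : ((2 * r).factorial : ℝ) ≤ (2 * r : ℝ) ^ (2 * r) := by
        exact_mod_cast Nat.factorial_le_pow (2 * r)
      refine h1.trans ?_
      rw [pow_mul]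
      gcongr
      nlinarith
    calc (2 : ℝ) ^ r * ((2 * r).factorial : ℝ) ^ d ≤ 2 ^ r * ((32 * A ^ 2) ^ r) ^ d := by
          gcongr
      _ = _ := by
          rw [mul_pow 2, ← Real.rpow_natCast (32 * A ^ 2) r, ← Real.rpow_mul (by positivity),
            mul_comm (r : ℝ) d, Real.rpow_mul (by positivity), Real.rpow_natCast]
  have hjensen : ∀ ω, |∑ i ∈ Finset.range n, Y i ω| ^ r ≤
      n ^ r * (∑ i ∈ Finset.range n, |Y i ω| ^ r / n) := by
    intro ω
    have hj := Real.pow_arith_mean_le_arith_mean_pow (Finset.range n) (fun _ => (n : ℝ)⁻¹)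
      (fun i => |Y i ω|) (fun _ _ => by positivity) (by simp [hn'.ne']) (fun _ _ => abs_nonneg _) r
    rw [← Finset.mul_sum, mul_pow, inv_pow, inv_mul_le_iff₀ (by positivity)] at hj
    calc |∑ i ∈ Finset.range n, Y i ω| ^ r ≤ (∑ i ∈ Finset.range n, |Y i ω|) ^ r := by
          gcongr; exact Finset.abs_sum_le_sum_abs _ _
      _ ≤ _ := hj
      _ = _ := by congr 1; exact Finset.sum_congr rfl fun i _ => by ring
  have hE : ∫ ω, |∑ i ∈ Finset.range n, Y i ω| ^ r ∂μ ≤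
      n ^ r * (2 * (32 * A ^ 2) ^ d) ^ r := by
    calc _ ≤ ∫ ω, n ^ r * (∑ i ∈ Finset.range n, |Y i ω| ^ r / n) ∂μ :=
          integral_mono (hS.abs.pow r).integrable
            ((integrable_finsetSum _ fun i hi => (hInt i hi).div_const _).const_mul _) hjensen
      _ = n ^ r * ∑ i ∈ Finset.range n, (∫ ω, |Y i ω| ^ r ∂μ) / n := by
          rw [integral_const_mul, integral_finsetSum _ fun i hi => (hInt i hi).div_const _]
          simp_rw [integral_div]
      _ ≤ n ^ r * ∑ i ∈ Finset.range n, (2 * (32 * A ^ 2) ^ d) ^ r / n := by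
          gcongr with i hi
          exact hmom i hi
      _ = _ := by
          rw [Finset.sum_const, Finset.card_range, nsmul_eq_mul, mul_div_cancel₀ _ hn'.ne']
  refine (measureReal_lt_abs_le (q := r) (hS.abs.pow r).integrable
    (show 0 < 16 * x * n by positivity)).trans ?_
  rw [div_le_iff₀ (by positivity)]
  refine hE.trans ?_
  have hbase : Real.exp 1 * (2 * (32 * A ^ 2) ^ d) ≤ 16 * x := by
    have he : Real.exp 1 ≤ 3 := Real.exp_one_lt_three.le
    nlinarith
  calc (n : ℝ) ^ r * (2 * (32 * A ^ 2) ^ d) ^ r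
      = Real.exp (-r) * (n ^ r * (Real.exp 1 * (2 * (32 * A ^ 2) ^ d)) ^ r) := by
        have : Real.exp (-r) * Real.exp 1 ^ r = 1 := by
          rw [← Real.exp_nat_mul, ← Real.exp_add]; simp
        rw [mul_pow (Real.exp 1)]
        linear_combination -((n : ℝ) ^ r * (2 * (32 * A ^ 2) ^ d) ^ r) * this
    _ ≤ Real.exp (-A) * (n ^ r * (16 * x) ^ r) := by gcongr
    _ = Real.exp (-A) * (16 * x * n) ^ r := by rw [mul_pow (16 * x)]; ring

/-- The exponential inequality for sums of a geometrically mixing sequence. -/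
theorem measureReal_lt_abs_sum_le (h : IsMixingSequence μ Y n k d K ρ past future)
    (hK : 0 ≤ K) (hρ : 1 < ρ) (hd : 0 ≤ d) {p : ℕ} (hp : 1 ≤ p) (hk : k ≤ p)
    {A x ν : ℝ} (hA : 1 ≤ A) (hx : 0 < x) (hν : 0 < ν) (hνn : ν ≤ n)
    (hgauss : 33000 * A * 256 ^ d * (1 + √K) * (p * (1 + 1 / Real.log ρ)) ≤ x ^ 2 * ν)
    (hheavy : 1000 * A ^ 2 * (32 * A ^ 2) ^ d * (p * (1 + 1 / Real.log ρ)) ≤ x * ν) :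
    μ.real {ω | 16 * x * n < |∑ i ∈ Finset.range n, Y i ω|} ≤ Real.exp (-A) := by
  rcases le_or_gt A ν with hAν | hAν
  · rcases le_or_gt A 4 with h4 | h4
    -- For `A ≤ 4` second moments suffice. Only `a = 1` occurs in the factorial condition, so `Q =
    -- 1` works.
    · refine h.measureReal_lt_abs_sum_le_of_moment hK hρ hd hp hk (q := 2) (Q := 1) one_pos ?_
        even_two one_le_two hA hx hν hνn hAν (by push_cast; linarith) (by push_cast; linarith)
        (by nlinarith) hgauss hheavy
      intro a h1 h2
      have : a = 1 := by omega
      subst this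
      norm_num [Nat.factorial]
    -- This even `q` lies between `A / 2` and `A`, as `A > 4`. For `a < q` one has `6a ≤ 3A + 6 ≤
    -- 5A`, hence `Q = 5A`.
    · set q := 2 * ⌈A / 4⌉₊ with hq
      have hc1 : A / 4 ≤ ⌈A / 4⌉₊ := Nat.le_ceil _
      have hc2 : (⌈A / 4⌉₊ : ℝ) < A / 4 + 1 := Nat.ceil_lt_add_one (by linarith)
      have hqr : (q : ℝ) = 2 * ⌈A / 4⌉₊ := by rw [hq]; push_cast; ring
      have hq2 : 2 ≤ q := by
        have : 0 < ⌈A / 4⌉₊ := Nat.ceil_pos.2 (by linarith)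
        omega
      refine h.measureReal_lt_abs_sum_le_of_moment hK hρ hd hp hk (q := q) (Q := 5 * A)
        (by positivity) ?_ (even_two_mul _) (by omega) hA hx hν hνn hAν (by rw [hqr]; linarith)
        (by rw [hqr]; linarith) ?_ hgauss hheavy
      · intro a h1 h2
        refine (factorial_six_mul_le h1).trans ?_
        have h3 : (a : ℝ) + 1 ≤ q := by exact_mod_cast h2
        refine mul_le_mul_of_nonneg_left (pow_le_pow_left₀ (by positivity) ?_ _) (by norm_num)
        linarith
      · nlinarith
  -- If `ν < A`, the heavy-tailed condition forces `x` to be so large that the crude inequality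
  -- applies.
  · have hlog : 0 < Real.log ρ := Real.log_pos hρ
    have hpL : 1 ≤ (p : ℝ) * (1 + 1 / Real.log ρ) := by
      have h1 : (1 : ℝ) ≤ p := by exact_mod_cast hp
      have h2 : 0 < 1 / Real.log ρ := by positivity
      nlinarith
    have hn : 0 < n := by exact_mod_cast hν.trans_le hνn
    refine h.measureReal_lt_abs_sum_le_of_large hd hA hn ?_
    have hpos : 0 < (32 * A ^ 2) ^ d := by positivity
    have h1 : 1000 * A ^ 2 * (32 * A ^ 2) ^ d * 1 ≤ x * A :=
      (mul_le_mul_of_nonneg_left hpL (by positivity)).trans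
        (hheavy.trans (mul_le_mul_of_nonneg_left hAν.le hx.le))
    have hA0 : 0 < A := by linarith
    refine le_of_mul_le_mul_right (le_trans (le_of_eq ?_) h1) hA0
    ring

end IsMixingSequence

/-! ### The local covariance function as a real integral -/

/-- The real form `∫_{-π}^{π} cos(k lam) f(u, lam) d lam` of the local covariance function. -/
noncomputable def realCov (f : ℝ → ℝ → ℝ) (k : ℤ) (u : ℝ) : ℝ :=
  ∫ lam in (-Real.pi)..Real.pi, Real.cos (k * lam) * f u lam

theorem IsLocalSpectralDensity.intervalIntegrable {f : ℝ → ℝ → ℝ} (hf : IsLocalSpectralDensity f)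
    (u a b : ℝ) : IntervalIntegrable (f u) volume a b :=
  ((hf.locallyIntegrable u).integrableOn_isCompact isCompact_uIcc).intervalIntegrable

theorem IsLocalSpectralDensity.intervalIntegrable_mul {f : ℝ → ℝ → ℝ}
    (hf : IsLocalSpectralDensity f) {g : ℝ → ℝ} (hg : Continuous g) (u a b : ℝ) :
    IntervalIntegrable (fun lam => g lam * f u lam) volume a b :=
  (hf.intervalIntegrable u a b).continuousOn_mul hg.continuousOn

theorem re_localCov {f : ℝ → ℝ → ℝ} (hf : IsLocalSpectralDensity f) (k : ℤ) (u : ℝ) :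
    (localCov f k u).re = realCov f k u := by
  have hInt : IntervalIntegrable
      (fun lam : ℝ => Complex.exp (Complex.I * k * lam) * (f u lam : ℂ)) volume
      (-Real.pi) Real.pi := by
    refine IntervalIntegrable.continuousOn_mul ?_ (by fun_prop)
    have h1 := hf.intervalIntegrable u (-Real.pi) Real.pi
    exact ⟨h1.1.ofReal, h1.2.ofReal⟩
  unfold localCov realCov
  rw [← Complex.reCLM_apply, ← Complex.reCLM.intervalIntegral_comp_comm hInt]
  refine intervalIntegral.integral_congr fun lam _ => ?_
  have e : Complex.I * k * lam = ((k * lam : ℝ) : ℂ) * Complex.I := by push_cast; ring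
  simp only [Complex.reCLM_apply]
  rw [e, Complex.re_mul_ofReal, Complex.exp_ofReal_mul_I_re]

theorem IsLocallyStationary.abs_cov_sub_realCov_le {μ : Measure Ω} {X : ℤ → ℕ → Ω → ℝ}
    {f : ℝ → ℝ → ℝ} {C : ℝ} (h : IsLocallyStationary μ X f C) (t k : ℤ) {T : ℕ} (hT : 1 ≤ T) :
    |covariance (X t T) (X (t - k) T) μ - realCov f k ((t : ℝ) / T)| ≤ C / T := by
  have h1 := h.cov_approx t k T hT
  refine le_trans ?_ h1
  have h2 := Complex.abs_re_le_norm
    (((covariance (X t T) (X (t - k) T) μ : ℝ) : ℂ) - localCov f k ((t : ℝ) / T))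
  rwa [Complex.sub_re, Complex.ofReal_re, re_localCov h.density] at h2

theorem DensityBounded.le_upper {f : ℝ → ℝ → ℝ} {mf Mf : ℝ} (h : DensityBounded f mf Mf)
    (u lam : ℝ) : f u lam ≤ Mf := (le_abs_self _).trans (h.upper u lam)

theorem DensityBounded.lower_le {f : ℝ → ℝ → ℝ} {mf Mf : ℝ} (h : DensityBounded f mf Mf)
    (hf : IsLocalSpectralDensity f) (u lam : ℝ) : mf ≤ f u lam := by
  have := h.lower u lam
  rwa [abs_of_nonneg (hf.nonneg u lam)] at this

theorem DensityBounded.lower_le_upper {f : ℝ → ℝ → ℝ} {mf Mf : ℝ} (h : DensityBounded f mf Mf) :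
    mf ≤ Mf := (h.lower 0 0).trans (h.upper 0 0)

theorem realCov_zero_le {f : ℝ → ℝ → ℝ} {mf Mf : ℝ} (hf : IsLocalSpectralDensity f)
    (h : DensityBounded f mf Mf) (u : ℝ) : realCov f 0 u ≤ 2 * Real.pi * Mf := by
  have hpi := Real.pi_pos
  calc realCov f 0 u ≤ ∫ _ in (-Real.pi)..Real.pi, Mf := by
        refine intervalIntegral.integral_mono_on (by linarith)
          (hf.intervalIntegrable_mul (by fun_prop) u _ _) intervalIntegrable_const fun lam _ => ?_
        simpa using h.le_upper u lam
    _ = 2 * Real.pi * Mf := by rw [intervalIntegral.integral_const, smul_eq_mul]; ring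

/-! ### Moments of the products `X_{ℓ-k,T} X_{ℓ,T}` -/

section Moments

variable {μ : Measure Ω} {X : ℤ → ℕ → Ω → ℝ}

theorem BernsteinCond.hasAllMoments [IsProbabilityMeasure μ] {c d : ℝ} (h : BernsteinCond μ X c d) {T : ℕ} {s : ℤ}
    (hmeas : Measurable (X s T)) (h1 : 1 ≤ s) (hT : s ≤ T) : HasAllMoments μ (X s T) := by
  intro r
  have h2 : MemLp (X s T) ((r + 2 : ℕ) : ENNReal) μ := by
    rw [← integrable_norm_rpow_iff hmeas.aestronglyMeasurable (by simp) (by simp)]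
    simpa only [ENNReal.toReal_natCast, Real.rpow_natCast, Real.norm_eq_abs] using
      h.integrable T s (r + 2) h1 hT (by omega)
  exact h2.mono_exponent (by exact_mod_cast (by omega : r ≤ r + 2))

/-- A single constant `b` dominates both `c²` and the variance: `r - 1` factors `b` come from
`c^(2r-2)` and the last one from the variance. -/
theorem BernsteinCond.integral_abs_pow_le {c d b : ℝ} (h : BernsteinCond μ X c d) {T : ℕ} {s : ℤ}
    (h1 : 1 ≤ s) (hT : s ≤ T) (hc : c ^ 2 ≤ b) (hv : variance (X s T) μ ≤ b) {r : ℕ}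
    (hr : 1 ≤ r) : ∫ ω, |X s T ω| ^ (2 * r) ∂μ ≤ b ^ r * ((2 * r).factorial : ℝ) ^ d := by
  have hb := h.bound T s (2 * r) h1 hT (by omega)
  have hc0 := h.c_pos
  obtain ⟨j, rfl⟩ : ∃ j, r = j + 1 := ⟨r - 1, by omega⟩
  have e : 2 * (j + 1) - 2 = 2 * j := by omega
  rw [e, pow_mul] at hb
  have hb0 : 0 ≤ b := (sq_nonneg c).trans hc
  calc _ ≤ _ := hb
    _ ≤ b ^ j * ((2 * (j + 1)).factorial : ℝ) ^ d * b := by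
        have := variance_nonneg (X s T) μ
        gcongr
    _ = _ := by ring

theorem integral_abs_mul_pow_le [IsProbabilityMeasure μ] {F G : Ω → ℝ} (hF : HasAllMoments μ F) (hG : HasAllMoments μ G)
    {B : ℝ} {r : ℕ} (h1 : ∫ ω, |F ω| ^ (2 * r) ∂μ ≤ B) (h2 : ∫ ω, |G ω| ^ (2 * r) ∂μ ≤ B) :
    ∫ ω, |F ω * G ω| ^ r ∂μ ≤ B := by
  have iF := (hF.abs.pow (2 * r)).integrable
  have iG := (hG.abs.pow (2 * r)).integrable
  calc ∫ ω, |F ω * G ω| ^ r ∂μ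
      ≤ ∫ ω, (1 / 2 * |F ω| ^ (2 * r) + 1 / 2 * |G ω| ^ (2 * r)) ∂μ := by
        refine integral_mono ((hF.mul hG).abs.pow r).integrable
          ((iF.const_mul _).add (iG.const_mul _)) fun ω => ?_
        simp only [abs_mul, mul_pow, mul_comm 2 r, pow_mul]
        nlinarith [sq_nonneg (|F ω| ^ r - |G ω| ^ r)]
    _ = 1 / 2 * (∫ ω, |F ω| ^ (2 * r) ∂μ) + 1 / 2 * ∫ ω, |G ω| ^ (2 * r) ∂μ := by
        rw [integral_add (iF.const_mul _) (iG.const_mul _), integral_const_mul,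
          integral_const_mul]
    _ ≤ B := by linarith

/-- Moments of a centred and normalised product. -/
theorem integral_abs_centred_mul_pow_le [IsProbabilityMeasure μ] {F G : Ω → ℝ} (hF : HasAllMoments μ F)
    (hG : HasAllMoments μ G) {b d : ℝ} (hb : 0 < b) (hd : 0 ≤ d)
    (hF' : ∀ r : ℕ, 1 ≤ r → ∫ ω, |F ω| ^ (2 * r) ∂μ ≤ b ^ r * ((2 * r).factorial : ℝ) ^ d)
    (hG' : ∀ r : ℕ, 1 ≤ r → ∫ ω, |G ω| ^ (2 * r) ∂μ ≤ b ^ r * ((2 * r).factorial : ℝ) ^ d)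
    {r : ℕ} (hr : 1 ≤ r) :
    ∫ ω, |b⁻¹ * (F ω * G ω - ∫ ω', F ω' * G ω' ∂μ)| ^ r ∂μ ≤
      2 ^ r * ((2 * r).factorial : ℝ) ^ d := by
  set E : ℝ := ∫ ω', F ω' * G ω' ∂μ with hE
  have hFG := hF.mul hG
  have iFG := (hFG.abs.pow r).integrable
  -- The mean obeys the same bound as the `r`-th moment, because `|E| ≤ b 2^d` and `2^r ≤ (2r)!`.
  -- Centring therefore only costs the factor `2^r`.
  have hEle : |E| ^ r ≤ b ^ r * ((2 * r).factorial : ℝ) ^ d := by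
    have h1 : |E| ≤ b * 2 ^ d := by
      have h2 := integral_abs_mul_pow_le hF hG (hF' 1 le_rfl) (hG' 1 le_rfl)
      simp only [pow_one, mul_one] at h2
      refine le_trans abs_integral_le_integral_abs (h2.trans (le_of_eq ?_))
      norm_num [Nat.factorial]
    calc |E| ^ r ≤ (b * 2 ^ d) ^ r := by gcongr
      _ = b ^ r * ((2 : ℝ) ^ r) ^ d := by
          rw [mul_pow, ← Real.rpow_natCast (2 ^ d) r, ← Real.rpow_natCast 2 r,
            ← Real.rpow_mul (by norm_num), ← Real.rpow_mul (by norm_num), mul_comm d]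
      _ ≤ b ^ r * ((2 * r).factorial : ℝ) ^ d := by
          have h3 : 2 ^ r ≤ (2 * r).factorial := by
            have h4 := Nat.two_pow_mul_factorial_le_factorial_two_mul r
            exact (Nat.le_mul_of_pos_right _ r.factorial_pos).trans h4
          have h5 : (2 : ℝ) ^ r ≤ ((2 * r).factorial : ℝ) := by exact_mod_cast h3
          gcongr
  have hmain := integral_abs_mul_pow_le hF hG (hF' r hr) (hG' r hr)
  set B := b ^ r * ((2 * r).factorial : ℝ) ^ d with hB
  have hpt : ∀ ω, |b⁻¹ * (F ω * G ω - E)| ^ r ≤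
      (b⁻¹) ^ r * (2 ^ (r - 1) * (|F ω * G ω| ^ r + |E| ^ r)) := by
    intro ω
    rw [abs_mul, mul_pow, abs_of_pos (inv_pos.2 hb)]
    gcongr
    calc |F ω * G ω - E| ^ r ≤ (|F ω * G ω| + |E|) ^ r := by gcongr; exact abs_sub _ _
      _ ≤ _ := add_pow_le (abs_nonneg _) (abs_nonneg _) r
  have hc : HasAllMoments μ (fun ω => b⁻¹ * (F ω * G ω - E)) :=
    HasAllMoments.const_mul (fun r => (hFG r).sub (HasAllMoments.const E r)) _
  calc _ ≤ ∫ ω, (b⁻¹) ^ r * (2 ^ (r - 1) * (|F ω * G ω| ^ r + |E| ^ r)) ∂μ :=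
        integral_mono (hc.abs.pow r).integrable
          (((iFG.add (integrable_const _)).const_mul _).const_mul _) hpt
    _ = (b⁻¹) ^ r * (2 ^ (r - 1) * ((∫ ω, |F ω * G ω| ^ r ∂μ) + |E| ^ r)) := by
        rw [integral_const_mul, integral_const_mul, integral_add iFG (integrable_const _)]
        simp
    _ ≤ (b⁻¹) ^ r * (2 ^ (r - 1) * (B + B)) := by gcongr
    _ = 2 ^ r * ((2 * r).factorial : ℝ) ^ d := by
        have e : (2 : ℝ) ^ r = 2 ^ (r - 1) * 2 := by rw [← pow_succ]; congr 1; omega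
        rw [e, hB, inv_pow]
        field_simp
        ring

end Moments

/-! ### Mixing of the products -/

theorem abs_sub_le_alphaMixing (μ : Measure Ω) [IsProbabilityMeasure μ] (X : ℤ → ℕ → Ω → ℝ)
    {T : ℕ} (hT : 1 ≤ T) (s : ℤ) (k : ℕ) {A B : Set Ω} (hA : MeasurableSet[pastSigma X T s] A)
    (hB : MeasurableSet[futureSigma X T (s + k)] B) :
    |μ.real (A ∩ B) - μ.real A * μ.real B| ≤ alphaMixing μ X k := by
  refine le_csSup ⟨1, ?_⟩ ⟨T, s, A, B, hT, hA, hB, rfl⟩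
  rintro r ⟨T, s, A, B, -, -, -, rfl⟩
  have a1 := measureReal_nonneg (μ := μ) (s := A ∩ B)
  have a2 := measureReal_le_one (μ := μ) (s := A ∩ B)
  have a3 := measureReal_nonneg (μ := μ) (s := A)
  have a4 := measureReal_le_one (μ := μ) (s := A)
  have a5 := measureReal_nonneg (μ := μ) (s := B)
  have a6 := measureReal_le_one (μ := μ) (s := B)
  have a7 := mul_nonneg a3 a5
  have a8 := mul_le_one₀ a4 a5 a6
  rw [abs_le]; constructor <;> linarith

theorem measurable_pastSigma {Ω : Type*} (X : ℤ → ℕ → Ω → ℝ) (T : ℕ) {s t : ℤ} (h : s ≤ t) :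
    Measurable[pastSigma X T t] (X s T) :=
  (comap_measurable (X s T)).mono
    (le_iSup (fun s : {s : ℤ // s ≤ t} => MeasurableSpace.comap (X s T) inferInstance) ⟨s, h⟩)
    le_rfl

theorem measurable_futureSigma {Ω : Type*} (X : ℤ → ℕ → Ω → ℝ) (T : ℕ) {s t : ℤ} (h : t ≤ s) :
    Measurable[futureSigma X T t] (X s T) :=
  (comap_measurable (X s T)).mono
    (le_iSup (fun s : {s : ℤ // t ≤ s} => MeasurableSpace.comap (X s T) inferInstance) ⟨s, h⟩)
    le_rfl

/-- The centred and normalised products form a mixing sequence. -/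
theorem isMixingSequence_products {μ : Measure Ω} [IsProbabilityMeasure μ]
    {X : ℤ → ℕ → Ω → ℝ} {K ρ c d b : ℝ} {T : ℕ} (hT : 1 ≤ T)
    (hmeas : ∀ s, Measurable (X s T)) (hMix : IsGeomMixing μ X K ρ) (hMom : BernsteinCond μ X c d)
    (hb : 0 < b) (hc : c ^ 2 ≤ b) (hv : ∀ s, variance (X s T) μ ≤ b) {a : ℤ} (ha : 1 ≤ a)
    {n k : ℕ} (hn : a + k + n ≤ T + 1) :
    IsMixingSequence μ
      (fun i ω => b⁻¹ * (X (a + i) T ω * X (a + k + i) T ω -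
        ∫ ω', X (a + i) T ω' * X (a + k + i) T ω' ∂μ)) n k d K ρ
      (fun j => pastSigma X T (a + k + j)) (fun j => futureSigma X T (a + j)) where
  hasAllMoments i hi := by
    have h1 := hMom.hasAllMoments (hmeas (a + i)) (by omega) (by omega)
    have h2 := hMom.hasAllMoments (hmeas (a + k + i)) (by omega) (by omega)
    exact HasAllMoments.const_mul (fun r => (h1.mul h2 r).sub (HasAllMoments.const _ r)) _
  mean i hi := by
    have h1 := hMom.hasAllMoments (hmeas (a + i)) (by omega) (by omega)
    have h2 := hMom.hasAllMoments (hmeas (a + k + i)) (by omega) (by omega)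
    rw [integral_const_mul, integral_sub (h1.mul h2).integrable (integrable_const _)]
    simp
  moment r i hr hi := by
    have hd : 0 ≤ d := by linarith [hMom.half_le_d]
    exact integral_abs_centred_mul_pow_le
      (hMom.hasAllMoments (hmeas (a + i)) (by omega) (by omega))
      (hMom.hasAllMoments (hmeas (a + k + i)) (by omega) (by omega)) hb hd
      (fun r hr => hMom.integral_abs_pow_le (by omega) (by omega) hc (hv _) hr)
      (fun r hr => hMom.integral_abs_pow_le (by omega) (by omega) hc (hv _) hr) hr
  past_le i := iSup_le fun s => (hmeas s).comap_le
  future_le i := iSup_le fun s => (hmeas s).comap_le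
  measurable_past i j hij :=
    (((measurable_pastSigma X T (by omega)).mul
      (measurable_pastSigma X T (by omega))).sub_const _).const_mul _
  measurable_future i j hij :=
    (((measurable_futureSigma X T (by omega)).mul
      (measurable_futureSigma X T (by omega))).sub_const _).const_mul _
  mixing i g A B hg hA hB := by
    -- The past of product `i` reaches up to `a + k + i`, while the future of product `i + g` begins
    -- at `a + i + g`: the separation is `g - k`.
    refine (abs_sub_le_alphaMixing μ X hT (a + k + i) (g - k) hA ?_).trans
      (hMix.bound (g - k) (by omega))
    have e : a + k + i + ((g - k : ℕ) : ℤ) = a + ((i + g : ℕ) : ℤ) := by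
      push_cast [Nat.cast_sub hg.le]; ring
    rw [e]
    exact hB

/-! ### Deviations of the empirical covariances -/

theorem gammaHat_natCast {Ω : Type*} (X : ℤ → ℕ → Ω → ℝ) {N k : ℕ} (hk : k ≤ N) (T : ℕ) (t : ℤ) (ω : Ω) :
    gammaHat X N T t k ω = (1 / ((N : ℝ) - k)) * ∑ i ∈ Finset.range (N - k),
      X (t - N + 1 + i) T ω * X (t - N + 1 + k + i) T ω := by
  unfold gammaHat
  rw [Int.cast_natCast, Nat.abs_cast, Nat.abs_cast]
  congr 1
  refine (Finset.sum_nbij' (fun i : ℕ => t - N + 1 + k + i)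
    (fun l : ℤ => (l - (t - N + 1 + k)).toNat) ?_ ?_ ?_ ?_ ?_).symm
  · intro i hi
    rw [Finset.mem_range] at hi
    rw [Finset.mem_Icc]; omega
  · intro l hl
    rw [Finset.mem_Icc] at hl
    rw [Finset.mem_range]; omega
  · intro i hi; simp
  · intro l hl
    rw [Finset.mem_Icc] at hl
    omega
  · intro i hi
    congr 2; ring

theorem gammaHat_abs {Ω : Type*} (X : ℤ → ℕ → Ω → ℝ) (N T : ℕ) (t k : ℤ) (ω : Ω) :
    gammaHat X N T t k ω = gammaHat X N T t k.natAbs ω := by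
  unfold gammaHat
  have e : (|(k : ℝ)| : ℝ) = |((k.natAbs : ℤ) : ℝ)| := by
    rw [← Int.cast_abs, ← Int.cast_abs, Int.natCast_natAbs, abs_abs]
  rw [e, Int.natCast_natAbs, abs_abs]

theorem integral_gammaHat_natCast {μ : Measure Ω} [IsProbabilityMeasure μ]
    {X : ℤ → ℕ → Ω → ℝ} {c d : ℝ} {N T k : ℕ} {t : ℤ} (hmeas : ∀ s, Measurable (X s T))
    (hMom : BernsteinCond μ X c d) (hk : k ≤ N) (hNt : (N : ℤ) ≤ t) (htT : t ≤ T) :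
    ∫ ω, gammaHat X N T t k ω ∂μ = (1 / ((N : ℝ) - k)) * ∑ i ∈ Finset.range (N - k),
      ∫ ω, X (t - N + 1 + i) T ω * X (t - N + 1 + k + i) T ω ∂μ := by
  simp_rw [gammaHat_natCast X hk]
  rw [integral_const_mul, integral_finsetSum]
  intro i hi
  rw [Finset.mem_range] at hi
  exact ((hMom.hasAllMoments (hmeas _) (by omega) (by omega)).mul
    (hMom.hasAllMoments (hmeas _) (by omega) (by omega))).integrable

/-- The exponential inequality for one empirical covariance. -/
theorem measureReal_gammaHat_deviation_le {μ : Measure Ω} [IsProbabilityMeasure μ]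
    {X : ℤ → ℕ → Ω → ℝ} {K ρ c d b : ℝ} {T : ℕ} (hT : 1 ≤ T)
    (hmeas : ∀ s, Measurable (X s T)) (hMix : IsGeomMixing μ X K ρ) (hMom : BernsteinCond μ X c d)
    (hb : 0 < b) (hc : c ^ 2 ≤ b) (hv : ∀ s, variance (X s T) μ ≤ b) {p N k : ℕ} {t : ℤ}
    (hp : 1 ≤ p) (hpN : p < N) (hk : k ≤ p) (hNt : (N : ℤ) ≤ t) (htT : t ≤ T)
    {A η : ℝ} (hA : 1 ≤ A) (hη : 0 < η)
    (hgauss : 33000 * A * 256 ^ d * (1 + √K) * (p * (1 + 1 / Real.log ρ)) ≤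
      (η / b) ^ 2 * (N - p))
    (hheavy : 1000 * A ^ 2 * (32 * A ^ 2) ^ d * (p * (1 + 1 / Real.log ρ)) ≤
      η / b * (N - p)) :
    μ.real {ω | 16 * η < |gammaHat X N T t k ω - ∫ ω', gammaHat X N T t k ω' ∂μ|} ≤
      Real.exp (-A) := by
  have hd : 0 ≤ d := by linarith [hMom.half_le_d]
  have hpN' : (p : ℝ) < N := by exact_mod_cast hpN
  have hk' : (k : ℝ) ≤ p := by exact_mod_cast hk
  have hNk : 0 < (N : ℝ) - k := by linarith
  have hcast : ((N - k : ℕ) : ℝ) = N - k := by rw [Nat.cast_sub (by omega)]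
  have hseq := isMixingSequence_products (n := N - k) (k := k) (a := t - N + 1) hT hmeas hMix
    hMom hb hc hv (by omega) (by omega)
  -- Taking `ν = N - p`, below the number `N - k` of summands, makes the two conditions the same for
  -- all lags.
  have h := hseq.measureReal_lt_abs_sum_le hMix.K_pos.le hMix.one_lt_rho hd hp hk hA
    (div_pos hη hb) (ν := (N : ℝ) - p) (by linarith) (by rw [hcast]; linarith) hgauss hheavy
  refine le_trans (le_of_eq ?_) h
  congr 1
  ext ω
  rw [Set.mem_ofPred_eq, Set.mem_ofPred_eq, integral_gammaHat_natCast hmeas hMom (by omega) hNt htT,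
    gammaHat_natCast X (by omega), ← mul_sub, ← Finset.sum_sub_distrib, ← Finset.mul_sum, abs_mul,
    abs_mul, abs_of_pos (one_div_pos.2 hNk), abs_of_pos (inv_pos.2 hb), hcast]
  rw [one_div, lt_inv_mul_iff₀ hNk, lt_inv_mul_iff₀ hb]
  have e : b * (16 * (η / b) * ((N : ℝ) - k)) = ((N : ℝ) - k) * (16 * η) := by field_simp
  rw [e]

theorem variance_le {μ : Measure Ω} [IsProbabilityMeasure μ] {X : ℤ → ℕ → Ω → ℝ}
    {f : ℝ → ℝ → ℝ} {C mf Mf : ℝ} (hLS : IsLocallyStationary μ X f C)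
    (hBd : DensityBounded f mf Mf) {T : ℕ} (hT : 1 ≤ T) (hC : C / T ≤ mf / 2) (s : ℤ) :
    variance (X s T) μ ≤ 3 * Real.pi * Mf := by
  have h1 := hLS.abs_cov_sub_realCov_le s 0 hT
  rw [sub_zero, covariance_self (hLS.measurable s T hT).aemeasurable] at h1
  have h2 := realCov_zero_le hLS.density hBd ((s : ℝ) / T)
  have h3 := (abs_le.1 h1).2
  have h4 := hBd.lower_le_upper
  have h5 := hBd.pos
  have h6 := Real.pi_gt_three
  nlinarith

/-! ### Trigonometric polynomials and the local covariance function -/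

theorem integral_cos_int_mul (m : ℤ) :
    ∫ lam in (-Real.pi)..Real.pi, Real.cos (m * lam) = if m = 0 then 2 * Real.pi else 0 := by
  split_ifs with h
  · subst h; simp; ring
  · have hm : (m : ℝ) ≠ 0 := by exact_mod_cast h
    rw [intervalIntegral.integral_comp_mul_left (fun x => Real.cos x) hm, integral_cos]
    simp [Real.sin_int_mul_pi]

/-- This is the expansion of `|∑ v_j e^{ij lam}|²`; its use is that the trigonometric sum is
nonnegative. -/
theorem sum_sum_mul_cos_eq {p : ℕ} (v : Fin p → ℝ) (lam : ℝ) :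
    ∑ i, ∑ j, v i * v j * Real.cos ((((i : ℤ) - (j : ℤ) : ℤ) : ℝ) * lam) =
      (∑ i, v i * Real.cos ((i : ℕ) * lam)) ^ 2 + (∑ i, v i * Real.sin ((i : ℕ) * lam)) ^ 2 := by
  rw [sq, sq, Finset.sum_mul_sum, Finset.sum_mul_sum, ← Finset.sum_add_distrib]
  refine Finset.sum_congr rfl fun i _ => ?_
  rw [← Finset.sum_add_distrib]
  refine Finset.sum_congr rfl fun j _ => ?_
  push_cast
  rw [sub_mul, Real.cos_sub]
  ring

theorem integral_sum_sum_mul_cos {p : ℕ} (v : Fin p → ℝ) {g : ℝ → ℝ}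
    (hg : IntervalIntegrable g volume (-Real.pi) Real.pi) :
    ∫ lam in (-Real.pi)..Real.pi,
      (∑ i, ∑ j, v i * v j * Real.cos ((((i : ℤ) - (j : ℤ) : ℤ) : ℝ) * lam)) * g lam =
    ∑ i, ∑ j, v i * v j *
      ∫ lam in (-Real.pi)..Real.pi, Real.cos ((((i : ℤ) - (j : ℤ) : ℤ) : ℝ) * lam) * g lam := by
  have hInt : ∀ i j : Fin p, IntervalIntegrable (fun lam => v i * v j *
      (Real.cos ((((i : ℤ) - (j : ℤ) : ℤ) : ℝ) * lam) * g lam)) volume (-Real.pi) Real.pi :=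
    fun i j => (hg.continuousOn_mul (by fun_prop)).const_mul _
  have hsum : ∀ i : Fin p, IntervalIntegrable (fun lam => ∑ j, v i * v j *
      (Real.cos ((((i : ℤ) - (j : ℤ) : ℤ) : ℝ) * lam) * g lam)) volume (-Real.pi) Real.pi := by
    intro i
    have hc : ContinuousOn (fun lam =>
        ∑ j, v i * v j * Real.cos ((((i : ℤ) - (j : ℤ) : ℤ) : ℝ) * lam))
        (Set.uIcc (-Real.pi) Real.pi) := by fun_prop
    simpa only [Finset.sum_mul, mul_assoc] using hg.continuousOn_mul hc
  have e : ∀ lam : ℝ,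
      (∑ i, ∑ j, v i * v j * Real.cos ((((i : ℤ) - (j : ℤ) : ℤ) : ℝ) * lam)) * g lam =
      ∑ i, ∑ j, v i * v j * (Real.cos ((((i : ℤ) - (j : ℤ) : ℤ) : ℝ) * lam) * g lam) := by
    intro lam
    simp_rw [Finset.sum_mul, mul_assoc]
  simp_rw [e]
  rw [intervalIntegral.integral_finsetSum fun i _ => hsum i]
  refine Finset.sum_congr rfl fun i _ => ?_
  rw [intervalIntegral.integral_finsetSum fun j _ => hInt i j]
  simp_rw [intervalIntegral.integral_const_mul]

/-- The form is the integral of `|∑ v_j e^{ij lam}|²` against `f u`. Replacing `f u` by its lower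
bound leaves `2π mf |v|²` by orthogonality. -/
theorem le_sum_sum_mul_realCov {f : ℝ → ℝ → ℝ} {mf Mf : ℝ} (hf : IsLocalSpectralDensity f)
    (h : DensityBounded f mf Mf) {p : ℕ} (v : Fin p → ℝ) (u : ℝ) :
    2 * Real.pi * mf * ∑ i, v i ^ 2 ≤
      ∑ i, ∑ j, v i * v j * realCov f ((i : ℤ) - (j : ℤ)) u := by
  have hpi := Real.pi_pos
  unfold realCov
  rw [← integral_sum_sum_mul_cos v (hf.intervalIntegrable u _ _)]
  have h1 : 2 * Real.pi * mf * ∑ i, v i ^ 2 = ∫ lam in (-Real.pi)..Real.pi,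
      (∑ i, ∑ j, v i * v j * Real.cos ((((i : ℤ) - (j : ℤ) : ℤ) : ℝ) * lam)) * mf := by
    rw [integral_sum_sum_mul_cos v intervalIntegrable_const, Finset.mul_sum]
    refine Finset.sum_congr rfl fun i _ => ?_
    simp_rw [intervalIntegral.integral_mul_const, integral_cos_int_mul]
    rw [Finset.sum_eq_single i]
    · simp; ring
    · intro j _ hj
      have : (i : ℤ) - (j : ℤ) ≠ 0 := by
        intro h0
        apply hj
        ext
        omega
      simp [this]
    · simp
  rw [h1]
  refine intervalIntegral.integral_mono_on (by linarith) ?_ ?_ fun lam _ => ?_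
  · exact Continuous.intervalIntegrable (by fun_prop) _ _
  · exact hf.intervalIntegrable_mul (by fun_prop) u _ _
  · refine mul_le_mul_of_nonneg_left (h.lower_le hf u lam) ?_
    rw [sum_sum_mul_cos_eq]
    positivity

theorem integral_sum_mul_cos_sq {p : ℕ} (v : Fin p → ℝ) :
    ∫ lam in (-Real.pi)..Real.pi, (∑ i, v i * Real.cos ((((i : ℤ) + 1 : ℤ) : ℝ) * lam)) ^ 2 =
      Real.pi * ∑ i, v i ^ 2 := by
  have e : ∀ lam : ℝ, (∑ i, v i * Real.cos ((((i : ℤ) + 1 : ℤ) : ℝ) * lam)) ^ 2 =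
      ∑ i, ∑ j, v i * v j * (1 / 2 * Real.cos ((((i : ℤ) - (j : ℤ) : ℤ) : ℝ) * lam) +
        1 / 2 * Real.cos ((((i : ℤ) + (j : ℤ) + 2 : ℤ) : ℝ) * lam)) := by
    intro lam
    rw [sq, Finset.sum_mul_sum]
    refine Finset.sum_congr rfl fun i _ => Finset.sum_congr rfl fun j _ => ?_
    have e1 : (((i : ℤ) - (j : ℤ) : ℤ) : ℝ) * lam =
      (((i : ℤ) + 1 : ℤ) : ℝ) * lam - (((j : ℤ) + 1 : ℤ) : ℝ) * lam := by push_cast; ring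
    have e2 : (((i : ℤ) + (j : ℤ) + 2 : ℤ) : ℝ) * lam =
      (((i : ℤ) + 1 : ℤ) : ℝ) * lam + (((j : ℤ) + 1 : ℤ) : ℝ) * lam := by push_cast; ring
    rw [e1, e2, Real.cos_sub, Real.cos_add]
    ring
  simp_rw [e]
  have c1 : ∀ m : ℤ, IntervalIntegrable (fun lam => 1 / 2 * Real.cos (m * lam)) volume
      (-Real.pi) Real.pi := fun m => Continuous.intervalIntegrable (by fun_prop) _ _
  rw [intervalIntegral.integral_finsetSum
    fun i _ => Continuous.intervalIntegrable (by fun_prop) _ _, Finset.mul_sum]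
  refine Finset.sum_congr rfl fun i _ => ?_
  rw [intervalIntegral.integral_finsetSum
    fun j _ => Continuous.intervalIntegrable (by fun_prop) _ _]
  simp_rw [intervalIntegral.integral_const_mul]
  rw [Finset.sum_eq_single i]
  · rw [intervalIntegral.integral_add (c1 _) (c1 _), intervalIntegral.integral_const_mul,
      intervalIntegral.integral_const_mul, integral_cos_int_mul, integral_cos_int_mul,
      if_pos (by simp), if_neg (by omega)]
    ring
  · intro j _ hj
    have : (i : ℤ) - (j : ℤ) ≠ 0 := by
      intro h0
      apply hj
      ext
      omega
    rw [intervalIntegral.integral_add (c1 _) (c1 _), intervalIntegral.integral_const_mul,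
      intervalIntegral.integral_const_mul, integral_cos_int_mul, integral_cos_int_mul,
      if_neg this, if_neg (by omega)]
    ring
  · simp

/-- The sum is the integral of a cosine polynomial `g` against `f u`. The pointwise bound `g ≤
g²/(2s) + s/2` stands in for Cauchy–Schwarz, with `∫ g² = π s²` by orthogonality. -/
theorem sum_mul_realCov_le {f : ℝ → ℝ → ℝ} {mf Mf : ℝ} (hf : IsLocalSpectralDensity f)
    (h : DensityBounded f mf Mf) {p : ℕ} (v : Fin p → ℝ) (u : ℝ) {s : ℝ} (hs : 0 < s)
    (hv : ∑ i, v i ^ 2 = s ^ 2) :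
    ∑ i, v i * realCov f ((i : ℤ) + 1) u ≤ 3 / 2 * Real.pi * Mf * s := by
  have hpi := Real.pi_pos
  have hM : 0 < Mf := h.pos.trans_le h.lower_le_upper
  set g : ℝ → ℝ := fun lam => ∑ i, v i * Real.cos ((((i : ℤ) + 1 : ℤ) : ℝ) * lam) with hg
  have hgc : Continuous g := by rw [hg]; fun_prop
  have e1 : ∑ i, v i * realCov f ((i : ℤ) + 1) u =
      ∫ lam in (-Real.pi)..Real.pi, g lam * f u lam := by
    unfold realCov
    simp_rw [← intervalIntegral.integral_const_mul]
    rw [← intervalIntegral.integral_finsetSum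
      fun i _ => (hf.intervalIntegrable_mul (by fun_prop) u _ _).const_mul _]
    refine intervalIntegral.integral_congr fun lam _ => ?_
    simp only [hg, Finset.sum_mul]
    exact Finset.sum_congr rfl fun i _ => by ring
  rw [e1]
  calc ∫ lam in (-Real.pi)..Real.pi, g lam * f u lam
      ≤ ∫ lam in (-Real.pi)..Real.pi, (Mf / (2 * s) * g lam ^ 2 + Mf * s / 2) := by
        refine intervalIntegral.integral_mono_on (by linarith)
          (hf.intervalIntegrable_mul hgc u _ _)
          (Continuous.intervalIntegrable (by fun_prop) _ _) fun lam _ => ?_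
        have h1 : g lam ≤ g lam ^ 2 / (2 * s) + s / 2 := by
          have : g lam ^ 2 / (2 * s) + s / 2 - g lam = (g lam - s) ^ 2 / (2 * s) := by
            field_simp; ring
          have h2 : 0 ≤ (g lam - s) ^ 2 / (2 * s) := by positivity
          linarith
        have h3 : 0 ≤ g lam ^ 2 / (2 * s) + s / 2 := by positivity
        calc g lam * f u lam ≤ (g lam ^ 2 / (2 * s) + s / 2) * f u lam :=
              mul_le_mul_of_nonneg_right h1 (hf.nonneg u lam)
          _ ≤ (g lam ^ 2 / (2 * s) + s / 2) * Mf :=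
              mul_le_mul_of_nonneg_left (h.le_upper u lam) h3
          _ = _ := by ring
    _ = Mf / (2 * s) * (Real.pi * s ^ 2) + Mf * s / 2 * (2 * Real.pi) := by
        rw [intervalIntegral.integral_add (Continuous.intervalIntegrable (by fun_prop) _ _)
          intervalIntegrable_const, intervalIntegral.integral_const_mul,
          intervalIntegral.integral_const, hg, integral_sum_mul_cos_sq, hv, smul_eq_mul]
        ring
    _ = _ := by field_simp; ring

theorem abs_realCov_sub_le {f : ℝ → ℝ → ℝ} {Mf' : ℝ} (hf : IsLocalSpectralDensity f)
    (h : DensityDerivBounded f Mf') (k : ℤ) (u u' : ℝ) :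
    |realCov f k u - realCov f k u'| ≤ 2 * Real.pi * Mf' * |u - u'| := by
  have hlip : ∀ lam, |f u lam - f u' lam| ≤ Mf' * |u - u'| := by
    intro lam
    have := Convex.norm_image_sub_le_of_norm_deriv_le (f := fun v => f v lam) (s := Set.univ)
      (C := Mf') (x := u') (y := u)
      (fun x _ => ((h.contDiff lam).differentiable one_ne_zero).differentiableAt)
      (fun x _ => h.bound x lam) convex_univ trivial trivial
    simpa using this
  have hpi := Real.pi_pos
  unfold realCov
  rw [← intervalIntegral.integral_sub (hf.intervalIntegrable_mul (by fun_prop) u _ _)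
    (hf.intervalIntegrable_mul (by fun_prop) u' _ _)]
  have h1 := intervalIntegral.norm_integral_le_of_norm_le_const (a := -Real.pi) (b := Real.pi)
    (f := fun lam => Real.cos (k * lam) * f u lam - Real.cos (k * lam) * f u' lam)
    (C := Mf' * |u - u'|) (fun lam _ => by
      rw [← mul_sub, norm_mul, Real.norm_eq_abs, Real.norm_eq_abs]
      calc |Real.cos (k * lam)| * |f u lam - f u' lam| ≤ 1 * (Mf' * |u - u'|) :=
            mul_le_mul (Real.abs_cos_le_one _) (hlip lam) (abs_nonneg _) zero_le_one
        _ = _ := one_mul _)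
  rw [Real.norm_eq_abs] at h1
  refine h1.trans (le_of_eq ?_)
  rw [abs_of_nonneg (by linarith : 0 ≤ Real.pi - -Real.pi)]
  ring

/-! ### Averages over shortened windows -/

/-- The difference equals the sum of `h (k + i) - h j` over the `k (N - k)` pairs, divided by `(N -
k) N`. Each term is at most `D N`, so no factor `N` survives. -/
theorem abs_average_sub_average_le {h : ℕ → ℝ} {D : ℝ} (hD : 0 ≤ D) {N k : ℕ} (hk : k < N)
    (hh : ∀ i j : ℕ, |h i - h j| ≤ D * |(i : ℝ) - j|) :
    |1 / ((N : ℝ) - k) * (∑ i ∈ Finset.range (N - k), h (k + i)) -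
      1 / (N : ℝ) * ∑ i ∈ Finset.range N, h i| ≤ D * k := by
  have hk' : (k : ℝ) < N := by exact_mod_cast hk
  have hN : (0 : ℝ) < N := by linarith [(Nat.cast_nonneg k : (0 : ℝ) ≤ k)]
  have hNk : (0 : ℝ) < N - k := by linarith
  have hcast : ((N - k : ℕ) : ℝ) = N - k := by rw [Nat.cast_sub hk.le]
  have hsplit : ∑ i ∈ Finset.range N, h i =
      ∑ j ∈ Finset.range k, h j + ∑ i ∈ Finset.range (N - k), h (k + i) := by
    rw [← Finset.sum_range_add, Nat.add_sub_cancel' hk.le]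
  have e : 1 / ((N : ℝ) - k) * (∑ i ∈ Finset.range (N - k), h (k + i)) -
      1 / (N : ℝ) * ∑ i ∈ Finset.range N, h i =
      (∑ i ∈ Finset.range (N - k), ∑ j ∈ Finset.range k, (h (k + i) - h j)) /
        (((N : ℝ) - k) * N) := by
    simp_rw [Finset.sum_sub_distrib, Finset.sum_const, Finset.card_range, nsmul_eq_mul]
    rw [hsplit, hcast, ← Finset.mul_sum]
    field_simp
    ring
  rw [e, abs_div, abs_of_pos (mul_pos hNk hN), div_le_iff₀ (mul_pos hNk hN)]
  calc |∑ i ∈ Finset.range (N - k), ∑ j ∈ Finset.range k, (h (k + i) - h j)|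
      ≤ ∑ i ∈ Finset.range (N - k), ∑ j ∈ Finset.range k, D * N := by
        refine (Finset.abs_sum_le_sum_abs _ _).trans (Finset.sum_le_sum fun i hi => ?_)
        refine (Finset.abs_sum_le_sum_abs _ _).trans (Finset.sum_le_sum fun j hj => ?_)
        refine (hh _ _).trans (mul_le_mul_of_nonneg_left ?_ hD)
        have h1 : k + i < N := by have := Finset.mem_range.1 hi; omega
        have h2 : j < N := by have := Finset.mem_range.1 hj; omega
        have h1' : ((k + i : ℕ) : ℝ) < N := by exact_mod_cast h1
        have h2' : (j : ℝ) < N := by exact_mod_cast h2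
        have h3 : (0 : ℝ) ≤ ((k + i : ℕ) : ℝ) := Nat.cast_nonneg _
        have h4 : (0 : ℝ) ≤ j := Nat.cast_nonneg _
        rw [abs_le]; constructor <;> linarith
    _ = D * k * (((N : ℝ) - k) * N) := by
        simp only [Finset.sum_const, Finset.card_range, nsmul_eq_mul, hcast]
        ring

/-! ### Perturbation of coercive linear systems -/

section LinearAlgebra

variable {p : ℕ}

/-- The Euclidean norm of a coordinate vector. -/
noncomputable def euclNorm (v : Fin p → ℝ) : ℝ := ‖(WithLp.toLp 2 v : EuclideanSpace ℝ (Fin p))‖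

theorem euclNorm_nonneg (v : Fin p → ℝ) : 0 ≤ euclNorm v := norm_nonneg _

theorem euclNorm_sq (v : Fin p → ℝ) : euclNorm v ^ 2 = ∑ i, v i ^ 2 := by
  unfold euclNorm
  rw [EuclideanSpace.real_norm_sq_eq]

theorem euclNorm_sub_le (v w : Fin p → ℝ) : euclNorm (v - w) ≤ euclNorm v + euclNorm w := by
  unfold euclNorm
  rw [WithLp.toLp_sub]
  exact norm_sub_le _ _

theorem euclNorm_eq_zero {v : Fin p → ℝ} (h : euclNorm v = 0) : v = 0 := by
  unfold euclNorm at h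
  rw [norm_eq_zero] at h
  funext i
  exact congrArg (fun w : EuclideanSpace ℝ (Fin p) => w i) h

theorem sum_mul_le_euclNorm (v w : Fin p → ℝ) : ∑ i, v i * w i ≤ euclNorm v * euclNorm w := by
  have h := Finset.sum_mul_sq_le_sq_mul_sq Finset.univ v w
  rw [← euclNorm_sq, ← euclNorm_sq, ← mul_pow] at h
  exact le_of_sq_le_sq h (mul_nonneg (euclNorm_nonneg v) (euclNorm_nonneg w))

theorem sq_sum_abs_le (v : Fin p → ℝ) : (∑ i, |v i|) ^ 2 ≤ p * euclNorm v ^ 2 := by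
  have h := sq_sum_le_card_mul_sum_sq (s := Finset.univ) (f := fun i : Fin p => |v i|)
  simpa [euclNorm_sq] using h

theorem euclNorm_le_of_abs_le {v : Fin p → ℝ} {B : ℝ} (hB : 0 ≤ B) (h : ∀ i, |v i| ≤ B) :
    euclNorm v ≤ p * B := by
  refine le_of_sq_le_sq ?_ (by positivity)
  rw [euclNorm_sq]
  calc ∑ i, v i ^ 2 ≤ ∑ _i : Fin p, B ^ 2 := by
        refine Finset.sum_le_sum fun i _ => ?_
        rw [← sq_abs]
        exact pow_le_pow_left₀ (abs_nonneg _) (h i) 2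
    _ = p * B ^ 2 := by simp
    _ ≤ (p * B) ^ 2 := by
        rcases Nat.eq_zero_or_pos p with rfl | hp
        · simp
        · have : (1 : ℝ) ≤ p := by exact_mod_cast hp
          rw [mul_pow]
          gcongr
          nlinarith

/-- The quadratic form of `M` is at least `c` times the squared norm. -/
def IsCoerciveMatrix (M : Matrix (Fin p) (Fin p) ℝ) (c : ℝ) : Prop :=
  ∀ v : Fin p → ℝ, c * ∑ i, v i ^ 2 ≤ ∑ i, ∑ j, v i * v j * M i j

theorem sum_mul_mulVec (M : Matrix (Fin p) (Fin p) ℝ) (v : Fin p → ℝ) :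
    ∑ i, v i * M.mulVec v i = ∑ i, ∑ j, v i * v j * M i j := by
  refine Finset.sum_congr rfl fun i _ => ?_
  simp only [Matrix.mulVec, dotProduct, Finset.mul_sum]
  exact Finset.sum_congr rfl fun j _ => by ring

/-- Cauchy–Schwarz: `c |v|² ≤ ⟨v, M v⟩ ≤ |v| |M v|`. Symmetry of the matrix is not needed. -/
theorem IsCoerciveMatrix.euclNorm_le {M : Matrix (Fin p) (Fin p) ℝ} {c : ℝ}
    (h : IsCoerciveMatrix M c) (v : Fin p → ℝ) :
    c * euclNorm v ≤ euclNorm (M.mulVec v) := by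
  rcases (euclNorm_nonneg v).eq_or_lt with h0 | h0
  · rw [← h0, mul_zero]; exact euclNorm_nonneg _
  · have h1 := h v
    rw [← sum_mul_mulVec, ← euclNorm_sq] at h1
    have h2 := sum_mul_le_euclNorm v (M.mulVec v)
    refine le_of_mul_le_mul_left ?_ h0
    linarith [h1.trans h2, (by ring : euclNorm v * (c * euclNorm v) = c * euclNorm v ^ 2)]

theorem IsCoerciveMatrix.isUnit_det {M : Matrix (Fin p) (Fin p) ℝ} {c : ℝ}
    (h : IsCoerciveMatrix M c) (hc : 0 < c) : IsUnit M.det := by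
  rw [isUnit_iff_ne_zero]
  intro hdet
  obtain ⟨v, hv, hMv⟩ := Matrix.exists_mulVec_eq_zero_iff.2 hdet
  apply hv
  have h1 := h.euclNorm_le v
  have h2 : euclNorm (0 : Fin p → ℝ) = 0 := by simp [euclNorm]
  rw [hMv, h2] at h1
  exact euclNorm_eq_zero (le_antisymm (nonpos_of_mul_nonpos_right h1 hc) (euclNorm_nonneg v))

/-- The form changes by at most `δ (∑ |v i|)²`, which is at most `p δ |v|²`. -/
theorem IsCoerciveMatrix.perturb {M M' : Matrix (Fin p) (Fin p) ℝ} {c δ : ℝ}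
    (h : IsCoerciveMatrix M c) (hδ : 0 ≤ δ) (hM : ∀ i j, |M' i j - M i j| ≤ δ) :
    IsCoerciveMatrix M' (c - p * δ) := by
  intro v
  have h1 : |∑ i, ∑ j, v i * v j * (M' i j - M i j)| ≤ δ * (∑ i, |v i|) ^ 2 := by
    rw [sq, Finset.sum_mul_sum, Finset.mul_sum]
    refine (Finset.abs_sum_le_sum_abs _ _).trans (Finset.sum_le_sum fun i _ => ?_)
    rw [Finset.mul_sum]
    refine (Finset.abs_sum_le_sum_abs _ _).trans (Finset.sum_le_sum fun j _ => ?_)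
    rw [abs_mul, abs_mul, mul_comm δ]
    exact mul_le_mul_of_nonneg_left (hM i j) (by positivity)
  have h2 : ∑ i, ∑ j, v i * v j * M' i j = ∑ i, ∑ j, v i * v j * M i j +
      ∑ i, ∑ j, v i * v j * (M' i j - M i j) := by
    simp_rw [← Finset.sum_add_distrib, ← mul_add]
    simp
  have h3 := h v
  have h4 := mul_le_mul_of_nonneg_left (sq_sum_abs_le v) hδ
  rw [euclNorm_sq] at h4
  have h5 := (abs_le.1 h1).1
  rw [h2, sub_mul]
  nlinarith

theorem euclNorm_mulVec_le {E : Matrix (Fin p) (Fin p) ℝ} {δ : ℝ} (hδ : 0 ≤ δ)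
    (hE : ∀ i j, |E i j| ≤ δ) (x : Fin p → ℝ) :
    euclNorm (E.mulVec x) ≤ p * δ * euclNorm x := by
  refine le_of_sq_le_sq ?_ (mul_nonneg (by positivity) (euclNorm_nonneg x))
  rw [euclNorm_sq]
  calc ∑ i, E.mulVec x i ^ 2 ≤ ∑ _i : Fin p, δ ^ 2 * (p * euclNorm x ^ 2) := by
        refine Finset.sum_le_sum fun i _ => ?_
        have h1 : |E.mulVec x i| ≤ δ * ∑ j, |x j| := by
          simp only [Matrix.mulVec, dotProduct, Finset.mul_sum]
          refine (Finset.abs_sum_le_sum_abs _ _).trans (Finset.sum_le_sum fun j _ => ?_)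
          rw [abs_mul]
          exact mul_le_mul_of_nonneg_right (hE i j) (abs_nonneg _)
        calc E.mulVec x i ^ 2 = |E.mulVec x i| ^ 2 := (sq_abs _).symm
          _ ≤ (δ * ∑ j, |x j|) ^ 2 := pow_le_pow_left₀ (abs_nonneg _) h1 2
          _ = δ ^ 2 * (∑ j, |x j|) ^ 2 := mul_pow _ _ _
          _ ≤ _ := mul_le_mul_of_nonneg_left (sq_sum_abs_le x) (sq_nonneg δ)
    _ = (p * δ * euclNorm x) ^ 2 := by simp; ring

/-- Stability of the solution of a coercive linear system. -/
theorem euclNorm_inv_mulVec_sub_le {M M₀ : Matrix (Fin p) (Fin p) ℝ} {g g₀ : Fin p → ℝ}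
    {c δ B : ℝ} (hM₀ : IsCoerciveMatrix M₀ c) (hδ : 0 ≤ δ) (hc : p * δ < c)
    (hM : ∀ i j, |M i j - M₀ i j| ≤ δ) (hg : ∀ i, |g i - g₀ i| ≤ δ) (hB : euclNorm g₀ ≤ B) :
    (c - p * δ) * euclNorm (M⁻¹.mulVec g - M₀⁻¹.mulVec g₀) ≤ p * δ * (1 + B / c) := by
  have hpδ : 0 ≤ p * δ := by positivity
  have hc0 : 0 < c := hpδ.trans_lt hc
  have hMc := hM₀.perturb hδ hM
  have u := hMc.isUnit_det (by linarith)
  have u₀ := hM₀.isUnit_det hc0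
  set x₀ := M₀⁻¹.mulVec g₀ with hx₀
  have e₀ : M₀.mulVec x₀ = g₀ := by
    rw [hx₀, Matrix.mulVec_mulVec, Matrix.mul_nonsing_inv _ u₀, Matrix.one_mulVec]
  have hx₀B : euclNorm x₀ ≤ B / c := by
    rw [le_div_iff₀ hc0, mul_comm]
    refine (hM₀.euclNorm_le x₀).trans ?_
    rwa [e₀]
  refine (hMc.euclNorm_le _).trans ?_
  have e : M.mulVec (M⁻¹.mulVec g - x₀) = (g - g₀) - (M - M₀).mulVec x₀ := by
    rw [Matrix.mulVec_sub, Matrix.mulVec_mulVec, Matrix.mul_nonsing_inv _ u, Matrix.one_mulVec,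
      Matrix.sub_mulVec, e₀]
    abel
  rw [e]
  calc _ ≤ euclNorm (g - g₀) + euclNorm ((M - M₀).mulVec x₀) := euclNorm_sub_le _ _
    _ ≤ p * δ + p * δ * euclNorm x₀ :=
        add_le_add (euclNorm_le_of_abs_le hδ hg) (euclNorm_mulVec_le hδ hM x₀)
    _ ≤ p * δ + p * δ * (B / c) := by gcongr
    _ = _ := by ring

end LinearAlgebra

/-! ### The expected empirical covariances -/

section Population

variable {Ω : Type*} [MeasurableSpace Ω] {μ : Measure Ω} [IsProbabilityMeasure μ]
  {X : ℤ → ℕ → Ω → ℝ} {f : ℝ → ℝ → ℝ} {C mf Mf Mf' c d : ℝ} {p N T : ℕ} {t : ℤ}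

/-- The average of the local covariance function over the window of length `N` ending at `t`. -/
noncomputable def windowCov (f : ℝ → ℝ → ℝ) (N T : ℕ) (t : ℤ) (k : ℤ) : ℝ :=
  1 / (N : ℝ) * ∑ i ∈ Finset.range N, realCov f k (((t - N + 1 + i : ℤ) : ℝ) / T)

theorem windowCov_natAbs (f : ℝ → ℝ → ℝ) (N T : ℕ) (t k : ℤ) :
    windowCov f N T t k.natAbs = windowCov f N T t k := by
  unfold windowCov realCov
  rcases Int.natAbs_eq k with h | h
  · rw [← h]
  · conv_rhs => rw [h]
    simp [Real.cos_neg]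

/-- Local stationarity costs `C / T`. Lengthening the window from `N - k` to `N` terms costs the
rest, by the Lipschitz bound in `u`. Using the same full window for every lag makes the target an
average of Toeplitz matrices of spectral densities, which is coercive. -/
theorem abs_integral_gammaHat_sub_windowCov_le (hLS : IsLocallyStationary μ X f C)
    (hDer : DensityDerivBounded f Mf') (hMom : BernsteinCond μ X c d)
    (hMean : ∀ (t : ℤ) (T : ℕ), 1 ≤ T → ∫ ω, X t T ω ∂μ = 0) (hT : 1 ≤ T) {k : ℕ} (hk : k < N)
    (hNt : (N : ℤ) ≤ t) (htT : t ≤ T) :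
    |(∫ ω, gammaHat X N T t k ω ∂μ) - windowCov f N T t k| ≤
      (2 * Real.pi * Mf' * k + C) / T := by
  have hT' : (0 : ℝ) < T := by exact_mod_cast hT
  have hk' : (k : ℝ) < N := by exact_mod_cast hk
  have hNk : (0 : ℝ) < N - k := by linarith
  have hM' := hDer.nonneg
  have hpi := Real.pi_pos
  set h : ℕ → ℝ := fun i => realCov f k (((t - N + 1 + i : ℤ) : ℝ) / T) with hh
  have hlip : ∀ i j : ℕ, |h i - h j| ≤ 2 * Real.pi * Mf' / T * |(i : ℝ) - j| := by
    intro i j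
    refine (abs_realCov_sub_le hLS.density hDer k _ _).trans (le_of_eq ?_)
    rw [← sub_div, abs_div, abs_of_pos hT']
    have e : ((t - N + 1 + i : ℤ) : ℝ) - ((t - N + 1 + j : ℤ) : ℝ) = (i : ℝ) - j := by
      push_cast; ring
    rw [e]; ring
  have hav := abs_average_sub_average_le (by positivity) hk hlip
  have hterm : ∀ i : ℕ, |(∫ ω, X (t - N + 1 + i) T ω * X (t - N + 1 + k + i) T ω ∂μ) -
      h (k + i)| ≤ C / T := by
    intro i
    have h1 := hLS.abs_cov_sub_realCov_le (t - N + 1 + k + i) k hT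
    have e1 : t - N + 1 + k + i - (k : ℤ) = t - N + 1 + i := by ring
    rw [e1, covariance_eq_sub (hLS.memLp _ T hT) (hLS.memLp _ T hT), hMean _ T hT,
      zero_mul, sub_zero] at h1
    have e2 : h (k + i) = realCov f k (((t - N + 1 + k + i : ℤ) : ℝ) / T) := by
      simp only [hh]; congr 2; push_cast; ring
    rw [e2]
    refine le_trans (le_of_eq ?_) h1
    congr 2
    exact integral_congr_ae (Filter.Eventually.of_forall fun ω => by simp [mul_comm])
  have hmeas : ∀ s, Measurable (X s T) := fun s => hLS.measurable s T hT
  rw [integral_gammaHat_natCast hmeas hMom hk.le hNt htT]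
  have hsum : |1 / ((N : ℝ) - k) * (∑ i ∈ Finset.range (N - k),
      ∫ ω, X (t - N + 1 + i) T ω * X (t - N + 1 + k + i) T ω ∂μ) -
      1 / ((N : ℝ) - k) * ∑ i ∈ Finset.range (N - k), h (k + i)| ≤ C / T := by
    rw [← mul_sub, ← Finset.sum_sub_distrib, abs_mul, abs_of_pos (one_div_pos.2 hNk), one_div,
      inv_mul_le_iff₀ hNk]
    refine (Finset.abs_sum_le_sum_abs _ _).trans
      ((Finset.sum_le_sum fun i _ => hterm i).trans (le_of_eq ?_))
    rw [Finset.sum_const, Finset.card_range, nsmul_eq_mul, Nat.cast_sub hk.le]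
  have h3 := abs_sub_le (1 / ((N : ℝ) - k) * (∑ i ∈ Finset.range (N - k),
      ∫ ω, X (t - N + 1 + i) T ω * X (t - N + 1 + k + i) T ω ∂μ))
    (1 / ((N : ℝ) - k) * ∑ i ∈ Finset.range (N - k), h (k + i)) (windowCov f N T t k)
  refine h3.trans ((add_le_add hsum hav).trans (le_of_eq ?_))
  ring

theorem isCoerciveMatrix_windowCov (hf : IsLocalSpectralDensity f) (hBd : DensityBounded f mf Mf)
    (hN : 0 < N) :
    IsCoerciveMatrix (Matrix.of fun i j : Fin p => windowCov f N T t ((i : ℤ) - (j : ℤ)))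
      (2 * Real.pi * mf) := by
  intro v
  have hN' : (0 : ℝ) < N := by exact_mod_cast hN
  have e : ∑ i, ∑ j, v i * v j * windowCov f N T t ((i : ℤ) - (j : ℤ)) =
      1 / (N : ℝ) * ∑ l ∈ Finset.range N, ∑ i, ∑ j, v i * v j *
        realCov f ((i : ℤ) - (j : ℤ)) (((t - N + 1 + l : ℤ) : ℝ) / T) := by
    unfold windowCov
    conv_rhs => rw [Finset.sum_comm, Finset.mul_sum]
    refine Finset.sum_congr rfl fun i _ => ?_
    conv_rhs => rw [Finset.sum_comm, Finset.mul_sum]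
    refine Finset.sum_congr rfl fun j _ => ?_
    rw [← Finset.mul_sum]
    ring
  simp only [Matrix.of_apply]
  rw [e, one_div, le_inv_mul_iff₀ hN']
  calc (N : ℝ) * (2 * Real.pi * mf * ∑ i, v i ^ 2)
      = ∑ _l ∈ Finset.range N, 2 * Real.pi * mf * ∑ i, v i ^ 2 := by
        rw [Finset.sum_const, Finset.card_range, nsmul_eq_mul]
    _ ≤ _ := Finset.sum_le_sum fun l _ => le_sum_sum_mul_realCov hf hBd v _

theorem euclNorm_windowCov_le (hf : IsLocalSpectralDensity f) (hBd : DensityBounded f mf Mf)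
    (hN : 0 < N) :
    euclNorm (fun i : Fin p => windowCov f N T t ((i : ℤ) + 1)) ≤ 3 / 2 * Real.pi * Mf := by
  have hN' : (0 : ℝ) < N := by exact_mod_cast hN
  have hM : 0 < Mf := hBd.pos.trans_le hBd.lower_le_upper
  set v := fun i : Fin p => windowCov f N T t ((i : ℤ) + 1) with hv
  rcases (euclNorm_nonneg v).eq_or_lt with h0 | h0
  · rw [← h0]
    have := Real.pi_pos
    positivity
  · refine le_of_mul_le_mul_right ?_ h0
    have e : euclNorm v * euclNorm v = 1 / (N : ℝ) * ∑ l ∈ Finset.range N, ∑ i, v i *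
        realCov f ((i : ℤ) + 1) (((t - N + 1 + l : ℤ) : ℝ) / T) := by
      rw [← sq, euclNorm_sq, Finset.sum_comm, Finset.mul_sum]
      refine Finset.sum_congr rfl fun i _ => ?_
      rw [← Finset.mul_sum, sq]
      conv_lhs => rhs; rw [hv]
      simp only [windowCov]
      ring
    rw [e, one_div, inv_mul_le_iff₀ hN']
    calc _ ≤ ∑ _l ∈ Finset.range N, 3 / 2 * Real.pi * Mf * euclNorm v :=
          Finset.sum_le_sum fun l _ => sum_mul_realCov_le hf hBd v _ h0 (euclNorm_sq v).symm
      _ = _ := by simp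

end Population

/-! ### The three regimes of the exponential bound -/

section Regimes

variable {mf C0 C11 C21 d ε : ℝ} {p N : ℕ}

theorem etaYW_pos (hmf : 0 < mf) (hC0 : 0 < C0) (hp : 1 ≤ p) (hε : 0 < ε) :
    0 < etaYW mf C0 p ε := by
  have hp' : (0 : ℝ) < p := by exact_mod_cast hp
  unfold etaYW
  exact mul_pos (by positivity) (lt_min one_pos (by positivity))

theorem etaYW_of_ge (hC0 : 0 < C0) (h : 8 * C0 ≤ ε) : etaYW mf C0 p ε = mf / (4 * p) := by
  unfold etaYW
  rw [min_eq_left, mul_one]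
  rw [mul_one_div, le_div_iff₀ (by positivity)]
  linarith

theorem etaYW_of_le (hC0 : 0 < C0) (h : ε ≤ 8 * C0) :
    etaYW mf C0 p ε = mf * ε / (32 * p * C0) := by
  unfold etaYW
  rw [min_eq_right]
  · rw [mul_one_div, div_mul_div_comm]; congr 1; ring
  · rw [mul_one_div, div_le_iff₀ (by positivity)]
    linarith

theorem two_sub_exponent (hd : 0 < d) : (3 + 4 * d) / (2 + 2 * d) = 2 - 1 / (2 + 2 * d) := by
  field_simp; ring

theorem rpow_two_sub {x a : ℝ} (hx : 0 < x) : x ^ (2 - a) = x ^ 2 / x ^ a := by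
  rw [Real.rpow_sub hx, Real.rpow_two]

theorem rpow_rpow_one_div {x : ℝ} (hx : 0 ≤ x) {s : ℝ} (hs : 0 < s) : (x ^ s) ^ (1 / s) = x := by
  rw [← Real.rpow_mul hx, mul_one_div_cancel hs.ne', Real.rpow_one]

/-- The two sides agree. In `2^(4+2d)`, the factor `2^(2+2d)` yields the leading `2` of the
denominator and the remaining `4` comes from `η = mf / (4p)`. -/
theorem boundYW_le_of_ge (hmf : 0 < mf) (hC0 : 0 < C0) (hC21 : 0 < C21) (hd : 0 < d)
    (hp : 1 ≤ p) (hN : p < N) (h : 8 * C0 ≤ ε) :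
    boundYW mf C0 C11 C21 d p N ε ≤
      3 * p * Real.exp (-(mf ^ 2 /
        (32 * C11 * ((p : ℝ) ^ 3 / ((N : ℝ) - p)) +
          mf ^ ((3 + 4 * d) / (2 + 2 * d)) *
            ((2 : ℝ) ^ (4 + 2 * d) * C21 * ((p : ℝ) ^ 2 / ((N : ℝ) - p)))
              ^ (1 / (2 + 2 * d))))) := by
  have hp' : (0 : ℝ) < p := by exact_mod_cast hp
  have hN' : (p : ℝ) < N := by exact_mod_cast hN
  have hn : 0 < (N : ℝ) - p := by linarith
  unfold boundYW
  rw [etaYW_of_ge hC0 h, two_sub_exponent hd]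
  set n := (N : ℝ) - p
  set a := 1 / (2 + 2 * d) with ha
  have e1 : ((2 : ℝ) ^ (4 + 2 * d) * C21 * ((p : ℝ) ^ 2 / n)) ^ a =
      2 * ((4 * p) ^ a * (C21 * (p / n)) ^ a) := by
    have e2 : (2 : ℝ) ^ (4 + 2 * d) * C21 * ((p : ℝ) ^ 2 / n) =
        2 ^ (2 + 2 * d) * ((4 * p) * (C21 * (p / n))) := by
      have : (2 : ℝ) ^ (4 + 2 * d) = 2 ^ (2 + 2 * d) * 4 := by
        rw [show (4 : ℝ) + 2 * d = (2 + 2 * d) + 2 by ring, Real.rpow_add two_pos (2 + 2 * d) 2]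
        norm_num
      rw [this]; ring
    rw [e2, Real.mul_rpow (by positivity) (by positivity), ha,
      rpow_rpow_one_div two_pos.le (by linarith), Real.mul_rpow (by positivity) (by positivity)]
  rw [e1]
  refine le_of_eq ?_
  congr 3
  have hpa : (0 : ℝ) < (4 * p) ^ a := by positivity
  have hma : 0 < mf ^ a := by positivity
  rw [rpow_two_sub hmf, rpow_two_sub (by positivity), Real.div_rpow hmf.le (by positivity)]
  rw [div_pow, div_div]
  congr 1
  field_simp
  ring

theorem threshU_eq (hC11 : 0 < C11) (hC21 : 0 < C21) (hd : 0 < d) (hp : 1 ≤ p) (hN : p < N) :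
    threshU mf C0 C11 C21 d p N = 32 * p * C0 / mf *
      ((C11 * ((p : ℝ) / ((N : ℝ) - p))) ^ (2 + 2 * d) / (C21 * ((p : ℝ) / ((N : ℝ) - p))))
        ^ (1 / (3 + 4 * d)) := by
  have hp' : (0 : ℝ) < p := by exact_mod_cast hp
  have hN' : (p : ℝ) < N := by exact_mod_cast hN
  have hn : 0 < (N : ℝ) - p := by linarith
  unfold threshU
  set n := (N : ℝ) - p
  have e1 : (C11 * (p / n)) ^ (2 + 2 * d) / (C21 * (p / n)) =
      C11 ^ (2 + 2 * d) / C21 * ((p : ℝ) ^ (1 + 2 * d) / n ^ (1 + 2 * d)) := by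
    rw [Real.mul_rpow hC11.le (by positivity), ← Real.div_rpow hp'.le hn.le,
      show (2 : ℝ) + 2 * d = (1 + 2 * d) + 1 by ring, Real.rpow_add_one (x := p / n) (by positivity)]
    field_simp
  have e2 : ((p : ℝ) ^ (1 + 2 * d) / n ^ (1 + 2 * d)) ^ (1 / (3 + 4 * d)) =
      (p : ℝ) ^ ((1 + 2 * d) / (3 + 4 * d)) / n ^ ((1 + 2 * d) / (3 + 4 * d)) := by
    rw [Real.div_rpow (by positivity) (by positivity), ← Real.rpow_mul hp'.le,
      ← Real.rpow_mul hn.le, mul_one_div]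
  have e3 : (p : ℝ) ^ ((4 + 6 * d) / (3 + 4 * d)) = p ^ ((1 + 2 * d) / (3 + 4 * d)) * p := by
    rw [← Real.rpow_add_one hp'.ne']
    congr 1; field_simp; ring
  rw [e1, Real.mul_rpow (by positivity) (by positivity), e2, e3]
  ring

/-- Raising the left comparison to the power `2 + 2d` clears its roots, and the right one to the
power `3 + 4d`; both become a comparison of `η^(3+4d) g` with `a^(2+2d)`. -/
theorem rpow_mul_rpow_compare {η a g : ℝ} (hη : 0 < η) (ha : 0 < a) (hg : 0 < g) (hd : 0 < d) :
    (η ^ ((3 + 4 * d) / (2 + 2 * d)) * g ^ (1 / (2 + 2 * d)) ≤ a ↔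
      η ≤ (a ^ (2 + 2 * d) / g) ^ (1 / (3 + 4 * d))) ∧
    (a ≤ η ^ ((3 + 4 * d) / (2 + 2 * d)) * g ^ (1 / (2 + 2 * d)) ↔
      (a ^ (2 + 2 * d) / g) ^ (1 / (3 + 4 * d)) ≤ η) := by
  have h2 : 0 < 2 + 2 * d := by linarith
  have h3 : 0 < 3 + 4 * d := by linarith
  have e1 : (η ^ ((3 + 4 * d) / (2 + 2 * d)) * g ^ (1 / (2 + 2 * d))) ^ (2 + 2 * d) =
      η ^ (3 + 4 * d) * g := by
    rw [Real.mul_rpow (by positivity) (by positivity), ← Real.rpow_mul hη.le,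
      ← Real.rpow_mul hg.le, div_mul_cancel₀ _ h2.ne', div_mul_cancel₀ _ h2.ne', Real.rpow_one]
  have e2 : ((a ^ (2 + 2 * d) / g) ^ (1 / (3 + 4 * d))) ^ (3 + 4 * d) = a ^ (2 + 2 * d) / g := by
    rw [← Real.rpow_mul (by positivity), div_mul_cancel₀ _ h3.ne', Real.rpow_one]
  constructor
  · rw [← Real.rpow_le_rpow_iff (by positivity) ha.le h2, e1,
      ← Real.rpow_le_rpow_iff hη.le (by positivity) h3, e2, le_div_iff₀ hg]
  · rw [← Real.rpow_le_rpow_iff ha.le (by positivity) h2, e1,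
      ← Real.rpow_le_rpow_iff (by positivity) hη.le h3, e2, div_le_iff₀ hg]

/-- The threshold separates the Gaussian term and the heavy-tailed term of the denominator. -/
theorem threshU_compare (hmf : 0 < mf) (hC0 : 0 < C0) (hC11 : 0 < C11) (hC21 : 0 < C21)
    (hd : 0 < d) (hp : 1 ≤ p) (hN : p < N) (hε : 0 < ε) :
    (ε ≤ threshU mf C0 C11 C21 d p N →
      (mf * ε / (32 * p * C0)) ^ ((3 + 4 * d) / (2 + 2 * d)) *
        (C21 * ((p : ℝ) / ((N : ℝ) - p))) ^ (1 / (2 + 2 * d)) ≤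
          C11 * ((p : ℝ) / ((N : ℝ) - p))) ∧
    (threshU mf C0 C11 C21 d p N ≤ ε →
      C11 * ((p : ℝ) / ((N : ℝ) - p)) ≤
        (mf * ε / (32 * p * C0)) ^ ((3 + 4 * d) / (2 + 2 * d)) *
          (C21 * ((p : ℝ) / ((N : ℝ) - p))) ^ (1 / (2 + 2 * d))) := by
  have hp' : (0 : ℝ) < p := by exact_mod_cast hp
  have hN' : (p : ℝ) < N := by exact_mod_cast hN
  have hn : 0 < (N : ℝ) - p := by linarith
  have h := rpow_mul_rpow_compare (d := d) (η := mf * ε / (32 * p * C0))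
    (a := C11 * ((p : ℝ) / ((N : ℝ) - p))) (g := C21 * ((p : ℝ) / ((N : ℝ) - p)))
    (by positivity) (by positivity) (by positivity) hd
  rw [threshU_eq hC11 hC21 hd hp hN, h.1, h.2, div_le_iff₀ (by positivity),
    le_div_iff₀ (by positivity), div_mul_eq_mul_div, le_div_iff₀ hmf, div_le_iff₀ hmf]
  constructor <;> intro h <;> linarith

/-- Below the threshold the Gaussian term dominates, so the other one may be replaced by it. -/
theorem boundYW_le_of_small (hmf : 0 < mf) (hC0 : 0 < C0) (hC11 : 0 < C11) (hC21 : 0 < C21)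
    (hd : 0 < d) (hp : 1 ≤ p) (hN : p < N) (hε : 0 < ε)
    (h : ε ≤ min (threshU mf C0 C11 C21 d p N) (8 * C0)) :
    boundYW mf C0 C11 C21 d p N ε ≤
      3 * p * Real.exp (-(ε ^ 2 * (mf ^ 2 / ((2 : ℝ) ^ 12 * C11)) *
        (C0 ^ 2 * ((p : ℝ) ^ 3 / ((N : ℝ) - p)))⁻¹)) := by
  have hp' : (0 : ℝ) < p := by exact_mod_cast hp
  have hN' : (p : ℝ) < N := by exact_mod_cast hN
  have hn : 0 < (N : ℝ) - p := by linarith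
  have h1 := (threshU_compare hmf hC0 hC11 hC21 hd hp hN hε).1 (h.trans (min_le_left _ _))
  unfold boundYW
  rw [etaYW_of_le hC0 (h.trans (min_le_right _ _))]
  set n := (N : ℝ) - p
  have e : ε ^ 2 * (mf ^ 2 / ((2 : ℝ) ^ 12 * C11)) * (C0 ^ 2 * ((p : ℝ) ^ 3 / n))⁻¹ =
      (mf * ε / (32 * p * C0)) ^ 2 / (2 * (C11 * (p / n) + C11 * (p / n))) := by
    field_simp
    norm_num
  rw [e]
  gcongr

/-- Here the heavy-tailed term dominates. Doubling it turns the exponent into `η^a / (4 g^a)`, and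
`4 = (2^(4+4d))^a` explains the power of two in the result. -/
theorem boundYW_le_of_large (hmf : 0 < mf) (hC0 : 0 < C0) (hC11 : 0 < C11) (hC21 : 0 < C21)
    (hd : 0 < d) (hp : 1 ≤ p) (hN : p < N) (hε : 0 < ε) (h8 : ε < 8 * C0)
    (h : min (threshU mf C0 C11 C21 d p N) (8 * C0) ≤ ε) :
    boundYW mf C0 C11 C21 d p N ε ≤
      3 * p * Real.exp (-(ε ^ (1 / (2 + 2 * d)) *
        (mf / ((2 : ℝ) ^ (9 + 4 * d) * C21)) ^ (1 / (2 + 2 * d)) *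
        (C0 * ((p : ℝ) ^ 2 / ((N : ℝ) - p))) ^ (-(1 / (2 + 2 * d))))) := by
  have hp' : (0 : ℝ) < p := by exact_mod_cast hp
  have hN' : (p : ℝ) < N := by exact_mod_cast hN
  have hn : 0 < (N : ℝ) - p := by linarith
  have hU : threshU mf C0 C11 C21 d p N ≤ ε := by
    rcases min_le_iff.1 h with h | h
    · exact h
    · exact absurd h (not_le.2 h8)
  have h1 : C11 * ((p : ℝ) / ((N : ℝ) - p)) ≤
      (mf * ε / (32 * p * C0)) ^ ((3 + 4 * d) / (2 + 2 * d)) *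
        (C21 * ((p : ℝ) / ((N : ℝ) - p))) ^ (1 / (2 + 2 * d)) :=
    (threshU_compare hmf hC0 hC11 hC21 hd hp hN hε).2 hU
  unfold boundYW
  rw [etaYW_of_le hC0 h8.le]
  set n := (N : ℝ) - p
  set a := 1 / (2 + 2 * d) with ha
  set η := mf * ε / (32 * p * C0) with hη
  have hη0 : 0 < η := by positivity
  have hg : 0 < C21 * (p / n) := by positivity
  have h2 : 0 < 2 + 2 * d := by linarith
  have e : ε ^ a * (mf / ((2 : ℝ) ^ (9 + 4 * d) * C21)) ^ a * (C0 * ((p : ℝ) ^ 2 / n)) ^ (-a) =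
      η ^ 2 / (2 * (η ^ (2 - a) * (C21 * (p / n)) ^ a + η ^ (2 - a) * (C21 * (p / n)) ^ a)) := by
    have e1 : η ^ 2 / (2 * (η ^ (2 - a) * (C21 * (p / n)) ^ a +
        η ^ (2 - a) * (C21 * (p / n)) ^ a)) = η ^ a / (4 * (C21 * (p / n)) ^ a) := by
      rw [rpow_two_sub hη0]
      have : 0 < η ^ a := by positivity
      have : 0 < (C21 * (p / n)) ^ a := by positivity
      field_simp
      norm_num
    have e4 : (4 : ℝ) = (2 ^ (4 + 4 * d)) ^ a := by
      rw [← Real.rpow_mul two_pos.le, ha,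
        show (4 + 4 * d) * (1 / (2 + 2 * d)) = 2 by field_simp; ring]
      norm_num
    rw [e1]
    nth_rw 2 [e4]
    rw [← Real.mul_rpow (by positivity) hg.le, ← Real.div_rpow hη0.le (by positivity),
      Real.rpow_neg (by positivity), ← Real.inv_rpow (by positivity),
      ← Real.mul_rpow hε.le (by positivity), ← Real.mul_rpow (by positivity) (by positivity)]
    congr 1
    have e9 : (2 : ℝ) ^ (9 + 4 * d) = 32 * 2 ^ (4 + 4 * d) := by
      rw [show (9 : ℝ) + 4 * d = 5 + (4 + 4 * d) by ring, Real.rpow_add two_pos 5]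
      norm_num
    rw [e9, hη]
    field_simp
  rw [e]
  rw [two_sub_exponent hd] at h1 ⊢
  gcongr

end Regimes

/-! ### The Yule–Walker estimator -/

section Estimator

variable {Ω : Type*} [MeasurableSpace Ω] {μ : Measure Ω}
  {X : ℤ → ℕ → Ω → ℝ} {f : ℝ → ℝ → ℝ} {C mf Mf Mf' c d : ℝ} {p N T : ℕ} {t : ℤ}

theorem bias_le (hmf : 0 < mf) (hM' : 0 ≤ Mf') (hC : 0 ≤ C) (hp : 1 ≤ p) (hT1 : 1 ≤ T)
    (hT : 2 * const1 mf Mf' C * (p : ℝ) ^ 2 ≤ (T : ℝ)) {k : ℕ} (hk : k ≤ p) :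
    (2 * Real.pi * Mf' * k + C) / T ≤ mf / (2 * p) := by
  have hp' : (1 : ℝ) ≤ p := by exact_mod_cast hp
  have hk' : (k : ℝ) ≤ p := by exact_mod_cast hk
  have hT' : (0 : ℝ) < T := by exact_mod_cast hT1
  have hpi := Real.pi_pos
  have h1 : 2 * (2 * Real.pi * Mf' + C) * (p : ℝ) ^ 2 ≤ mf * T := by
    have e : 2 * const1 mf Mf' C * (p : ℝ) ^ 2 =
        2 * (2 * Real.pi * Mf' + C) * (p : ℝ) ^ 2 / mf := by unfold const1; ring
    rw [e, div_le_iff₀ hmf] at hT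
    linarith
  rw [div_le_div_iff₀ hT' (by positivity)]
  have h2 : 2 * Real.pi * Mf' * k ≤ 2 * Real.pi * Mf' * p := by gcongr
  have h3 : C ≤ C * p := le_mul_of_one_le_right hC hp'
  nlinarith

/-- The expected empirical covariance matrix is uniformly positive definite, and the expected
vector of empirical covariances is bounded. -/
theorem population_bounds [IsProbabilityMeasure μ] (hLS : IsLocallyStationary μ X f C) (hBd : DensityBounded f mf Mf)
    (hDer : DensityDerivBounded f Mf') (hMom : BernsteinCond μ X c d)
    (hMean : ∀ (t : ℤ) (T : ℕ), 1 ≤ T → ∫ ω, X t T ω ∂μ = 0) (hp : 1 ≤ p) (hN : p < N)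
    (hNt : (N : ℤ) ≤ t) (htT : t ≤ T) (hT1 : 1 ≤ T)
    (hT : 2 * const1 mf Mf' C * (p : ℝ) ^ 2 ≤ (T : ℝ)) :
    IsCoerciveMatrix (EGammaHat μ X p N T t) (2 * Real.pi * mf - mf / 2) ∧
      euclNorm (EgammaHatVec μ X p N T t) ≤ 3 / 2 * Real.pi * Mf + mf / 2 := by
  have hp' : (0 : ℝ) < p := by exact_mod_cast hp
  have hmf := hBd.pos
  have hbias : ∀ k : ℕ, k ≤ p →
      |(∫ ω, gammaHat X N T t k ω ∂μ) - windowCov f N T t k| ≤ mf / (2 * p) := fun k hk =>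
    (abs_integral_gammaHat_sub_windowCov_le hLS hDer hMom hMean hT1 (by omega) hNt htT).trans
      (bias_le hmf hDer.nonneg hLS.const_nonneg hp hT1 hT hk)
  have e : (p : ℝ) * (mf / (2 * p)) = mf / 2 := by field_simp
  constructor
  · have h := (isCoerciveMatrix_windowCov (p := p) (N := N) (T := T) (t := t) hLS.density hBd
      (by omega)).perturb (M' := EGammaHat μ X p N T t) (δ := mf / (2 * p)) (by positivity) ?_
    · rwa [e] at h
    · intro i j
      simp only [EGammaHat, GammaHat, Matrix.of_apply]
      simp_rw [gammaHat_abs X N T t ((i : ℤ) - (j : ℤ))]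
      rw [← windowCov_natAbs]
      exact hbias _ (by omega)
  · have h1 := euclNorm_windowCov_le (p := p) (N := N) (T := T) (t := t) hLS.density hBd
      (by omega)
    have h2 := euclNorm_le_of_abs_le (B := mf / (2 * p)) (by positivity)
      (v := (fun i : Fin p => windowCov f N T t ((i : ℤ) + 1)) - EgammaHatVec μ X p N T t) (by
        intro i
        rw [Pi.sub_apply, abs_sub_comm]
        simp only [EgammaHatVec, gammaHatVec]
        have := hbias (i + 1) (by omega)
        push_cast at this
        exact this)
    rw [e] at h2
    have h3 := euclNorm_sub_le (fun i : Fin p => windowCov f N T t ((i : ℤ) + 1))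
      ((fun i : Fin p => windowCov f N T t ((i : ℤ) + 1)) - EgammaHatVec μ X p N T t)
    rw [sub_sub_cancel] at h3
    linarith

/-- Off the event of a large deviation of an empirical covariance, the estimator is well defined
and close to its population counterpart. -/
theorem estimator_close {C0 ε : ℝ} (hC0 : C0 = const0 mf Mf) (hBd : DensityBounded f mf Mf)
    (hp : 1 ≤ p) (hε : 0 < ε)
    (hcoer : IsCoerciveMatrix (EGammaHat μ X p N T t) (2 * Real.pi * mf - mf / 2))
    (hvec : euclNorm (EgammaHatVec μ X p N T t) ≤ 3 / 2 * Real.pi * Mf + mf / 2) {ω : Ω}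
    (hdev : ∀ k : ℕ, k ≤ p →
      |gammaHat X N T t k ω - ∫ ω', gammaHat X N T t k ω' ∂μ| ≤ 16 * etaYW mf C0 p ε) :
    IsUnit (GammaHat X p N T t ω).det ∧ ‖aHat X p N T t ω - aBar μ X p N T t‖ ≤ ε := by
  have hmf := hBd.pos
  have hmM := hBd.lower_le_upper
  have hM : 0 < Mf := hmf.trans_le hmM
  have hp' : (0 : ℝ) < p := by exact_mod_cast hp
  have hpi1 := Real.pi_gt_d2
  have hpi2 := Real.pi_lt_d2
  have hsqrt : 5 / 2 ≤ √(2 * Real.pi) := by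
    apply Real.le_sqrt_of_sq_le
    nlinarith
  have hC0' : 5 / 2 * Mf ≤ C0 * mf := by
    rw [hC0, const0, div_mul_cancel₀ _ hmf.ne']
    gcongr
  have hC0pos : 0 < C0 := by
    by_contra hle
    nlinarith [not_lt.1 hle]
  have hη := etaYW_pos hmf hC0pos hp hε
  set δ := 16 * etaYW mf C0 p ε with hδ
  have hδ0 : 0 ≤ δ := by positivity
  have hpδ1 : p * δ ≤ 4 * mf := by
    have e : p * δ = 4 * mf * min 1 (ε * (1 / (8 * C0))) := by
      rw [hδ, etaYW]; field_simp; ring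
    rw [e]
    exact mul_le_of_le_one_right (by positivity) (min_le_left _ _)
  have hpδ2 : p * δ * (2 * C0) ≤ mf * ε := by
    have e : p * δ = 4 * mf * min 1 (ε * (1 / (8 * C0))) := by
      rw [hδ, etaYW]; field_simp; ring
    rw [e]
    calc 4 * mf * min 1 (ε * (1 / (8 * C0))) * (2 * C0)
        ≤ 4 * mf * (ε * (1 / (8 * C0))) * (2 * C0) := by
          gcongr; exact min_le_right _ _
      _ = mf * ε := by field_simp; norm_num
  set c₀ := 2 * Real.pi * mf - mf / 2 with hc₀
  -- From `2 · 3.14 - 1/2 = 5.78`. The perturbation uses up at most `4 mf` of this coercivity, so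
  -- `1.78 mf` remains.
  have hc₀1 : 5.78 * mf ≤ c₀ := by rw [hc₀]; nlinarith
  have hMat : ∀ i j, |GammaHat X p N T t ω i j - EGammaHat μ X p N T t i j| ≤ δ := by
    intro i j
    simp only [EGammaHat, GammaHat, Matrix.of_apply]
    simp_rw [gammaHat_abs X N T t ((i : ℤ) - (j : ℤ))]
    exact hdev _ (by omega)
  have hVec : ∀ i, |gammaHatVec X p N T t ω i - EgammaHatVec μ X p N T t i| ≤ δ := by
    intro i
    simp only [EgammaHatVec, gammaHatVec]
    have := hdev (i + 1) (by omega)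
    push_cast at this
    exact this
  refine ⟨(hcoer.perturb hδ0 hMat).isUnit_det (by linarith), ?_⟩
  have h := euclNorm_inv_mulVec_sub_le hcoer hδ0 (by linarith) hMat hVec hvec
  have e : euclNorm ((GammaHat X p N T t ω)⁻¹.mulVec (gammaHatVec X p N T t ω) -
      (EGammaHat μ X p N T t)⁻¹.mulVec (EgammaHatVec μ X p N T t)) =
      ‖aHat X p N T t ω - aBar μ X p N T t‖ := by
    unfold euclNorm aHat aBar
    rw [WithLp.toLp_sub]
  rw [e] at h
  set D := ‖aHat X p N T t ω - aBar μ X p N T t‖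
  have hD : 0 ≤ D := norm_nonneg _
  have hc₀pos : 0 < c₀ := by linarith
  have hB : (1 + (3 / 2 * Real.pi * Mf + mf / 2) / c₀) * mf ≤ 2 * Mf := by
    have h1 : (3 / 2 * Real.pi * Mf + mf / 2) / c₀ * mf ≤ Mf := by
      rw [div_mul_eq_mul_div, div_le_iff₀ hc₀pos]
      nlinarith
    linarith
  have h2 : 1.78 * mf * D ≤ p * δ * (1 + (3 / 2 * Real.pi * Mf + mf / 2) / c₀) :=
    le_trans (mul_le_mul_of_nonneg_right (by linarith) hD) h
  have h3 : 1.78 * mf * D * mf ≤ p * δ * (2 * Mf) := by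
    calc 1.78 * mf * D * mf ≤ p * δ * (1 + (3 / 2 * Real.pi * Mf + mf / 2) / c₀) * mf := by
          gcongr
      _ = p * δ * ((1 + (3 / 2 * Real.pi * Mf + mf / 2) / c₀) * mf) := by ring
      _ ≤ p * δ * (2 * Mf) := by gcongr
  have h4 : p * δ * (2 * Mf) ≤ mf * ε * mf := by
    calc p * δ * (2 * Mf) ≤ p * δ * (2 * (C0 * mf)) := by gcongr; linarith
      _ = p * δ * (2 * C0) * mf := by ring
      _ ≤ mf * ε * mf := by gcongr
  have h5 : 1.78 * D * (mf * mf) ≤ ε * (mf * mf) := by linarith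
  have h6 := le_of_mul_le_mul_right h5 (by positivity)
  linarith

end Estimator

/-! ### The exponent -/

section Exponent

variable {Mf c d K ρ : ℝ}

theorem const1a_one : const1a 1 Mf c d K ρ =
    6144 * 256 ^ d * max (c ^ 2) (3 * Real.pi * Mf) ^ 2 * Real.exp 1 * (1 + 1 / Real.log ρ) *
      (1 + √K) := by
  have e : (2 : ℝ) ^ (8 * ((1 : ℕ) : ℝ) * d + 9) = 512 * 256 ^ d := by
    rw [Nat.cast_one, mul_one, Real.rpow_add two_pos, Real.rpow_mul two_pos.le]
    norm_num
    ring
  unfold const1a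
  rw [e]
  simp only [Nat.factorial_one, Nat.cast_one, Real.one_rpow, mul_one]
  ring

theorem const2a_one : const2a 1 Mf c d ρ =
    96 * 8 ^ d * max (c ^ 2) (3 * Real.pi * Mf) * Real.exp 1 * (1 + 1 / Real.log ρ) := by
  have e : (2 : ℝ) ^ (3 * (((1 : ℕ) : ℝ) * d + 1)) = 8 * 8 ^ d := by
    rw [Nat.cast_one, one_mul, Real.rpow_mul two_pos.le, Real.rpow_add_one (by norm_num)]
    norm_num
    ring
  unfold const2a
  rw [e]
  simp only [Nat.factorial_one, Nat.cast_one, Real.one_rpow, mul_one, pow_one]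
  ring

/-- Lower bounds on the deviation in terms of the exponent `A` of the bound. -/
theorem le_of_exponent {b η A n pL κ : ℝ} (hb : 0 < b) (hη : 0 < η) (hA : 0 < A) (hn : 0 < n)
    (hd : 0 < d) (hpL : 0 < pL) (hκ : 0 < κ)
    (hAeq : A = η ^ 2 / (2 * (6144 * 256 ^ d * b ^ 2 * Real.exp 1 * κ * (pL / n) +
      η ^ ((3 + 4 * d) / (2 + 2 * d)) *
        (96 * 8 ^ d * b * Real.exp 1 * (pL / n)) ^ (1 / (2 + 2 * d))))) :
    33000 * A * 256 ^ d * κ * pL ≤ (η / b) ^ 2 * n ∧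
      1000 * A ^ 2 * (32 * A ^ 2) ^ d * pL ≤ η / b * n := by
  -- The factor `e` in both constants supplies the numerical slack: `12288 e ≥ 33000` and `384 e ≥
  -- 1000`.
  have he : 2.7 < Real.exp 1 := lt_trans (by norm_num) Real.exp_one_gt_d9
  have hP : 0 < pL / n := by positivity
  set G := 6144 * 256 ^ d * b ^ 2 * Real.exp 1 * κ * (pL / n) with hG
  set g := 96 * 8 ^ d * b * Real.exp 1 * (pL / n) with hg
  have hG0 : 0 < G := by positivity
  have hg0 : 0 < g := by positivity
  rw [two_sub_exponent hd] at hAeq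
  set a := 1 / (2 + 2 * d) with ha
  have hs0 : 0 < η ^ (2 - a) * g ^ a := by positivity
  rw [eq_div_iff (by positivity)] at hAeq
  have h1 : A * (2 * G) ≤ η ^ 2 := by
    rw [← hAeq]
    gcongr
    linarith
  have h2 : A * (2 * (η ^ (2 - a) * g ^ a)) ≤ η ^ 2 := by
    rw [← hAeq]
    gcongr
    linarith
  constructor
  · have e : (η / b) ^ 2 * n = η ^ 2 * (n / b ^ 2) := by field_simp
    rw [e]
    calc 33000 * A * 256 ^ d * κ * pL ≤ (12288 * Real.exp 1) * A * 256 ^ d * κ * pL := by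
          gcongr
          linarith
      _ = A * (2 * G) * (n / b ^ 2) := by rw [hG]; field_simp; ring
      _ ≤ η ^ 2 * (n / b ^ 2) := by gcongr
  · have hηa : 0 < η ^ a := by positivity
    have h3 : 2 * A * g ^ a ≤ η ^ a := by
      rw [rpow_two_sub hη] at h2
      have e : A * (2 * (η ^ 2 / η ^ a * g ^ a)) = η ^ 2 * (2 * A * g ^ a) / η ^ a := by ring
      rw [e, div_le_iff₀ hηa] at h2
      exact le_of_mul_le_mul_left h2 (by positivity)
    have h2d : 0 < 2 + 2 * d := by linarith
    -- Keeping only the heavy-tailed term, the square of `η` cancels and leaves `2 A g^a ≤ η^a`; the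
    -- power `1/a` removes the roots.
    have h4 : (2 * A) ^ (2 + 2 * d) * g ≤ η := by
      have h5 := Real.rpow_le_rpow (by positivity) h3 h2d.le
      rw [Real.mul_rpow (by positivity) (by positivity), ← Real.rpow_mul hg0.le,
        ← Real.rpow_mul hη.le, ha, div_mul_cancel₀ _ h2d.ne', Real.rpow_one, Real.rpow_one] at h5
      exact h5
    have e1 : (2 * A) ^ (2 + 2 * d) = 4 * A ^ 2 * (4 * A ^ 2) ^ d := by
      rw [Real.rpow_add (by positivity), Real.rpow_mul (by positivity), Real.rpow_two, mul_pow]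
      norm_num
    have e2 : (32 * A ^ 2) ^ d = (4 * A ^ 2) ^ d * 8 ^ d := by
      rw [← Real.mul_rpow (by positivity) (by norm_num)]
      congr 1; ring
    have e3 : η / b * n = η * (n / b) := by ring
    rw [e3, e2]
    calc 1000 * A ^ 2 * ((4 * A ^ 2) ^ d * 8 ^ d) * pL
        ≤ (384 * Real.exp 1) * A ^ 2 * ((4 * A ^ 2) ^ d * 8 ^ d) * pL := by
          gcongr
          linarith
      _ = (2 * A) ^ (2 + 2 * d) * g * (n / b) := by rw [e1, hg]; field_simp; ring
      _ ≤ η * (n / b) := by gcongr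

end Exponent

/-- The exponential inequality for the Yule–Walker estimator. -/
theorem measureReal_estimator_le {Ω : Type*} [MeasurableSpace Ω] {μ : Measure Ω}
    [IsProbabilityMeasure μ] {X : ℤ → ℕ → Ω → ℝ} {f : ℝ → ℝ → ℝ} {C K ρ mf Mf Mf' c d : ℝ}
    (hLS : IsLocallyStationary μ X f C) (hMix : IsGeomMixing μ X K ρ)
    (hBd : DensityBounded f mf Mf) (hDer : DensityDerivBounded f Mf')
    (hMom : BernsteinCond μ X c d)
    {p N T : ℕ} {t : ℤ} {ε C0 : ℝ} (hC0 : C0 = const0 mf Mf) (hp : 1 ≤ p) (hN : p < N)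
    (hNt : (N : ℤ) ≤ t) (htT : t ≤ T) (hT1 : 1 ≤ T)
    (hT : 2 * const1 mf Mf' C * (p : ℝ) ^ 2 ≤ (T : ℝ)) (hε : 0 < ε) (hC0pos : 0 < C0)
    (hcoer : IsCoerciveMatrix (EGammaHat μ X p N T t) (2 * Real.pi * mf - mf / 2))
    (hvec : euclNorm (EgammaHatVec μ X p N T t) ≤ 3 / 2 * Real.pi * Mf + mf / 2) :
    μ.real {ω | ¬ IsUnit (GammaHat X p N T t ω).det ∨
        ε < ‖aHat X p N T t ω - aBar μ X p N T t‖}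
      ≤ boundYW mf C0 (const1a 1 Mf c d K ρ) (const2a 1 Mf c d ρ) d p N ε := by
  have hd : 0 < d := by linarith [hMom.half_le_d]
  have hmf := hBd.pos
  have hp' : (1 : ℝ) ≤ p := by exact_mod_cast hp
  have hN' : (p : ℝ) < N := by exact_mod_cast hN
  have hη := etaYW_pos hmf hC0pos hp hε
  have hb : 0 < max (c ^ 2) (3 * Real.pi * Mf) :=
    lt_max_of_lt_left (by have := hMom.c_pos; positivity)
  have hlog : 0 < Real.log ρ := Real.log_pos hMix.one_lt_rho
  unfold boundYW
  rw [const1a_one, const2a_one]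
  set b := max (c ^ 2) (3 * Real.pi * Mf) with hbdef
  set η := etaYW mf C0 p ε with hηdef
  set A := η ^ 2 / (2 * (6144 * 256 ^ d * b ^ 2 * Real.exp 1 * (1 + 1 / Real.log ρ) * (1 + √K) *
    ((p : ℝ) / ((N : ℝ) - p)) + η ^ ((3 + 4 * d) / (2 + 2 * d)) *
      (96 * 8 ^ d * b * Real.exp 1 * (1 + 1 / Real.log ρ) * ((p : ℝ) / ((N : ℝ) - p))) ^
        (1 / (2 + 2 * d)))) with hA
  rcases le_or_gt 1 (3 * p * Real.exp (-A)) with h1 | h1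
  · exact measureReal_le_one.trans h1
  -- Since `e < 3`, an exponent below one would make the right-hand side exceed one, and that case
  -- is already settled.
  have hA1 : 1 ≤ A := by
    by_contra hlt
    have h2 : Real.exp (-1) ≤ Real.exp (-A) := Real.exp_le_exp.2 (by linarith [not_le.1 hlt])
    have h3 : 1 < 3 * Real.exp (-1) := by
      rw [Real.exp_neg, ← div_eq_mul_inv, one_lt_div (Real.exp_pos 1)]
      exact Real.exp_one_lt_three
    have h4 : 3 * Real.exp (-1) ≤ 3 * p * Real.exp (-A) := by
      calc 3 * Real.exp (-1) ≤ 3 * Real.exp (-A) := by gcongr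
        _ ≤ 3 * p * Real.exp (-A) := by
            have := Real.exp_pos (-A)
            nlinarith
    linarith
  have hn : 0 < (N : ℝ) - p := by linarith
  have hbounds := le_of_exponent (d := d) (pL := p * (1 + 1 / Real.log ρ)) (κ := 1 + √K)
    (A := A) (n := (N : ℝ) - p) hb hη (by linarith) hn hd (by positivity) (by positivity) (by
      rw [hA]; congr 3
      · ring
      · congr 2; ring)
  have hCT : C / T ≤ mf / 2 := by
    have h2 := bias_le (k := 0) hmf hDer.nonneg hLS.const_nonneg hp hT1 hT (Nat.zero_le p)
    rw [Nat.cast_zero, mul_zero, zero_add] at h2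
    refine h2.trans ?_
    gcongr
    linarith
  have hv : ∀ s, variance (X s T) μ ≤ b := fun s =>
    (variance_le hLS hBd hT1 hCT s).trans (le_max_right _ _)
  have hdev : ∀ k ∈ Finset.range (p + 1),
      μ.real {ω | 16 * η < |gammaHat X N T t k ω - ∫ ω', gammaHat X N T t k ω' ∂μ|} ≤
        Real.exp (-A) := fun k hk =>
    measureReal_gammaHat_deviation_le hT1 (fun s => hLS.measurable s T hT1) hMix hMom hb
      (le_max_left _ _) hv hp hN (by have := Finset.mem_range.1 hk; omega) hNt htT hA1 hη
      hbounds.1 hbounds.2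
  have hsub : {ω | ¬ IsUnit (GammaHat X p N T t ω).det ∨
        ε < ‖aHat X p N T t ω - aBar μ X p N T t‖} ⊆
      ⋃ k ∈ Finset.range (p + 1),
        {ω | 16 * η < |gammaHat X N T t k ω - ∫ ω', gammaHat X N T t k ω' ∂μ|} := by
    intro ω hω
    by_contra hnot
    simp only [Set.mem_iUnion, not_exists] at hnot
    have hclose := estimator_close hC0 hBd hp hε hcoer hvec (ω := ω) fun k hk =>
      not_lt.1 (hnot k (Finset.mem_range.2 (by omega)))
    rcases hω with h2 | h2
    · exact h2 hclose.1
    · exact absurd hclose.2 (not_le.2 h2)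
  calc _ ≤ _ := measureReal_mono hsub (measure_ne_top _ _)
    _ ≤ _ := measureReal_biUnion_finset_le _ _
    _ ≤ ∑ _k ∈ Finset.range (p + 1), Real.exp (-A) := Finset.sum_le_sum hdev
    _ = (p + 1) * Real.exp (-A) := by simp
    _ ≤ 3 * p * Real.exp (-A) := by gcongr; linarith

end LocalYW

theorem theorem6p1 {Ω : Type*} [MeasurableSpace Ω] (μ : MeasureTheory.Measure Ω)
    [MeasureTheory.IsProbabilityMeasure μ]
    (X : ℤ → ℕ → Ω → ℝ) (f : ℝ → ℝ → ℝ) (C K ρ mf Mf Mf' c d : ℝ)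
    (hLS : LocalYW.IsLocallyStationary μ X f C)
    (hMix : LocalYW.IsGeomMixing μ X K ρ)
    (hBd : LocalYW.DensityBounded f mf Mf)
    (hDer : LocalYW.DensityDerivBounded f Mf')
    (hMom : LocalYW.BernsteinCond μ X c d)
    (hMean : ∀ (t : ℤ) (T : ℕ), 1 ≤ T → ∫ ω, X t T ω ∂μ = 0)
    (C0 C1 C11 C21 : ℝ)
    (hC0 : C0 = LocalYW.const0 mf Mf) (hC1 : C1 = LocalYW.const1 mf Mf' C)
    (hC11 : C11 = LocalYW.const1a 1 Mf c d K ρ) (hC21 : C21 = LocalYW.const2a 1 Mf c d ρ)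
    (p N T : ℕ) (t : ℤ) (ε : ℝ)
    (hp : 1 ≤ p) (hN : p + 1 ≤ N) (hNt : (N : ℤ) ≤ t) (htT : t ≤ (T : ℤ))
    (hT : 2 * C1 * (p : ℝ) ^ 2 ≤ (T : ℝ)) (hε : 0 < ε) :
    -- the population quantity is well defined
    IsUnit (LocalYW.EGammaHat μ X p N T t).det ∧
    -- the exponential inequality (outcomes where the estimator is undefined count as deviations)
    μ.real {ω | ¬ IsUnit (LocalYW.GammaHat X p N T t ω).det ∨
        ε < ‖LocalYW.aHat X p N T t ω - LocalYW.aBar μ X p N T t‖}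
      ≤ LocalYW.boundYW mf C0 C11 C21 d p N ε ∧
    -- the three regimes
    (8 * C0 ≤ ε →
      LocalYW.boundYW mf C0 C11 C21 d p N ε ≤
        3 * p * Real.exp (-(mf ^ 2 /
          (32 * C11 * ((p : ℝ) ^ 3 / ((N : ℝ) - p)) +
            mf ^ ((3 + 4 * d) / (2 + 2 * d)) *
              ((2 : ℝ) ^ (4 + 2 * d) * C21 * ((p : ℝ) ^ 2 / ((N : ℝ) - p)))
                ^ (1 / (2 + 2 * d)))))) ∧
    (ε ≤ min (LocalYW.threshU mf C0 C11 C21 d p N) (8 * C0) →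
      LocalYW.boundYW mf C0 C11 C21 d p N ε ≤
        3 * p * Real.exp (-(ε ^ 2 * (mf ^ 2 / ((2 : ℝ) ^ 12 * C11)) *
          (C0 ^ 2 * ((p : ℝ) ^ 3 / ((N : ℝ) - p)))⁻¹))) ∧
    (ε < 8 * C0 → min (LocalYW.threshU mf C0 C11 C21 d p N) (8 * C0) ≤ ε →
      LocalYW.boundYW mf C0 C11 C21 d p N ε ≤
        3 * p * Real.exp (-(ε ^ (1 / (2 + 2 * d)) *
          (mf / ((2 : ℝ) ^ (9 + 4 * d) * C21)) ^ (1 / (2 + 2 * d)) *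
          (C0 * ((p : ℝ) ^ 2 / ((N : ℝ) - p))) ^ (-(1 / (2 + 2 * d)))))) := by
  have hd : 0 < d := by linarith [hMom.half_le_d]
  have hmf := hBd.pos
  have hM : 0 < Mf := hmf.trans_le hBd.lower_le_upper
  have hT1 : 1 ≤ T := by omega
  have hC0pos : 0 < C0 := by
    rw [hC0, LocalYW.const0]
    have := Real.pi_pos
    positivity
  have hlog : 0 < Real.log ρ := Real.log_pos hMix.one_lt_rho
  have hb : 0 < max (c ^ 2) (3 * Real.pi * Mf) :=
    lt_max_of_lt_left (by have := hMom.c_pos; positivity)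
  have hC11pos : 0 < C11 := by
    rw [hC11, LocalYW.const1a_one]
    positivity
  have hC21pos : 0 < C21 := by
    rw [hC21, LocalYW.const2a_one]
    positivity
  rw [hC1] at hT
  obtain ⟨hcoer, hvec⟩ := LocalYW.population_bounds hLS hBd hDer hMom hMean hp hN hNt htT hT1 hT
  refine ⟨hcoer.isUnit_det ?_, ?_, ?_, ?_, ?_⟩
  · have := Real.pi_gt_three
    nlinarith
  · rw [hC11, hC21]
    exact LocalYW.measureReal_estimator_le hLS hMix hBd hDer hMom hC0 hp hN hNt htT hT1 hT hε
      hC0pos hcoer hvec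
  · exact LocalYW.boundYW_le_of_ge hmf hC0pos hC21pos hd hp hN
  · exact LocalYW.boundYW_le_of_small hmf hC0pos hC11pos hC21pos hd hp hN hε
  · exact LocalYW.boundYW_le_of_large hmf hC0pos hC11pos hC21pos hd hp hN hε
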